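/- All Lie algebras are real and finite-dimensional. A pseudo-Hermitian quadratic Lie algebra is a triple $(\mathfrak g,J,\varphi)$ where $\mathfrak g$ is a Lie algebra, $J$ is a linear endomorphism of $\mathfrak g$ with $J^2=-\mathrm{id}$ and $[x,y]+J[Jx,y]+J[x,Jy]-[Jx,Jy]=0$ for all $x,y$, and $\varphi$ is a non-degenerate symmetric bilinear form on $\mathfrak g$ with $\varphi(Jx,Jy)=\varphi(x,y)$ and $\varphi([x,y],z)+\varphi(y,[x,z])=0$ for all $x,y,z$. Two such triples are equivalent if there is a Lie algebra isomorphism $\psi$ between them with $J_2\psi=\psi J_1$ and $\varphi_2(\psi x,\psi y)=\varphi_1(x,y)$. A triple is indecomposable if $\mathfrak g\neq 0$ and $\mathfrak g$ is not the orthogonal direct sum of two non-zero $J$-invariant ideals on which $\varphi$ is non-degenerate. Consider the following triples. - $\mathbb R^{0,2}$ and $\mathbb R^{2,0}$: the abelian Lie algebra $\mathbb R^2=\langle e_1,e_2\rangle$ with $Je_1=e_2$, $Je_2=-e_1$, and the standard positive definite form, respectively its opposite. - $\mathcal L^{4,2}$ and $\mathcal L^{2,4}$: the Lie algebra $\mathcal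 L$ with basis $x_1,Jx_1,x_2,Jx_2,x_3,Jx_3$ and non-zero brackets $[x_1,Jx_1]=x_2$, $[x_1,x_2]=-Jx_3$, $[Jx_1,x_2]=x_3$, the complex structure $J$ indicated by the basis, and the form with non-zero pairings $\varphi(x_1,x_3)=\varphi(Jx_1,Jx_3)=\varphi(x_2,x_2)=\varphi(Jx_2,Jx_2)=1$, respectively its opposite. - $T^*_0\mathfrak k$ and $T^*_{\theta_3}\mathfrak k$: here $\mathfrak k=\langle x_1,x_2,x_3,x_4\rangle$ is the Kodaira–Thurston algebra, with only non-zero bracket $[x_1,x_2]=x_3$ and complex structure $Jx_1=x_2$, $Jx_2=-x_1$, $Jx_3=x_4$, $Jx_4=-x_3$; for a cocycle $\theta\in Z^2(\mathfrak k,\mathfrak k^*)$ (coadjoint representation) satisfying $\theta(x,y)z=\theta(Jx,Jy)z+\theta(Jy,Jz)x+\theta(Jz,Jx)y$, the algebra $T^*_\theta\mathfrak k$ is the vector space $\mathfrak k\oplus\mathfrak k^*$ with $[x+f,y+h]=[x,y]+\theta(x,y)+f\circ\mathrm{ad}(y)-h\circ\mathrm{ad}(x)$, $J(x+f)=Jx-f\circ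 J$, $\varphi(x+f,y+h)=f(y)+h(x)$; and $\theta_3$ is the skew-symmetric cocycle with non-zero values $\theta_3(x_1,x_3)=x_4^*$, $\theta_3(x_1,x_4)=-x_3^*$, $\theta_3(x_3,x_4)=x_1^*$. Theorem. Each of these six triples is an indecomposable pseudo-Hermitian quadratic Lie algebra whose Lie algebra is nilpotent of dimension at most $8$, and every indecomposable nilpotent pseudo-Hermitian quadratic Lie algebra of dimension at most $8$ is equivalent to exactly one of the six triples $$\mathbb R^{0,2},\quad \mathbb R^{2,0},\quad \mathcal L^{4,2},\quad \mathcal L^{2,4},\quad T^*_0\mathfrak k,\quad T^*_{\theta_3}\mathfrak k .$$ -/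

import Mathlib

universe u

noncomputable section

namespace PHQ

/-- A complex structure on a real Lie algebra: `J² = -1` with vanishing Nijenhuis tensor. -/
structure IsComplexStructure {g : Type*} [LieRing g] [LieAlgebra ℝ g] (J : g →ₗ[ℝ] g) : Prop where
  sq : ∀ x, J (J x) = -x
  nijenhuis : ∀ x y : g, ⁅x, y⁆ + J ⁅J x, y⁆ + J ⁅x, J y⁆ - ⁅J x, J y⁆ = 0

/-- A quadratic structure: a non-degenerate symmetric ad-invariant bilinear form. -/
structure IsQuadratic {g : Type*} [LieRing g] [LieAlgebra ℝ g]
    (φ : LinearMap.BilinForm ℝ g) : Prop where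
  symm : ∀ x y, φ x y = φ y x
  nondegenerate : LinearMap.Nondegenerate φ
  invariant : ∀ x y z : g, φ ⁅x, y⁆ z + φ y ⁅x, z⁆ = 0

/-- A (finite-dimensional, real) pseudo-Hermitian quadratic Lie algebra `(g, J, φ)`. -/
structure PHQAlgebra where
  carrier : Type u
  [lieRing : LieRing carrier]
  [lieAlgebra : LieAlgebra ℝ carrier]
  [finite : FiniteDimensional ℝ carrier]
  J : carrier →ₗ[ℝ] carrier
  φ : LinearMap.BilinForm ℝ carrier
  isComplex : IsComplexStructure J
  isQuadratic : IsQuadratic φ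
  hermitian : ∀ x y, φ (J x) (J y) = φ x y

attribute [instance] PHQAlgebra.lieRing PHQAlgebra.lieAlgebra PHQAlgebra.finite

/-- The real dimension of the underlying Lie algebra. -/
def PHQAlgebra.dim (A : PHQAlgebra) : ℕ := Module.finrank ℝ A.carrier

/-- Nilpotency of the underlying Lie algebra. -/
def PHQAlgebra.IsNilpotent (A : PHQAlgebra) : Prop := LieRing.IsNilpotent A.carrier

/-- Equivalence: existence of a holomorphic and isometric Lie algebra isomorphism. -/
def Equivalent (A B : PHQAlgebra) : Prop :=
  ∃ ψ : A.carrier ≃ₗ⁅ℝ⁆ B.carrier,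
    (∀ x, B.J (ψ x) = ψ (A.J x)) ∧ ∀ x y, B.φ (ψ x) (ψ y) = A.φ x y

/-- An ideal which is itself pseudo-Hermitian quadratic for the restrictions of `J` and `φ`. -/
def PHQAlgebra.IsPHQIdeal (A : PHQAlgebra) (I : LieIdeal ℝ A.carrier) : Prop :=
  (∀ x ∈ I, A.J x ∈ I) ∧ ∀ x ∈ I, (∀ y ∈ I, A.φ x y = 0) → x = 0

/-- `A` is the orthogonal direct sum of two non-zero pseudo-Hermitian quadratic ideals. -/
def PHQAlgebra.IsDecomposable (A : PHQAlgebra) : Prop :=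
  ∃ I K : LieIdeal ℝ A.carrier, I ≠ ⊥ ∧ K ≠ ⊥ ∧ A.IsPHQIdeal I ∧ A.IsPHQIdeal K ∧
    (∀ x ∈ I, ∀ y ∈ K, A.φ x y = 0) ∧ IsCompl I K

/-- `A` is non-zero and does not split as a sum of two non-zero pseudo-Hermitian
quadratic ideals. -/
def PHQAlgebra.IsIndecomposable (A : PHQAlgebra) : Prop :=
  Nontrivial A.carrier ∧ ¬ A.IsDecomposable

/-- The same Lie algebra and complex structure with the opposite metric. -/
def PHQAlgebra.opposite (A : PHQAlgebra) : PHQAlgebra where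
  carrier := A.carrier
  J := A.J
  φ := -A.φ
  isComplex := A.isComplex
  isQuadratic :=
    { symm := fun x y => by simp [A.isQuadratic.symm x y]
      nondegenerate := by
        refine ⟨fun x hx => A.isQuadratic.nondegenerate.1 x fun y => ?_,
          fun y hy => A.isQuadratic.nondegenerate.2 y fun x => ?_⟩
        · simpa using hx y
        · simpa using hy x
      invariant := fun x y z => by
        have := A.isQuadratic.invariant x y z
        simp only [LinearMap.neg_apply]
        linarith }
  hermitian := fun x y => by simp [A.hermitian x y]

/-! ### The abelian algebra of dimension two -/

/-- The abelian Lie algebra on `ℝ²`. -/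
def Plane : Type := Fin 2 → ℝ

namespace Plane

instance : AddCommGroup Plane := inferInstanceAs (AddCommGroup (Fin 2 → ℝ))
instance : Module ℝ Plane := inferInstanceAs (Module ℝ (Fin 2 → ℝ))
instance : FiniteDimensional ℝ Plane := inferInstanceAs (FiniteDimensional ℝ (Fin 2 → ℝ))

/-- The zero bracket. -/
instance : LieRing Plane where
  bracket _ _ := 0
  add_lie _ _ _ := (add_zero 0).symm
  lie_add _ _ _ := (add_zero 0).symm
  lie_self _ := rfl
  leibniz_lie _ _ _ := (add_zero 0).symm

instance : LieAlgebra ℝ Plane where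
  lie_smul t _ _ := (smul_zero t).symm

/-- `J e₁ = e₂`, `J e₂ = -e₁`. -/
def J : Plane →ₗ[ℝ] Plane where
  toFun x := ![-x 1, x 0]
  map_add' x y := by
    funext i; fin_cases i
    · exact neg_add (x 1) (y 1)
    · rfl
  map_smul' t x := by
    funext i; fin_cases i
    · exact (mul_neg t (x 1)).symm
    · rfl

/-- The standard positive definite form. -/
def φ : LinearMap.BilinForm ℝ Plane :=
  LinearMap.mk₂ ℝ (fun x y : Plane => x 0 * y 0 + x 1 * y 1)
    (fun x x' y => by
      change (x 0 + x' 0) * y 0 + (x 1 + x' 1) * y 1 = _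
      ring)
    (fun t x y => by
      change (t * x 0) * y 0 + (t * x 1) * y 1 = t * (_ + _)
      ring)
    (fun x y y' => by
      change x 0 * (y 0 + y' 0) + x 1 * (y 1 + y' 1) = _
      ring)
    (fun t x y => by
      change x 0 * (t * y 0) + x 1 * (t * y 1) = t * (_ + _)
      ring)

end Plane

/-- `ℝ^{0,2}`: the abelian algebra `ℝ²` with a positive definite metric. -/
def R02 : PHQAlgebra where
  carrier := Plane
  J := Plane.J
  φ := Plane.φ
  isComplex :=
    { sq := fun x => by funext i; fin_cases i <;> rfl
      nijenhuis := fun x y => by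
        change (0 : Plane) + Plane.J 0 + Plane.J 0 - 0 = 0
        simp }
  isQuadratic :=
    { symm := fun x y => by
        change x 0 * y 0 + x 1 * y 1 = y 0 * x 0 + y 1 * x 1
        ring
      nondegenerate := by
        have key : ∀ x : Plane, x 0 * x 0 + x 1 * x 1 = 0 → x = 0 := by
          intro x h
          funext i
          fin_cases i
          · change x 0 = 0
            nlinarith [mul_self_nonneg (x 0), mul_self_nonneg (x 1)]
          · change x 1 = 0
            nlinarith [mul_self_nonneg (x 0), mul_self_nonneg (x 1)]
        exact ⟨fun x hx => key x (hx x), fun y hy => key y (hy y)⟩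
      invariant := fun x y z => by
        change Plane.φ 0 z + Plane.φ y 0 = 0
        simp }
  hermitian := fun x y => by
    change (-x 1) * (-y 1) + x 0 * y 0 = x 0 * y 0 + x 1 * y 1
    ring

/-- `ℝ^{2,0}`: the abelian algebra `ℝ²` with a negative definite metric. -/
def R20 : PHQAlgebra := R02.opposite

/-! ### The six-dimensional algebra `𝓛` -/

/-- The underlying space of `𝓛`, in the basis `x₁, Jx₁, x₂, Jx₂, x₃, Jx₃`. -/
def LSpace : Type := Fin 6 → ℝ

namespace LSpace

instance : AddCommGroup LSpace := inferInstanceAs (AddCommGroup (Fin 6 → ℝ))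
instance : Module ℝ LSpace := inferInstanceAs (Module ℝ (Fin 6 → ℝ))
instance : FiniteDimensional ℝ LSpace := inferInstanceAs (FiniteDimensional ℝ (Fin 6 → ℝ))

@[simp] theorem add_apply (x y : LSpace) (i : Fin 6) : (x + y) i = x i + y i := rfl
@[simp] theorem neg_apply (x : LSpace) (i : Fin 6) : (-x) i = -x i := rfl
@[simp] theorem sub_apply (x y : LSpace) (i : Fin 6) : (x - y) i = x i - y i := rfl
@[simp] theorem zero_apply (i : Fin 6) : (0 : LSpace) i = 0 := rfl
@[simp] theorem smul_apply (t : ℝ) (x : LSpace) (i : Fin 6) : (t • x) i = t * x i := rfl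

@[ext] theorem ext {x y : LSpace} (h0 : x 0 = y 0) (h1 : x 1 = y 1) (h2 : x 2 = y 2)
    (h3 : x 3 = y 3) (h4 : x 4 = y 4) (h5 : x 5 = y 5) : x = y := by
  funext i; fin_cases i <;> assumption

/-- `[x₁, Jx₁] = x₂`, `[x₁, x₂] = -Jx₃`, `[Jx₁, x₂] = x₃`. -/
instance : Bracket LSpace LSpace where
  bracket x y := ![0, 0, x 0 * y 1 - x 1 * y 0, 0,
    x 1 * y 2 - x 2 * y 1, -(x 0 * y 2 - x 2 * y 0)]

@[simp] theorem lie_0 (x y : LSpace) : ⁅x, y⁆ 0 = 0 := rfl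
@[simp] theorem lie_1 (x y : LSpace) : ⁅x, y⁆ 1 = 0 := rfl
@[simp] theorem lie_2 (x y : LSpace) : ⁅x, y⁆ 2 = x 0 * y 1 - x 1 * y 0 := rfl
@[simp] theorem lie_3 (x y : LSpace) : ⁅x, y⁆ 3 = 0 := rfl
@[simp] theorem lie_4 (x y : LSpace) : ⁅x, y⁆ 4 = x 1 * y 2 - x 2 * y 1 := rfl
@[simp] theorem lie_5 (x y : LSpace) : ⁅x, y⁆ 5 = -(x 0 * y 2 - x 2 * y 0) := rfl

instance : LieRing LSpace where
  add_lie x y z := by ext <;> simp <;> ring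
  lie_add x y z := by ext <;> simp <;> ring
  lie_self x := by ext <;> simp [mul_comm]
  leibniz_lie x y z := by ext <;> simp <;> ring

instance : LieAlgebra ℝ LSpace where
  lie_smul t x y := by ext <;> simp <;> ring

/-- The complex structure, `x_i ↦ Jx_i ↦ -x_i`. -/
def J : LSpace →ₗ[ℝ] LSpace where
  toFun x := ![-x 1, x 0, -x 3, x 2, -x 5, x 4]
  map_add' x y := by
    funext i; fin_cases i
    all_goals first | rfl | exact neg_add (x _) (y _)
  map_smul' t x := by
    funext i; fin_cases i
    all_goals first | rfl | exact (mul_neg t (x _)).symm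

@[simp] theorem J_0 (x : LSpace) : J x 0 = -x 1 := rfl
@[simp] theorem J_1 (x : LSpace) : J x 1 = x 0 := rfl
@[simp] theorem J_2 (x : LSpace) : J x 2 = -x 3 := rfl
@[simp] theorem J_3 (x : LSpace) : J x 3 = x 2 := rfl
@[simp] theorem J_4 (x : LSpace) : J x 4 = -x 5 := rfl
@[simp] theorem J_5 (x : LSpace) : J x 5 = x 4 := rfl

/-- `φ(x₁, x₃) = φ(Jx₁, Jx₃) = 1`, `φ(x₂, x₂) = φ(Jx₂, Jx₂) = 1`. -/
def φ : LinearMap.BilinForm ℝ LSpace :=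
  LinearMap.mk₂ ℝ (fun x y : LSpace =>
      x 0 * y 4 + x 4 * y 0 + x 1 * y 5 + x 5 * y 1 + x 2 * y 2 + x 3 * y 3)
    (fun x x' y => by simp; ring) (fun t x y => by simp; ring)
    (fun x y y' => by simp; ring) (fun t x y => by simp; ring)

theorem φ_apply (x y : LSpace) :
    φ x y = x 0 * y 4 + x 4 * y 0 + x 1 * y 5 + x 5 * y 1 + x 2 * y 2 + x 3 * y 3 := rfl

end LSpace

/-- `𝓛` with its Lorentz-Hermitian metric. -/
def L42 : PHQAlgebra where
  carrier := LSpace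
  J := LSpace.J
  φ := LSpace.φ
  isComplex :=
    { sq := fun x => by ext <;> simp
      nijenhuis := fun x y => by ext <;> simp <;> ring }
  isQuadratic :=
    { symm := fun x y => by simp only [LSpace.φ_apply]; ring
      nondegenerate := by
        have key : ∀ x : LSpace, (∀ y, LSpace.φ x y = 0) → x = 0 := by
          intro x h
          have h' : ∀ y : Fin 6 → ℝ, x 0 * y 4 + x 4 * y 0 + x 1 * y 5 + x 5 * y 1
            + x 2 * y 2 + x 3 * y 3 = 0 := fun y => h y
          apply LSpace.ext
          · simpa using h' ![0, 0, 0, 0, 1, 0]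
          · simpa using h' ![0, 0, 0, 0, 0, 1]
          · simpa using h' ![0, 0, 1, 0, 0, 0]
          · simpa using h' ![0, 0, 0, 1, 0, 0]
          · simpa using h' ![1, 0, 0, 0, 0, 0]
          · simpa using h' ![0, 1, 0, 0, 0, 0]
        refine ⟨key, fun y hy => key y fun x => ?_⟩
        have := hy x
        simp only [LSpace.φ_apply] at this ⊢
        linarith
      invariant := fun x y z => by simp [LSpace.φ_apply]; ring }
  hermitian := fun x y => by simp [LSpace.φ_apply]; ring

/-- `𝓛` with the opposite of its Lorentz-Hermitian metric. -/
def L24 : PHQAlgebra := L42.opposite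

/-! ### `T*`-extensions -/

/-- A 2-cocycle of `g` with values in the coadjoint module `g*`, compatible with `J`. -/
structure TStarCocycle {g : Type*} [LieRing g] [LieAlgebra ℝ g] (J : g →ₗ[ℝ] g) where
  θ : g →ₗ[ℝ] g →ₗ[ℝ] Module.Dual ℝ g
  alt : ∀ x, θ x x = 0
  /-- the Chevalley-Eilenberg condition `dθ(x, y, z) = 0` evaluated at `w`, for the
  coadjoint action `x · f = -f ∘ ad x` -/
  cocycle : ∀ x y z w,
    -θ y z ⁅x, w⁆ + θ x z ⁅y, w⁆ - θ x y ⁅z, w⁆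
      - θ ⁅x, y⁆ z w + θ ⁅x, z⁆ y w - θ ⁅y, z⁆ x w = 0
  compat : ∀ x y z,
    θ x y z = θ (J x) (J y) z + θ (J y) (J z) x + θ (J z) (J x) y

namespace TStarCocycle

variable {g : Type*} [LieRing g] [LieAlgebra ℝ g] {J : g →ₗ[ℝ] g}

theorem skew (c : TStarCocycle J) (x y : g) : c.θ x y = -c.θ y x := by
  have h := c.alt (x + y)
  simp only [map_add, LinearMap.add_apply, c.alt, zero_add, add_zero] at h
  exact eq_neg_of_add_eq_zero_right h

theorem cyclic (c : TStarCocycle J) (x y z : g) : c.θ x y z = c.θ y z x := by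
  rw [c.compat x y z, c.compat y z x]; ring

/-- The zero cocycle. -/
def zero (J : g →ₗ[ℝ] g) : TStarCocycle J where
  θ := 0
  alt _ := rfl
  cocycle _ _ _ _ := by simp
  compat _ _ _ := by simp

end TStarCocycle

/-- The vector space `g ⊕ g*` underlying the `T*`-extension of `g` by `c`. -/
def TStar {g : Type*} [LieRing g] [LieAlgebra ℝ g] {J : g →ₗ[ℝ] g} (_c : TStarCocycle J) : Type _ :=
  g × Module.Dual ℝ g

namespace TStar

variable {g : Type*} [LieRing g] [LieAlgebra ℝ g] {J : g →ₗ[ℝ] g} (c : TStarCocycle J)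

instance : AddCommGroup (TStar c) := inferInstanceAs (AddCommGroup (g × Module.Dual ℝ g))
instance : Module ℝ (TStar c) := inferInstanceAs (Module ℝ (g × Module.Dual ℝ g))
instance [FiniteDimensional ℝ g] : FiniteDimensional ℝ (TStar c) :=
  inferInstanceAs (FiniteDimensional ℝ (g × Module.Dual ℝ g))

variable {c}

@[simp] theorem add_fst (x y : TStar c) : (x + y).1 = x.1 + y.1 := rfl
@[simp] theorem add_snd (x y : TStar c) : (x + y).2 = x.2 + y.2 := rfl
@[simp] theorem sub_fst (x y : TStar c) : (x - y).1 = x.1 - y.1 := rfl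
@[simp] theorem sub_snd (x y : TStar c) : (x - y).2 = x.2 - y.2 := rfl
@[simp] theorem neg_fst (x : TStar c) : (-x).1 = -x.1 := rfl
@[simp] theorem neg_snd (x : TStar c) : (-x).2 = -x.2 := rfl
@[simp] theorem zero_fst : (0 : TStar c).1 = 0 := rfl
@[simp] theorem zero_snd : (0 : TStar c).2 = 0 := rfl
@[simp] theorem smul_fst (t : ℝ) (x : TStar c) : (t • x).1 = t • x.1 := rfl
@[simp] theorem smul_snd (t : ℝ) (x : TStar c) : (t • x).2 = t • x.2 := rfl

theorem ext {x y : TStar c} (h1 : x.1 = y.1) (h2 : ∀ w, x.2 w = y.2 w) : x = y :=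
  Prod.ext h1 (LinearMap.ext h2)

/-- `[x + f, y + h] = [x, y] + θ(x, y) + f ∘ ad y - h ∘ ad x`. -/
instance : Bracket (TStar c) (TStar c) where
  bracket x y := (⁅x.1, y.1⁆,
    c.θ x.1 y.1 + x.2 ∘ₗ (LieAlgebra.ad ℝ g y.1 : g →ₗ[ℝ] g)
      - y.2 ∘ₗ (LieAlgebra.ad ℝ g x.1 : g →ₗ[ℝ] g))

@[simp] theorem lie_fst (x y : TStar c) : ⁅x, y⁆.1 = ⁅x.1, y.1⁆ := rfl
@[simp] theorem lie_snd (x y : TStar c) (w : g) :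
    ⁅x, y⁆.2 w = c.θ x.1 y.1 w + x.2 ⁅y.1, w⁆ - y.2 ⁅x.1, w⁆ := rfl

instance : LieRing (TStar c) where
  add_lie x y z := by
    apply TStar.ext
    · simp
    · intro w; simp; ring
  lie_add x y z := by
    apply TStar.ext
    · simp
    · intro w; simp; ring
  lie_self x := by
    apply TStar.ext
    · simp
    · intro w; simp [c.alt]
  leibniz_lie x y z := by
    apply TStar.ext
    · simp
    · intro w
      have h := c.cocycle x.1 y.1 z.1 w
      have h1 := LinearMap.congr_fun (c.skew x.1 ⁅y.1, z.1⁆) w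
      have h2 := LinearMap.congr_fun (c.skew y.1 ⁅x.1, z.1⁆) w
      simp only [LinearMap.neg_apply] at h1 h2
      simp only [lie_snd, lie_fst, add_snd, LinearMap.add_apply, lie_lie, map_sub]
      linarith

instance : LieAlgebra ℝ (TStar c) where
  lie_smul t x y := by
    apply TStar.ext
    · simp
    · intro w; simp; ring

variable (c)

/-- `J_T (x + f) = J x - f ∘ J`. -/
def JT : TStar c →ₗ[ℝ] TStar c where
  toFun x := (J x.1, -(x.2 ∘ₗ J))
  map_add' x y := by
    apply TStar.ext
    · exact map_add J x.1 y.1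
    · intro w; exact neg_add (x.2 (J w)) (y.2 (J w))
  map_smul' t x := by
    apply TStar.ext
    · exact map_smul J t x.1
    · intro w; exact (mul_neg t (x.2 (J w))).symm

/-- `φ (x + f, y + h) = f y + h x`. -/
def φT : LinearMap.BilinForm ℝ (TStar c) :=
  LinearMap.mk₂ ℝ (fun x y : TStar c => x.2 y.1 + y.2 x.1)
    (fun x x' y => by simp; ring) (fun t x y => by simp; ring)
    (fun x y y' => by simp; ring) (fun t x y => by simp; ring)

variable {c}

@[simp] theorem JT_fst (x : TStar c) : (JT c x).1 = J x.1 := rfl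
@[simp] theorem JT_snd (x : TStar c) (w : g) : (JT c x).2 w = -x.2 (J w) := rfl
theorem φT_apply (x y : TStar c) : φT c x y = x.2 y.1 + y.2 x.1 := rfl

/-- The `T*`-extension of `(g, J)` by `c`, as a pseudo-Hermitian quadratic Lie algebra. -/
def alg [FiniteDimensional ℝ g] (hJ : IsComplexStructure J) (c : TStarCocycle J) :
    PHQAlgebra where
  carrier := TStar c
  J := JT c
  φ := φT c
  isComplex :=
    { sq := fun x => by
        apply TStar.ext
        · exact hJ.sq x.1
        · intro w; simp [hJ.sq]
      nijenhuis := fun x y => by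
        apply TStar.ext
        · exact hJ.nijenhuis x.1 y.1
        · intro w
          have hx := congrArg x.2 (hJ.nijenhuis y.1 w)
          have hy := congrArg y.2 (hJ.nijenhuis x.1 w)
          have h := c.compat x.1 y.1 w
          have h1 := c.cyclic (J w) (J x.1) y.1
          have h2 := c.cyclic (J y.1) (J w) x.1
          have h3 := c.cyclic x.1 (J y.1) (J w)
          simp only [map_add, map_sub, map_zero] at hx hy
          simp only [sub_snd, add_snd, lie_snd, JT_snd, JT_fst, LinearMap.sub_apply,
            LinearMap.add_apply, zero_snd, LinearMap.zero_apply]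
          linarith }
  isQuadratic :=
    { symm := fun x y => by simp only [φT_apply]; ring
      nondegenerate := by
        have key : ∀ x : TStar c, (∀ y, φT c x y = 0) → x = 0 := by
          intro x h
          apply TStar.ext
          · rw [zero_fst, ← Module.forall_dual_apply_eq_zero_iff ℝ]
            intro f
            have h0 : x.2 0 + f x.1 = 0 := h ((0, f) : g × Module.Dual ℝ g)
            simpa using h0
          · intro w
            have h0 : x.2 w + (0 : Module.Dual ℝ g) x.1 = 0 := h ((w, 0) : g × Module.Dual ℝ g)
            simpa using h0
        refine ⟨key, fun y hy => key y fun x => ?_⟩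
        have := hy x
        simp only [φT_apply] at this ⊢
        linarith
      invariant := fun x y z => by
        have h1 := c.cyclic x.1 y.1 z.1
        have h2 := c.cyclic x.1 z.1 y.1
        have h3 := c.cyclic y.1 z.1 x.1
        have h4 := LinearMap.congr_fun (c.skew x.1 z.1) y.1
        have h5 : y.2 ⁅z.1, x.1⁆ = -y.2 ⁅x.1, z.1⁆ := by rw [← lie_skew, map_neg]
        have h6 : z.2 ⁅y.1, x.1⁆ = -z.2 ⁅x.1, y.1⁆ := by rw [← lie_skew, map_neg]
        have h7 : x.2 ⁅z.1, y.1⁆ = -x.2 ⁅y.1, z.1⁆ := by rw [← lie_skew, map_neg]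
        simp only [LinearMap.neg_apply] at h4
        simp only [φT_apply, lie_snd, lie_fst]
        linarith }
  hermitian := fun x y => by simp [φT_apply, hJ.sq]

end TStar

/-! ### The Kodaira-Thurston algebra -/

/-- The underlying space of the Kodaira-Thurston algebra, in the basis `x₁, x₂, x₃, x₄`. -/
def KT : Type := Fin 4 → ℝ

namespace KT

instance : AddCommGroup KT := inferInstanceAs (AddCommGroup (Fin 4 → ℝ))
instance : Module ℝ KT := inferInstanceAs (Module ℝ (Fin 4 → ℝ))
instance : FiniteDimensional ℝ KT := inferInstanceAs (FiniteDimensional ℝ (Fin 4 → ℝ))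

@[simp] theorem add_apply (x y : KT) (i : Fin 4) : (x + y) i = x i + y i := rfl
@[simp] theorem neg_apply (x : KT) (i : Fin 4) : (-x) i = -x i := rfl
@[simp] theorem sub_apply (x y : KT) (i : Fin 4) : (x - y) i = x i - y i := rfl
@[simp] theorem zero_apply (i : Fin 4) : (0 : KT) i = 0 := rfl
@[simp] theorem smul_apply (t : ℝ) (x : KT) (i : Fin 4) : (t • x) i = t * x i := rfl

@[ext] theorem ext {x y : KT} (h0 : x 0 = y 0) (h1 : x 1 = y 1) (h2 : x 2 = y 2)
    (h3 : x 3 = y 3) : x = y := by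
  funext i; fin_cases i <;> assumption

/-- The only non-trivial bracket is `[x₁, x₂] = x₃`. -/
instance : Bracket KT KT where
  bracket x y := ![0, 0, x 0 * y 1 - x 1 * y 0, 0]

@[simp] theorem lie_0 (x y : KT) : ⁅x, y⁆ 0 = 0 := rfl
@[simp] theorem lie_1 (x y : KT) : ⁅x, y⁆ 1 = 0 := rfl
@[simp] theorem lie_2 (x y : KT) : ⁅x, y⁆ 2 = x 0 * y 1 - x 1 * y 0 := rfl
@[simp] theorem lie_3 (x y : KT) : ⁅x, y⁆ 3 = 0 := rfl

instance : LieRing KT where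
  add_lie x y z := by ext <;> simp <;> ring
  lie_add x y z := by ext <;> simp <;> ring
  lie_self x := by ext <;> simp [mul_comm]
  leibniz_lie x y z := by ext <;> simp

instance : LieAlgebra ℝ KT where
  lie_smul t x y := by ext <;> simp <;> ring

/-- `Jx₁ = x₂`, `Jx₂ = -x₁`, `Jx₃ = x₄`, `Jx₄ = -x₃`. -/
def J : KT →ₗ[ℝ] KT where
  toFun x := ![-x 1, x 0, -x 3, x 2]
  map_add' x y := by
    funext i; fin_cases i
    all_goals first | rfl | exact neg_add (x _) (y _)
  map_smul' t x := by
    funext i; fin_cases i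
    all_goals first | rfl | exact (mul_neg t (x _)).symm

@[simp] theorem J_0 (x : KT) : J x 0 = -x 1 := rfl
@[simp] theorem J_1 (x : KT) : J x 1 = x 0 := rfl
@[simp] theorem J_2 (x : KT) : J x 2 = -x 3 := rfl
@[simp] theorem J_3 (x : KT) : J x 3 = x 2 := rfl

theorem isComplexStructure : IsComplexStructure J where
  sq x := by ext <;> simp
  nijenhuis x y := by ext <;> simp <;> ring

/-- `θ₃(x₁, x₃) = x₄*`, `θ₃(x₁, x₄) = -x₃*`, `θ₃(x₃, x₄) = x₁*`. -/
def θ₃ : TStarCocycle J where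
  θ := LinearMap.mk₂ ℝ
    (fun x y : KT =>
      ({ toFun := fun z => (x 0 * y 2 - x 2 * y 0) * z 3 - (x 0 * y 3 - x 3 * y 0) * z 2
            + (x 2 * y 3 - x 3 * y 2) * z 0
         map_add' := fun z z' => by simp; ring
         map_smul' := fun t z => by simp; ring } : Module.Dual ℝ KT))
    (fun x x' y => by apply LinearMap.ext; intro z; simp; ring)
    (fun t x y => by apply LinearMap.ext; intro z; simp; ring)
    (fun x y y' => by apply LinearMap.ext; intro z; simp; ring)
    (fun t x y => by apply LinearMap.ext; intro z; simp; ring)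
  alt x := by apply LinearMap.ext; intro z; simp; ring
  cocycle x y z w := by simp; ring
  compat x y z := by simp; ring

end KT

/-- `T*_0 𝔨`. -/
def T0k : PHQAlgebra := TStar.alg KT.isComplexStructure (TStarCocycle.zero KT.J)

/-- `T*_{θ₃} 𝔨`. -/
def Tθ₃k : PHQAlgebra := TStar.alg KT.isComplexStructure KT.θ₃

/-- The labels of the six algebras of the list. -/
inductive Label
  | R02 | R20 | L42 | L24 | T0k | Tθ₃k

/-- The six pseudo-Hermitian quadratic Lie algebras of the list. -/
def Label.alg : Label → PHQAlgebra.{0}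
  | .R02 => PHQ.R02
  | .R20 => PHQ.R20
  | .L42 => PHQ.L42
  | .L24 => PHQ.L24
  | .T0k => PHQ.T0k
  | .Tθ₃k => PHQ.Tθ₃k

end PHQ

end

namespace PHQ

/-! ### Linear algebra and nilpotency -/

/-! Everything is read off from complex lines spanned by `z` and `J z` that are both central. If `φ
z z ≠ 0`, such a line is an orthogonal direct factor, so indecomposability leaves only a plane, and
the sign of `φ z z` decides between `R02` and `R20`. Otherwise all these lines are isotropic
(`HasIsotropicCenter`).

In dimension at most 8 a central complex line exists (`exists_isCentral_isCentral_J`). If the centre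
Z met JZ trivially, nilpotency would supply independent central `z₁, z₂` and a vector `e` with dual
`a` such that these four vectors and their `J`-images exhaust the dimension. Each `ad (J z)` with
`z` in the span of `z₁, z₂` would be determined by one real number, so it would vanish for some
non-zero `z`, a contradiction.

For an isotropic central `z` with isotropic dual `a`, the space `perp a z` models the orthogonal of
the line modulo the line, and the algebra acts on it by nilpotent skew maps. If the action is
trivial (`IsFlat`), the bracket is determined by the single vector `r = ⁅a, J a⁆`. Vectors
complex-orthogonal to `r` give central lines, hence are isotropic. So `r ≠ 0`; a non-isotropic `r`
spans `perp a z` over the complex numbers and gives 𝓛 up to the sign of the form; an isotropic `r`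
gives `T0k`.

If the action is non-trivial, it still annihilates a non-zero vector of `perp a z`
(`exists_isReduced`). A non-isotropic one is impossible: integrability of `J`, the Jacobi identity
and nilpotency would kill the whole action (`isFlat_of_isReduced`). An isotropic one, `r`, has `J r`
annihilated too (`isReduced_J`), and the action reduces to two numbers `t, t'`, not both zero.
Complex rescalings and a shear of the frame then leave exactly `T0k` and `Tθ₃k` (`equivalent_or`).

Conversely, in each model a distinguished vector must lie in one summand of any splitting, and
orthogonality with a few brackets empties the other summand. Dimension, the sign of the form and the
nilpotency step separate the models. -/

theorem eq_top_of_linearIndependent {V : Type*} [AddCommGroup V] [Module ℝ V]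
    [FiniteDimensional ℝ V] {n : ℕ} {v : Fin n → V} (hv : LinearIndependent ℝ v)
    (hn : Module.finrank ℝ V ≤ n) (p : Submodule ℝ V) (hp : ∀ i, v i ∈ p) : p = ⊤ := by
  have h1 : Fintype.card (Fin n) ≤ Module.finrank ℝ V := hv.fintype_card_le_finrank
  have h2 : Submodule.span ℝ (Set.range v) = ⊤ :=
    hv.span_eq_top_of_card_eq_finrank' (le_antisymm h1 (by simpa using hn))
  rw [eq_top_iff, ← h2, Submodule.span_le]
  rintro _ ⟨i, rfl⟩
  exact hp i

/-- Modulo the invariant subspace, `f ^ k x` is congruent to `μ ^ k x`; a nilpotent map has no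
non-zero eigenvalue on a quotient. -/
theorem eq_zero_of_sub_smul_mem {V : Type*} [AddCommGroup V] [Module ℝ V]
    {f : Module.End ℝ V} (hf : IsNilpotent f) {N : Submodule ℝ V} (hN : ∀ x ∈ N, f x ∈ N)
    {x : V} (hx : x ∉ N) {μ : ℝ} (h : f x - μ • x ∈ N) : μ = 0 := by
  have key : ∀ k : ℕ, (f ^ k) x - μ ^ k • x ∈ N := by
    intro k
    induction k with
    | zero => simp
    | succ k ih =>
      have h1 := N.add_mem (hN _ ih) (N.smul_mem (μ ^ k) h)
      convert h1 using 1
      rw [pow_succ' f, Module.End.mul_apply, map_sub, map_smul, pow_succ]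
      module
  obtain ⟨k, hk⟩ := hf
  have h1 := key k
  rw [hk] at h1
  by_contra hμ
  apply hx
  have h2 := N.smul_mem (-(μ ^ k)⁻¹) h1
  have h3 : μ ^ k ≠ 0 := pow_ne_zero _ hμ
  convert h2 using 1
  rw [LinearMap.zero_apply, zero_sub, smul_neg, neg_smul, neg_neg, smul_smul, inv_mul_cancel₀ h3,
    one_smul]

/-- Packages the lower central series as plain subspaces, so that descents can be run as inductions
ending at `⊥`. -/
theorem exists_lowerCentralSeries {g : Type*} [LieRing g] [LieAlgebra ℝ g]
    (hg : LieRing.IsNilpotent g) :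
    ∃ S : ℕ → Submodule ℝ g, S 0 = ⊤ ∧ (∀ (k : ℕ) (x y : g), y ∈ S k → ⁅x, y⁆ ∈ S (k + 1)) ∧
      ∃ k, S k = ⊥ := by
  refine ⟨fun k => (LieModule.lowerCentralSeries ℝ g g k : Submodule ℝ g), by simp, ?_, ?_⟩
  · intro k x y hy
    have := LieSubmodule.lie_mem_lie (I := (⊤ : LieIdeal ℝ g)) (LieSubmodule.mem_top x) hy
    simpa [LieModule.lowerCentralSeries_succ] using this
  · have h : LieModule.IsNilpotent g g := hg
    rw [LieModule.isNilpotent_iff ℝ] at h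
    obtain ⟨k, hk⟩ := h
    exact ⟨k, by simp [hk]⟩

theorem isNilpotent_of_lie_lie_lie {g : Type*} [LieRing g] [LieAlgebra ℝ g]
    (h : ∀ x y z w : g, ⁅x, ⁅y, ⁅z, w⁆⁆⁆ = 0) : LieRing.IsNilpotent g := by
  have h3 : (⊥ : LieSubmodule ℝ g g).ucs 3 = ⊤ := by
    rw [eq_top_iff]
    intro w _
    simp only [LieSubmodule.ucs_succ, LieSubmodule.ucs_zero, LieSubmodule.mem_normalizer,
      LieSubmodule.mem_bot]
    exact fun z y x => h x y z w
  rw [LieSubmodule.ucs_eq_top_iff, le_bot_iff] at h3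
  exact (LieModule.isNilpotent_iff ℝ g g).2 ⟨3, h3⟩

/-- In a nilpotent Lie algebra, a subspace `K` stable under a family of adjoint maps and not
contained in `N` has a vector outside `N` which the family maps into `N`. -/
theorem exists_forall_lie_mem {g : Type*} [LieRing g] [LieAlgebra ℝ g]
    (hg : LieRing.IsNilpotent g) (T : Set g) (K N : Submodule ℝ g)
    (hK : ∀ y ∈ T, ∀ x ∈ K, ⁅y, x⁆ ∈ K) {x₀ : g} (h0 : x₀ ∈ K) (h0' : x₀ ∉ N) :
    ∃ x ∈ K, x ∉ N ∧ ∀ y ∈ T, ⁅y, x⁆ ∈ N := by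
  by_contra! hcon
  obtain ⟨S, hS0, hS, k, hk⟩ := exists_lowerCentralSeries hg
  -- If every vector of `K` outside `N` could be bracketed to another one outside `N`, such vectors
  -- would persist down the lower central series.
  have key : ∀ k, ∃ x ∈ K, x ∉ N ∧ x ∈ S k := by
    intro k
    induction k with
    | zero => exact ⟨x₀, h0, h0', by simp [hS0]⟩
    | succ k ih =>
      obtain ⟨x, hx, hxN, hxS⟩ := ih
      obtain ⟨y, hy, hyx⟩ := hcon x hx hxN
      exact ⟨⁅y, x⁆, hK y hy x hx, hyx, hS k y x hxS⟩
  obtain ⟨x, -, hxN, hxS⟩ := key k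
  rw [hk, Submodule.mem_bot] at hxS
  exact hxN (hxS ▸ N.zero_mem)

theorem eq_zero_of_lie_sub_smul_mem {g : Type*} [LieRing g] [LieAlgebra ℝ g]
    (hg : LieRing.IsNilpotent g) {N : Submodule ℝ g} {y x : g} (hN : ∀ w ∈ N, ⁅y, w⁆ ∈ N)
    (hx : x ∉ N) {μ : ℝ} (h : ⁅y, x⁆ - μ • x ∈ N) : μ = 0 := by
  have h1 : IsNilpotent (LieAlgebra.ad ℝ g y) :=
    LieModule.isNilpotent_toEnd_of_isNilpotent ℝ g g y
  exact eq_zero_of_sub_smul_mem h1 hN hx h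

/-- The squared version detects infinitesimal rotations, which have no real eigenvector but whose
square is a scalar. -/
theorem eq_zero_of_lie_lie_sub_smul_mem {g : Type*} [LieRing g] [LieAlgebra ℝ g]
    (hg : LieRing.IsNilpotent g) {N : Submodule ℝ g} {y x : g} (hN : ∀ w ∈ N, ⁅y, w⁆ ∈ N)
    (hx : x ∉ N) {μ : ℝ} (h : ⁅y, ⁅y, x⁆⁆ - μ • x ∈ N) : μ = 0 := by
  have h1 : IsNilpotent (LieAlgebra.ad ℝ g y) :=
    LieModule.isNilpotent_toEnd_of_isNilpotent ℝ g g y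
  exact eq_zero_of_sub_smul_mem (f := LieAlgebra.ad ℝ g y ^ 2) (h1.pow_of_pos two_ne_zero)
    (fun w hw => by
      rw [pow_two, Module.End.mul_apply]; exact hN _ (hN _ hw)) hx
    (by rw [pow_two, Module.End.mul_apply]; exact h)

/-! ### Identities for `J`, `φ` and the bracket; central vectors and dual vectors -/

namespace PHQAlgebra

variable (A : PHQAlgebra.{u})

theorem J_sq (x : A.carrier) : A.J (A.J x) = -x := A.isComplex.sq x

theorem φ_symm (x y : A.carrier) : A.φ x y = A.φ y x := A.isQuadratic.symm x y

theorem φ_J_left (x y : A.carrier) : A.φ (A.J x) y = -A.φ x (A.J y) := by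
  have h := A.hermitian x (A.J y)
  rw [A.J_sq, map_neg] at h
  linarith

theorem φ_J_J (x y : A.carrier) : A.φ (A.J x) (A.J y) = A.φ x y := A.hermitian x y

theorem φ_self_J (x : A.carrier) : A.φ x (A.J x) = 0 := by
  have h1 := A.φ_J_left x x
  have h2 := A.φ_symm x (A.J x)
  linarith

theorem φ_J_self (x : A.carrier) : A.φ (A.J x) x = 0 := by
  rw [A.φ_symm, A.φ_self_J]

theorem eq_zero_of_φ {x : A.carrier} (h : ∀ y, A.φ x y = 0) : x = 0 :=
  A.isQuadratic.nondegenerate.1 x h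

theorem φ_lie (x y z : A.carrier) : A.φ ⁅x, y⁆ z = -A.φ y ⁅x, z⁆ := by
  have := A.isQuadratic.invariant x y z
  linarith

/-- With ad-invariance, this makes `φ ⁅x, y⁆ z` an alternating 3-form; many later vanishing
statements are symmetries of it. -/
theorem φ_lie_swap (x y z : A.carrier) : A.φ ⁅x, y⁆ z = -A.φ ⁅y, x⁆ z := by
  rw [← lie_skew, map_neg, LinearMap.neg_apply]

theorem φ_lie_right (x y z : A.carrier) : A.φ ⁅x, y⁆ z = -A.φ ⁅x, z⁆ y := by
  rw [A.φ_lie, A.φ_symm]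

theorem φ_lie_cyclic (x y z : A.carrier) : A.φ ⁅x, y⁆ z = A.φ ⁅y, z⁆ x := by
  rw [A.φ_lie_swap, A.φ_lie_right, neg_neg]

theorem φ_lie_self (x y : A.carrier) : A.φ ⁅x, y⁆ y = 0 := by
  have := A.φ_lie_right x y y
  linarith

theorem φ_lie_self' (x y : A.carrier) : A.φ ⁅x, y⁆ x = 0 := by
  rw [A.φ_lie_swap, A.φ_lie_self, neg_zero]

/-- `z` commutes with everything. -/
def IsCentral (z : A.carrier) : Prop := ∀ y : A.carrier, ⁅z, y⁆ = 0

variable {A}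

/-- By cyclicity of the 3-form, the centre is the orthogonal of the derived algebra. -/
theorem isCentral_iff {z : A.carrier} : A.IsCentral z ↔ ∀ x y : A.carrier, A.φ ⁅x, y⁆ z = 0 := by
  constructor
  · intro h x y
    rw [A.φ_lie_cyclic, A.φ_lie_cyclic, h, map_zero, LinearMap.zero_apply]
  · intro h y
    exact A.eq_zero_of_φ fun w => by rw [A.φ_lie_cyclic, h]

theorem IsCentral.lie {z : A.carrier} (h : A.IsCentral z) (y : A.carrier) : ⁅z, y⁆ = 0 := h y

theorem IsCentral.lie' {z : A.carrier} (h : A.IsCentral z) (y : A.carrier) : ⁅y, z⁆ = 0 := by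
  rw [← lie_skew, h y, neg_zero]

theorem IsCentral.φ_lie {z : A.carrier} (h : A.IsCentral z) (x y : A.carrier) :
    A.φ ⁅x, y⁆ z = 0 := isCentral_iff.1 h x y

theorem IsCentral.add {z w : A.carrier} (hz : A.IsCentral z) (hw : A.IsCentral w) :
    A.IsCentral (z + w) := fun y => by rw [add_lie, hz, hw, add_zero]

theorem IsCentral.smul {z : A.carrier} (hz : A.IsCentral z) (t : ℝ) :
    A.IsCentral (t • z) := fun y => by rw [smul_lie, hz, smul_zero]

theorem IsCentral.neg {z : A.carrier} (hz : A.IsCentral z) :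
    A.IsCentral (-z) := fun y => by rw [neg_lie, hz, neg_zero]

theorem isCentral_zero : A.IsCentral 0 := fun y => zero_lie y

/-- Multiplication by the conjugate `p - q J` turns the relation into `(p ^ 2 + q ^ 2) • e = 0`. -/
theorem smul_add_smul_J_ne_zero {e : A.carrier} (he : e ≠ 0) {p q : ℝ}
    (h : p • e + q • A.J e = 0) : p = 0 ∧ q = 0 := by
  have h1 : p • A.J e - q • e = 0 := by
    have := congrArg A.J h
    simp only [map_add, map_smul, A.J_sq, map_zero] at this
    rw [← this]; module
  have h2 : (p ^ 2 + q ^ 2) • e = 0 := by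
    calc (p ^ 2 + q ^ 2) • e = p • (p • e + q • A.J e) - q • (p • A.J e - q • e) := by module
      _ = 0 := by rw [h, h1]; simp
  have h3 := (smul_eq_zero.1 h2).resolve_right he
  constructor <;> nlinarith [sq_nonneg p, sq_nonneg q]

theorem exists_dual {e : A.carrier} (he : e ≠ 0) : ∃ a, A.φ e a = 1 ∧ A.φ (A.J e) a = 0 := by
  obtain ⟨a, ha⟩ : ∃ a, A.φ e a ≠ 0 := by
    by_contra! h
    exact he (A.eq_zero_of_φ h)
  set α := A.φ e a with hα
  set β := A.φ (A.J e) a with hβ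
  have hpos : α ^ 2 + β ^ 2 ≠ 0 := by positivity
  -- Complex rescaling of `a` that normalises its Hermitian pairing with `e`.
  refine ⟨(α / (α ^ 2 + β ^ 2)) • a - (β / (α ^ 2 + β ^ 2)) • A.J a, ?_, ?_⟩
  · have h1 : A.φ e (A.J a) = -β := by rw [hβ, A.φ_J_left, neg_neg]
    simp only [map_sub, map_smul, smul_eq_mul, ← hα, h1]
    field_simp
    ring
  · simp only [map_sub, map_smul, smul_eq_mul, ← hβ, A.φ_J_J, ← hα]
    field_simp
    ring

theorem exists_isotropic_dual {e : A.carrier} (he : e ≠ 0) (h0 : A.φ e e = 0) :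
    ∃ a, A.φ e a = 1 ∧ A.φ (A.J e) a = 0 ∧ A.φ a a = 0 := by
  obtain ⟨a, h1, h2⟩ := exists_dual he
  refine ⟨a - (A.φ a a / 2) • e, ?_, ?_, ?_⟩
  · simp [h0, h1]
  · simp [h2, A.φ_J_self]
  · simp only [map_sub, map_smul, LinearMap.sub_apply, LinearMap.smul_apply, smul_eq_mul, h0, h1,
      A.φ_symm a e]
    ring

end PHQAlgebra
end PHQ

namespace PHQ
namespace PHQAlgebra
variable {A : PHQAlgebra.{u}}

/-! ### A central complex line -/

/-- For central `z` two Nijenhuis terms drop out, and the rest says that `ad (J z)` is complex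
linear. -/
theorem lie_J_of_isCentral {z : A.carrier} (hz : A.IsCentral z) (y : A.carrier) :
    ⁅A.J z, A.J y⁆ = A.J ⁅A.J z, y⁆ := by
  have h := A.isComplex.nijenhuis z y
  rw [hz.lie, hz.lie, map_zero, add_zero, zero_add, sub_eq_zero] at h
  exact h.symm

/-- The center, as a subspace. -/
def centerSubmodule (A : PHQAlgebra.{u}) : Submodule ℝ A.carrier where
  carrier := {z | A.IsCentral z}
  add_mem' := IsCentral.add
  zero_mem' := isCentral_zero
  smul_mem' t _ h := h.smul t

/-- A skew map has even rank. If the centre were inside the line of `z`, a vector `x` central modulo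
the centre would have `ad x` skew with image in that line, hence zero. -/
theorem exists_isCentral_not_smul (hA : A.IsNilpotent) {x₀ : A.carrier} (h0 : ¬ A.IsCentral x₀)
    (z : A.carrier) : ∃ w, A.IsCentral w ∧ ∀ t : ℝ, w ≠ t • z := by
  by_contra! hcon
  obtain ⟨x, -, hx, hxy⟩ := exists_forall_lie_mem hA Set.univ ⊤ A.centerSubmodule
    (fun _ _ _ _ => trivial) (x₀ := x₀) trivial h0
  have hf : ∀ y : A.carrier, ∃ t : ℝ, ⁅y, x⁆ = t • z := fun y => hcon _ (hxy y trivial)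
  choose f hf using hf
  have hanti : ∀ y w, f y * A.φ z w = -(f w * A.φ z y) := by
    intro y w
    have h := A.φ_lie_cyclic y x w
    rw [A.φ_lie_swap x w, hf, hf] at h
    simpa using h
  have hz : ∃ a, A.φ z a = 1 := by
    have hz0 : z ≠ 0 := by
      rintro rfl
      apply hx
      intro y
      rw [← lie_skew, hf, smul_zero, neg_zero]
    obtain ⟨a, ha, -⟩ := exists_dual hz0
    exact ⟨a, ha⟩
  obtain ⟨a, ha⟩ := hz
  have hfa : f a = 0 := by
    have := hanti a a
    rw [ha] at this
    linarith
  apply hx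
  intro y
  have hfy := hanti y a
  rw [hfa, ha, zero_mul, mul_one, neg_zero] at hfy
  rw [← lie_skew, hf, hfy, zero_smul, neg_zero]

/-- Descent along the lower central series. If no `z` worked, one with `J z ∈ S k + Z` would produce
another with `J z ∈ S (k + 1) + Z`, and finally a non-zero `z` with `J z` central. -/
theorem exists_isCentral_ad_J_disjoint (hA : A.IsNilpotent)
    (hZ : ∀ z, A.IsCentral z → A.IsCentral (A.J z) → z = 0) {z₀ : A.carrier}
    (hz₀ : A.IsCentral z₀) (hz₀' : z₀ ≠ 0) :
    ∃ z, A.IsCentral z ∧ z ≠ 0 ∧ ∀ y z₁ z₂, A.IsCentral z₁ → A.IsCentral z₂ →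
      ⁅A.J z, y⁆ = z₁ + A.J z₂ → ⁅A.J z, y⁆ = 0 := by
  by_contra! hcon
  obtain ⟨S, hS0, hS, k, hk⟩ := exists_lowerCentralSeries hA
  have key : ∀ k, ∃ z, A.IsCentral z ∧ z ≠ 0 ∧ A.J z ∈ S k ⊔ A.centerSubmodule := by
    intro k
    induction k with
    | zero => exact ⟨z₀, hz₀, hz₀', by simp [hS0]⟩
    | succ k ih =>
      obtain ⟨z, hz, hz0, hzS⟩ := ih
      obtain ⟨y, z₁, z₂, h1, h2, hy, hne⟩ := hcon z hz hz0
      have hmem : ∀ y, ⁅A.J z, y⁆ ∈ S (k + 1) := by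
        intro y
        obtain ⟨s, hs, c, hc, hsc⟩ := Submodule.mem_sup.1 hzS
        have hc' : A.IsCentral c := hc
        rw [← hsc, add_lie, hc'.lie, add_zero, ← lie_skew]
        exact (S (k + 1)).neg_mem (hS k y s hs)
      -- If the `J`-part vanishes, replacing `y` by `J y` and using complex linearity of `ad (J z)`
      -- exhibits `J z₁` itself as a bracket.
      by_cases hz2 : z₂ = 0
      · refine ⟨z₁, h1, ?_, ?_⟩
        · rintro rfl
          apply hne
          rw [hy, hz2, map_zero, add_zero]
        · have h := hmem (A.J y)
          rw [lie_J_of_isCentral hz, hy, hz2, map_zero, add_zero] at h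
          exact Submodule.mem_sup_left h
      · refine ⟨z₂, h2, hz2, ?_⟩
        have h : A.J z₂ = ⁅A.J z, y⁆ + -z₁ := by rw [hy]; abel
        rw [h]
        exact Submodule.add_mem_sup (hmem y) (A.centerSubmodule.neg_mem h1)
  obtain ⟨z, hz, hz0, hzS⟩ := key k
  rw [hk, bot_sup_eq] at hzS
  exact hz0 (hZ z hz hzS)

/-- A nonzero nilpotent pseudo-Hermitian quadratic Lie algebra of dimension at most eight has a
central complex line. -/
theorem exists_isCentral_isCentral_J (hA : A.IsNilpotent) [Nontrivial A.carrier]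
    (hdim : A.dim ≤ 8) : ∃ z, z ≠ 0 ∧ A.IsCentral z ∧ A.IsCentral (A.J z) := by
  by_contra! hcon
  have hZ : ∀ z, A.IsCentral z → A.IsCentral (A.J z) → z = 0 := by
    intro z h1 h2
    by_contra h3
    exact hcon z h3 h1 h2
  obtain ⟨x₀, hx₀⟩ := exists_ne (0 : A.carrier)
  have hcentral : ∃ z, A.IsCentral z ∧ z ≠ 0 := by
    obtain ⟨z, -, hz, hz'⟩ := exists_forall_lie_mem hA Set.univ ⊤ ⊥
      (fun _ _ _ _ => trivial) (x₀ := x₀) trivial (by simpa using hx₀)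
    refine ⟨z, fun y => ?_, by simpa using hz⟩
    have := hz' y trivial
    rw [Submodule.mem_bot] at this
    rw [← lie_skew, this, neg_zero]
  obtain ⟨z₀, hz₀, hz₀'⟩ := hcentral
  obtain ⟨z₁, hz₁, hz₁0, hdisj⟩ := exists_isCentral_ad_J_disjoint hA hZ hz₀ hz₀'
  have hJ₁ : ¬ A.IsCentral (A.J z₁) := fun h => hz₁0 (hZ z₁ hz₁ h)
  obtain ⟨z₂, hz₂, hindep⟩ := exists_isCentral_not_smul hA hJ₁ z₁
  have hJJ : ∀ z w, A.IsCentral z → A.IsCentral w → ⁅A.J z, A.J w⁆ = 0 := by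
    intro z w hz hw
    rw [lie_J_of_isCentral hz, hw.lie', map_zero]
  -- a vector in the image of `ad (J z₁)` killed by `J Z`
  obtain ⟨y₀, hy₀⟩ : ∃ y : A.carrier, ⁅A.J z₁, y⁆ ≠ 0 := by
    by_contra! h
    exact hJ₁ h
  obtain ⟨e, he, he0, heZ⟩ := exists_forall_lie_mem hA {w | ∃ z, A.IsCentral z ∧ w = A.J z}
    (LinearMap.range (LieAlgebra.ad ℝ A.carrier (A.J z₁) : A.carrier →ₗ[ℝ] A.carrier)) ⊥
    (by
      rintro _ ⟨z, hz, rfl⟩ _ ⟨y, rfl⟩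
      -- `J Z` is abelian, so by Jacobi the image of `ad (J z₁)` is stable under it.
      refine ⟨⁅A.J z, y⁆, ?_⟩
      rw [LieAlgebra.ad_apply, LieAlgebra.ad_apply, leibniz_lie (A.J z), hJJ z z₁ hz hz₁, zero_lie,
        zero_add])
    (x₀ := ⁅A.J z₁, y₀⁆) ⟨y₀, rfl⟩ (by simpa using hy₀)
  obtain ⟨y, hy⟩ := he
  rw [LieAlgebra.ad_apply] at hy
  rw [Submodule.mem_bot] at he0
  have he1 : ⁅A.J z₁, e⁆ = 0 := by simpa using heZ _ ⟨z₁, hz₁, rfl⟩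
  have he2 : ⁅A.J z₂, e⁆ = 0 := by simpa using heZ _ ⟨z₂, hz₂, rfl⟩
  have hee : A.φ e e = 0 := by
    nth_rewrite 1 [← hy]
    rw [A.φ_lie, he1, map_zero, neg_zero]
  have heZ0 : ∀ z, A.IsCentral z → A.φ e z = 0 := fun z hz => by rw [← hy, hz.φ_lie]
  have heJZ : ∀ z, A.IsCentral z → A.φ e (A.J z) = 0 := fun z hz => by
    rw [← neg_eq_iff_eq_neg.2 (A.φ_J_left e z), ← hy, ← lie_J_of_isCentral hz₁, hz.φ_lie, neg_zero]
  obtain ⟨a, ha, haJ⟩ := exists_dual he0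
  -- these eight vectors form a basis
  have hli : LinearIndependent ℝ
      ![z₁, z₂, A.J z₁, A.J z₂, e, A.J e, a, A.J a] := by
    rw [Fintype.linearIndependent_iff]
    intro c hc
    simp only [Fin.sum_univ_eight] at hc
    change c 0 • z₁ + c 1 • z₂ + c 2 • A.J z₁ + c 3 • A.J z₂ + c 4 • e + c 5 • A.J e
      + c 6 • a + c 7 • A.J a = 0 at hc
    have heJa : A.φ e (A.J a) = 0 := by
      rw [← neg_eq_iff_eq_neg.2 (A.φ_J_left e a), haJ, neg_zero]
    have hc6 : c 6 = 0 := by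
      have := congrArg (A.φ e) hc
      simpa [heZ0 _ hz₁, heZ0 _ hz₂, heJZ _ hz₁, heJZ _ hz₂, hee, A.φ_self_J, ha, heJa] using this
    have hc7 : c 7 = 0 := by
      have := congrArg (A.φ (A.J e)) hc
      simpa [A.φ_J_left e, A.J_sq, heZ0 _ hz₁, heZ0 _ hz₂, heJZ _ hz₁, heJZ _ hz₂, hee, A.φ_self_J,
        ha, heJa] using this
    rw [hc6, hc7, zero_smul, zero_smul, add_zero, add_zero] at hc
    have hcy : ⁅A.J z₁, c 4 • y + c 5 • A.J y⁆ = c 4 • e + c 5 • A.J e := by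
      rw [lie_add, lie_smul, lie_smul, lie_J_of_isCentral hz₁, hy]
    -- This combination is in the image of `ad (J z₁)` and, by the relation, in Z + JZ; the choice
    -- of `z₁` forbids this unless it is zero.
    have h45 : c 4 • e + c 5 • A.J e = 0 := by
      rw [← hcy]
      refine hdisj _ (-(c 0 • z₁ + c 1 • z₂)) (-(c 2 • z₁ + c 3 • z₂))
        ((hz₁.smul _).add (hz₂.smul _)).neg ((hz₁.smul _).add (hz₂.smul _)).neg ?_
      rw [hcy, ← sub_eq_zero, ← hc]
      simp only [map_neg, map_add, map_smul]
      abel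
    obtain ⟨hc4, hc5⟩ := smul_add_smul_J_ne_zero he0 h45
    have hw : A.J (c 2 • z₁ + c 3 • z₂) = -(c 0 • z₁ + c 1 • z₂) := by
      rw [eq_neg_iff_add_eq_zero, ← hc, hc4, hc5]
      simp only [map_add, map_smul]
      module
    have hw0 := hZ (c 2 • z₁ + c 3 • z₂) ((hz₁.smul _).add (hz₂.smul _))
      (hw ▸ ((hz₁.smul _).add (hz₂.smul _)).neg)
    have hw1 : c 0 • z₁ + c 1 • z₂ = 0 := by
      rw [hw0, map_zero] at hw
      rw [← neg_eq_zero, ← hw]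
    have hpair : ∀ s t : ℝ, s • z₁ + t • z₂ = 0 → s = 0 ∧ t = 0 := by
      intro s t hst
      have ht : t = 0 := by
        by_contra ht
        apply hindep (-(t⁻¹ * s))
        have h := congrArg (fun v => t⁻¹ • v) hst
        simp only [smul_add, smul_smul, inv_mul_cancel₀ ht, one_smul, smul_zero] at h
        rw [neg_smul]
        exact eq_neg_of_add_eq_zero_right h
      subst ht
      simp only [zero_smul, add_zero, smul_eq_zero, hz₁0, or_false] at hst
      exact ⟨hst, rfl⟩
    obtain ⟨hc0, hc1⟩ := hpair _ _ hw1
    obtain ⟨hc2, hc3⟩ := hpair _ _ hw0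
    intro i
    fin_cases i <;> assumption
  have hspan := eq_top_of_linearIndependent hli hdim
  -- Skewness against the basis leaves one free number: `ad (J z)` kills Z, JZ, `e` and `J e`, so
  -- `⁅J z, a⁆` can pair only with `J a`.
  have hDa : ∀ z, A.IsCentral z → ⁅A.J z, e⁆ = 0 →
      ⁅A.J z, a⁆ = A.φ ⁅A.J z, a⁆ (A.J a) • A.J e := by
    intro z hz hze
    rw [← sub_eq_zero]
    apply A.eq_zero_of_φ
    have hkill : ∀ w, ⁅A.J z, w⁆ = 0 → A.φ ⁅A.J z, a⁆ w = 0 := fun w hw => by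
      rw [A.φ_lie, hw, map_zero, neg_zero]
    have htop := hspan (LinearMap.ker (A.φ (⁅A.J z, a⁆ - A.φ ⁅A.J z, a⁆ (A.J a) • A.J e))) (by
      intro i
      rw [LinearMap.mem_ker]
      fin_cases i
      · simp [hz₁.φ_lie, A.φ_J_left e, heJZ _ hz₁]
      · simp [hz₂.φ_lie, A.φ_J_left e, heJZ _ hz₂]
      · simp [hkill _ (hJJ z z₁ hz hz₁), A.φ_J_J, heZ0 _ hz₁]
      · simp [hkill _ (hJJ z z₂ hz hz₂), A.φ_J_J, heZ0 _ hz₂]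
      · simp [hkill _ hze, A.φ_J_self]
      · simp [hkill (A.J e) (by rw [lie_J_of_isCentral hz, hze, map_zero]), A.φ_J_J, hee]
      · simp [haJ, A.φ_lie_self]
      · simp [A.φ_J_J, ha])
    intro w
    have : w ∈ LinearMap.ker (A.φ (⁅A.J z, a⁆ - A.φ ⁅A.J z, a⁆ (A.J a) • A.J e)) :=
      htop ▸ Submodule.mem_top
    exact this
  set l₁ := A.φ ⁅A.J z₁, a⁆ (A.J a) with hl₁
  set l₂ := A.φ ⁅A.J z₂, a⁆ (A.J a) with hl₂
  -- When this linear functional vanishes, `ad` of the `J`-image kills the whole basis, so the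
  -- vector lies in Z ∩ JZ.
  have hvanish : ∀ s t : ℝ, s * l₁ + t * l₂ = 0 → s • z₁ + t • z₂ = 0 := by
    intro s t hst
    have hz : A.IsCentral (s • z₁ + t • z₂) := (hz₁.smul _).add (hz₂.smul _)
    apply hZ _ hz
    have hJz : A.J (s • z₁ + t • z₂) = s • A.J z₁ + t • A.J z₂ := by
      rw [map_add, map_smul, map_smul]
    have hea : ⁅A.J (s • z₁ + t • z₂), a⁆ = 0 := by
      rw [hJz, add_lie, smul_lie, smul_lie, hDa z₁ hz₁ he1, hDa z₂ hz₂ he2, smul_smul, smul_smul,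
        ← add_smul, hst, zero_smul]
    have hee' : ⁅A.J (s • z₁ + t • z₂), e⁆ = 0 := by
      rw [hJz, add_lie, smul_lie, smul_lie, he1, he2, smul_zero, smul_zero, add_zero]
    have htop := hspan (LinearMap.ker
        (LieAlgebra.ad ℝ A.carrier (A.J (s • z₁ + t • z₂)) : A.carrier →ₗ[ℝ] A.carrier)) (by
      intro i
      rw [LinearMap.mem_ker, LieAlgebra.ad_apply]
      fin_cases i
      · exact hz₁.lie' _
      · exact hz₂.lie' _
      · exact hJJ _ _ hz hz₁
      · exact hJJ _ _ hz hz₂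
      · exact hee'
      · exact (lie_J_of_isCentral hz e).trans (by rw [hee', map_zero])
      · exact hea
      · exact (lie_J_of_isCentral hz a).trans (by rw [hea, map_zero]))
    intro w
    have : w ∈ LinearMap.ker
        (LieAlgebra.ad ℝ A.carrier (A.J (s • z₁ + t • z₂)) : A.carrier →ₗ[ℝ] A.carrier) :=
      htop ▸ Submodule.mem_top
    exact this
  have hl₁0 : l₁ ≠ 0 := by
    intro h
    have := hvanish 1 0 (by rw [h]; ring)
    simp only [one_smul, zero_smul, add_zero] at this
    exact hz₁0 this
  -- The functional on the plane of `z₁, z₂` has the kernel vector `z₂ - (l₂ / l₁) • z₁`,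
  -- contradicting independence.
  apply hindep (l₂ / l₁)
  have := hvanish (-(l₂ / l₁)) 1 (by field_simp; ring)
  rw [one_smul, neg_smul, neg_add_eq_zero] at this
  exact this.symm

end PHQAlgebra
end PHQ

namespace PHQ

/-! ### Equivalences with the models -/

universe v w

theorem Equivalent.symm {A : PHQAlgebra.{u}} {B : PHQAlgebra.{v}} (h : Equivalent A B) :
    Equivalent B A := by
  obtain ⟨ψ, hJ, hφ⟩ := h
  refine ⟨ψ.symm, fun x => ?_, fun x y => ?_⟩
  · apply ψ.injective
    change ψ (A.J (ψ.symm x)) = ψ (ψ.symm (B.J x))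
    rw [← hJ, LieEquiv.apply_symm_apply, LieEquiv.apply_symm_apply]
  · rw [← hφ, LieEquiv.apply_symm_apply, LieEquiv.apply_symm_apply]

theorem Equivalent.trans {A : PHQAlgebra.{u}} {B : PHQAlgebra.{v}} {C : PHQAlgebra.{w}}
    (h : Equivalent A B) (h' : Equivalent B C) : Equivalent A C := by
  obtain ⟨ψ, hJ, hφ⟩ := h
  obtain ⟨ψ', hJ', hφ'⟩ := h'
  exact ⟨ψ.trans ψ', fun x => by simp [hJ, hJ'], fun x y => by simp [hφ, hφ']⟩

theorem Equivalent.opposite {A : PHQAlgebra.{u}} {B : PHQAlgebra.{v}}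
    (h : Equivalent A.opposite B) : Equivalent A B.opposite := by
  obtain ⟨ψ, hJ, hφ⟩ := h
  refine ⟨ψ, hJ, fun x y => ?_⟩
  have h1 : B.φ (ψ x) (ψ y) = -A.φ x y := hφ x y
  change -B.φ (ψ x) (ψ y) = A.φ x y
  rw [h1, neg_neg]

/-- A form-preserving map out of a non-degenerate space is injective, and the dimension bound makes
it onto. Hence an upper bound on `A.dim` suffices for recognising a model. -/
theorem Equivalent.of_linearMap {A : PHQAlgebra.{u}} {B : PHQAlgebra.{v}}
    (Φ : B.carrier →ₗ[ℝ] A.carrier) (hlie : ∀ x y, Φ ⁅x, y⁆ = ⁅Φ x, Φ y⁆)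
    (hJ : ∀ x, Φ (B.J x) = A.J (Φ x)) (hφ : ∀ x y, A.φ (Φ x) (Φ y) = B.φ x y)
    (hdim : A.dim ≤ B.dim) : Equivalent A B := by
  have hinj : Function.Injective Φ := by
    rw [← LinearMap.ker_eq_bot, LinearMap.ker_eq_bot']
    intro x hx
    apply B.eq_zero_of_φ
    intro y
    rw [← hφ, hx, map_zero, LinearMap.zero_apply]
  have hle := LinearMap.finrank_le_finrank_of_injective hinj
  have hsurj := (LinearMap.injective_iff_surjective_of_finrank_eq_finrank
    (le_antisymm hle hdim)).1 hinj
  let f : B.carrier →ₗ⁅ℝ⁆ A.carrier := { Φ with map_lie' := fun {x y} => hlie x y }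
  exact Equivalent.symm ⟨LieEquiv.ofBijective f ⟨hinj, hsurj⟩,
    fun x => (hJ x).symm, fun x y => hφ x y⟩

theorem dim_Plane : Module.finrank ℝ Plane = 2 := by
  change Module.finrank ℝ (Fin 2 → ℝ) = 2
  simp

theorem dim_LSpace : Module.finrank ℝ LSpace = 6 := by
  change Module.finrank ℝ (Fin 6 → ℝ) = 6
  simp

theorem dim_KT : Module.finrank ℝ KT = 4 := by
  change Module.finrank ℝ (Fin 4 → ℝ) = 4
  simp

theorem dim_TStar (c : TStarCocycle KT.J) : Module.finrank ℝ (TStar c) = 8 := by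
  change Module.finrank ℝ (KT × Module.Dual ℝ KT) = 8
  rw [Module.finrank_prod, Subspace.dual_finrank_eq, dim_KT]

namespace KT

/-- The standard basis vectors of the Kodaira-Thurston algebra. -/
def e (i : Fin 4) : KT := (Pi.single i 1 : Fin 4 → ℝ)

theorem e_apply (i j : Fin 4) : e i j = if j = i then 1 else 0 := by
  change (Pi.single i 1 : Fin 4 → ℝ) j = _
  rw [Pi.single_apply]

theorem eq_sum (w : KT) : w = w 0 • e 0 + w 1 • e 1 + w 2 • e 2 + w 3 • e 3 := by
  ext <;> simp [e_apply]

theorem lie_e_0 (w : KT) : ⁅w, e 0⁆ = -(w 1) • e 2 := by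
  ext <;> simp [e_apply]

theorem lie_e_1 (w : KT) : ⁅w, e 1⁆ = w 0 • e 2 := by
  ext <;> simp [e_apply]

theorem lie_e_2 (w : KT) : ⁅w, e 2⁆ = 0 := by
  ext <;> simp [e_apply]

theorem lie_e_3 (w : KT) : ⁅w, e 3⁆ = 0 := by
  ext <;> simp [e_apply]

theorem J_e_0 : J (e 0) = e 1 := by ext <;> simp [e_apply]
theorem J_e_1 : J (e 1) = -e 0 := by ext <;> simp [e_apply]
theorem J_e_2 : J (e 2) = e 3 := by ext <;> simp [e_apply]
theorem J_e_3 : J (e 3) = -e 2 := by ext <;> simp [e_apply]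

theorem θ₃_apply (x y z : KT) : θ₃.θ x y z =
    (x 0 * y 2 - x 2 * y 0) * z 3 - (x 0 * y 3 - x 3 * y 0) * z 2
      + (x 2 * y 3 - x 3 * y 2) * z 0 := rfl

end KT

namespace PHQAlgebra

/-- Two isotropic pairs `x₁, x₃` and `y₁, y₃`, dual to each other for the Hermitian form. -/
structure IsDualFrame (A : PHQAlgebra.{u}) (x₁ x₃ y₁ y₃ : A.carrier) : Prop where
  x₁x₁ : A.φ x₁ x₁ = 0
  x₃x₃ : A.φ x₃ x₃ = 0
  y₁y₁ : A.φ y₁ y₁ = 0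
  y₃y₃ : A.φ y₃ y₃ = 0
  x₁y₁ : A.φ x₁ y₁ = 1
  x₁Jy₁ : A.φ x₁ (A.J y₁) = 0
  x₃y₃ : A.φ x₃ y₃ = 1
  x₃Jy₃ : A.φ x₃ (A.J y₃) = 0
  x₁x₃ : A.φ x₁ x₃ = 0
  x₁Jx₃ : A.φ x₁ (A.J x₃) = 0
  x₁y₃ : A.φ x₁ y₃ = 0
  x₁Jy₃ : A.φ x₁ (A.J y₃) = 0
  x₃y₁ : A.φ x₃ y₁ = 0
  x₃Jy₁ : A.φ x₃ (A.J y₁) = 0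
  y₁y₃ : A.φ y₁ y₃ = 0
  y₁Jy₃ : A.φ y₁ (A.J y₃) = 0

variable {A : PHQAlgebra.{u}}

theorem φ_swap {x y : A.carrier} {t : ℝ} (h : A.φ x y = t) : A.φ y x = t := by
  rw [A.φ_symm, h]

theorem φ_swap_J {x y : A.carrier} {t : ℝ} (h : A.φ x (A.J y) = t) : A.φ y (A.J x) = -t := by
  rw [A.φ_symm, A.φ_J_left, h]

variable {x₁ x₃ y₁ y₃ : A.carrier}

/-- The linear map from a `T*`-extension given by a dual frame. -/
def frameMap (c : TStarCocycle KT.J) (x₁ x₃ y₁ y₃ : A.carrier) : TStar c →ₗ[ℝ] A.carrier where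
  toFun v := v.1 0 • x₁ + v.1 1 • A.J x₁ + v.1 2 • x₃ + v.1 3 • A.J x₃
    + v.2 (KT.e 0) • y₁ + v.2 (KT.e 1) • A.J y₁ + v.2 (KT.e 2) • y₃ + v.2 (KT.e 3) • A.J y₃
  map_add' v w := by simp; module
  map_smul' t v := by simp; module

theorem frameMap_apply (c : TStarCocycle KT.J) (v : TStar c) : frameMap c x₁ x₃ y₁ y₃ v =
    v.1 0 • x₁ + v.1 1 • A.J x₁ + v.1 2 • x₃ + v.1 3 • A.J x₃
    + v.2 (KT.e 0) • y₁ + v.2 (KT.e 1) • A.J y₁ + v.2 (KT.e 2) • y₃ + v.2 (KT.e 3) • A.J y₃ := rfl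

theorem frameMap_J (c : TStarCocycle KT.J) (v : TStar c) :
    frameMap c x₁ x₃ y₁ y₃ (TStar.JT c v) = A.J (frameMap c x₁ x₃ y₁ y₃ v) := by
  simp only [frameMap_apply, TStar.JT_fst, TStar.JT_snd, KT.J_0, KT.J_1, KT.J_2, KT.J_3,
    KT.J_e_0, KT.J_e_1, KT.J_e_2, KT.J_e_3, map_add, map_smul, map_neg, A.J_sq]
  module

theorem IsDualFrame.frameMap_φ (h : A.IsDualFrame x₁ x₃ y₁ y₃) (c : TStarCocycle KT.J)
    (v w : TStar c) :
    A.φ (frameMap c x₁ x₃ y₁ y₃ v) (frameMap c x₁ x₃ y₁ y₃ w) = TStar.φT c v w := by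
  have hv : v.2 w.1 = w.1 0 * v.2 (KT.e 0) + w.1 1 * v.2 (KT.e 1) + w.1 2 * v.2 (KT.e 2)
      + w.1 3 * v.2 (KT.e 3) := by
    conv_lhs => rw [KT.eq_sum w.1]
    simp
  have hw : w.2 v.1 = v.1 0 * w.2 (KT.e 0) + v.1 1 * w.2 (KT.e 1) + v.1 2 * w.2 (KT.e 2)
      + v.1 3 * w.2 (KT.e 3) := by
    conv_lhs => rw [KT.eq_sum v.1]
    simp
  rw [TStar.φT_apply, hv, hw]
  simp only [frameMap_apply, map_add, map_smul, LinearMap.add_apply, LinearMap.smul_apply,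
    smul_eq_mul, A.φ_J_left, A.J_sq, map_neg, A.φ_self_J,
    h.x₁x₁, h.x₃x₃, h.y₁y₁, h.y₃y₃, h.x₁y₁, h.x₁Jy₁, h.x₃y₃, h.x₃Jy₃, h.x₁x₃, h.x₁Jx₃, h.x₁y₃,
    h.x₁Jy₃, h.x₃y₁, h.x₃Jy₁, h.y₁y₃, h.y₁Jy₃,
    φ_swap h.x₁y₁, φ_swap h.x₃y₃, φ_swap h.x₁x₃, φ_swap h.x₁y₃, φ_swap h.x₃y₁, φ_swap h.y₁y₃,
    φ_swap_J h.x₁Jy₁, φ_swap_J h.x₃Jy₃, φ_swap_J h.x₁Jx₃, φ_swap_J h.x₁Jy₃, φ_swap_J h.x₃Jy₁,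
    φ_swap_J h.y₁Jy₃]
  ring

theorem lie_swap {x y v : A.carrier} (h : ⁅x, y⁆ = v) : ⁅y, x⁆ = -v := by
  rw [← lie_skew, h]

/-- The vectors `y₁, J y₁, y₃, J y₃` stand for the dual basis, because the complex structure of the
model sends `x₁*` to `x₂*` and `x₃*` to `x₄*`. -/
theorem IsDualFrame.equivalent_T0k (h : A.IsDualFrame x₁ x₃ y₁ y₃) (hdim : A.dim ≤ 8)
    (cx₃ : A.IsCentral x₃) (cJx₃ : A.IsCentral (A.J x₃)) (cy₁ : A.IsCentral y₁)
    (cJy₁ : A.IsCentral (A.J y₁)) (h1 : ⁅x₁, A.J x₁⁆ = x₃) (h2 : ⁅x₁, y₃⁆ = -A.J y₁)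
    (h3 : ⁅A.J x₁, y₃⁆ = y₁) (h4 : ⁅x₁, A.J y₃⁆ = 0) (h5 : ⁅A.J x₁, A.J y₃⁆ = 0)
    (h6 : ⁅y₃, A.J y₃⁆ = 0) : Equivalent A T0k := by
  have hz : ∀ a b c, (TStarCocycle.zero KT.J).θ a b c = 0 := fun _ _ _ => rfl
  refine Equivalent.of_linearMap (B := T0k) (frameMap (TStarCocycle.zero KT.J) x₁ x₃ y₁ y₃)
    ?_ (frameMap_J _) (h.frameMap_φ _) (hdim.trans (dim_TStar _).ge)
  suffices hlie : ∀ v w : TStar (TStarCocycle.zero KT.J),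
      frameMap (TStarCocycle.zero KT.J) x₁ x₃ y₁ y₃ ⁅v, w⁆ =
        ⁅frameMap (TStarCocycle.zero KT.J) x₁ x₃ y₁ y₃ v,
          frameMap (TStarCocycle.zero KT.J) x₁ x₃ y₁ y₃ w⁆ from hlie
  intro v w
  simp only [frameMap_apply, TStar.lie_fst, TStar.lie_snd, hz, KT.lie_0, KT.lie_1, KT.lie_2,
    KT.lie_3, KT.lie_e_0, KT.lie_e_1, KT.lie_e_2, KT.lie_e_3, map_smul, map_zero,
    add_lie, lie_add, smul_lie, lie_smul, lie_self, cx₃.lie, cx₃.lie', cJx₃.lie, cJx₃.lie', cy₁.lie,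
    cy₁.lie', cJy₁.lie, cJy₁.lie', h1, h2, h3, h4, h5, h6, lie_swap h1, lie_swap h2, lie_swap h3,
    lie_swap h4, lie_swap h5, lie_swap h6, smul_eq_mul]
  module

theorem IsDualFrame.equivalent_Tθ₃k (h : A.IsDualFrame x₁ x₃ y₁ y₃) (hdim : A.dim ≤ 8)
    (cJy₃ : A.IsCentral (A.J y₃)) (cy₁ : A.IsCentral y₁) (cJy₁ : A.IsCentral (A.J y₁))
    (h1 : ⁅x₁, A.J x₁⁆ = x₃) (h2 : ⁅x₁, y₃⁆ = -A.J y₁) (h3 : ⁅A.J x₁, y₃⁆ = y₁)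
    (h4 : ⁅x₁, x₃⁆ = A.J y₃) (h5 : ⁅x₁, A.J x₃⁆ = -y₃) (h6 : ⁅A.J x₁, x₃⁆ = 0)
    (h7 : ⁅A.J x₁, A.J x₃⁆ = 0) (h8 : ⁅x₃, A.J x₃⁆ = y₁) (h9 : ⁅x₃, y₃⁆ = 0)
    (h10 : ⁅A.J x₃, y₃⁆ = 0) : Equivalent A Tθ₃k := by
  refine Equivalent.of_linearMap (B := Tθ₃k) (frameMap KT.θ₃ x₁ x₃ y₁ y₃)
    ?_ (frameMap_J _) (h.frameMap_φ _) (hdim.trans (dim_TStar _).ge)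
  suffices hlie : ∀ v w : TStar KT.θ₃, frameMap KT.θ₃ x₁ x₃ y₁ y₃ ⁅v, w⁆ =
      ⁅frameMap KT.θ₃ x₁ x₃ y₁ y₃ v, frameMap KT.θ₃ x₁ x₃ y₁ y₃ w⁆ from hlie
  intro v w
  simp only [frameMap_apply, TStar.lie_fst, TStar.lie_snd, KT.θ₃_apply, KT.lie_0, KT.lie_1,
    KT.lie_2, KT.lie_3, KT.lie_e_0, KT.lie_e_1, KT.lie_e_2, KT.lie_e_3, map_smul, map_zero,
    add_lie, lie_add, smul_lie, lie_smul, lie_self, cJy₃.lie, cJy₃.lie', cy₁.lie,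
    cy₁.lie', cJy₁.lie, cJy₁.lie', h1, h2, h3, h4, h5, h6, h7, h8, h9, h10,
    lie_swap h1, lie_swap h2, lie_swap h3, lie_swap h4, lie_swap h5, lie_swap h6, lie_swap h7,
    lie_swap h8, lie_swap h9, lie_swap h10, smul_eq_mul]
  simp [KT.e_apply]
  module

/-- The linear map from `𝓛` with given images of `x₁, x₂, x₃`. -/
def lMap (x₁ x₂ x₃ : A.carrier) : LSpace →ₗ[ℝ] A.carrier where
  toFun v := v 0 • x₁ + v 1 • A.J x₁ + v 2 • x₂ + v 3 • A.J x₂ + v 4 • x₃ + v 5 • A.J x₃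
  map_add' v w := by simp; module
  map_smul' t v := by simp; module

theorem lMap_apply (x₁ x₂ x₃ : A.carrier) (v : LSpace) : lMap x₁ x₂ x₃ v =
  v 0 • x₁ + v 1 • A.J x₁ + v 2 • x₂ + v 3 • A.J x₂ + v 4 • x₃ + v 5 • A.J x₃ := rfl

theorem equivalent_L42 {x₁ x₂ x₃ : A.carrier} (hdim : A.dim ≤ 6)
    (cx₃ : A.IsCentral x₃) (cJx₃ : A.IsCentral (A.J x₃)) (x₁x₁ : A.φ x₁ x₁ = 0)
    (x₃x₃ : A.φ x₃ x₃ = 0) (x₂x₂ : A.φ x₂ x₂ = 1) (x₁x₃ : A.φ x₁ x₃ = 1)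
    (x₁Jx₃ : A.φ x₁ (A.J x₃) = 0) (x₁x₂ : A.φ x₁ x₂ = 0) (x₁Jx₂ : A.φ x₁ (A.J x₂) = 0)
    (x₂x₃ : A.φ x₂ x₃ = 0) (x₂Jx₃ : A.φ x₂ (A.J x₃) = 0) (h1 : ⁅x₁, A.J x₁⁆ = x₂)
    (h2 : ⁅x₁, x₂⁆ = -A.J x₃) (h3 : ⁅A.J x₁, x₂⁆ = x₃) (h4 : ⁅x₁, A.J x₂⁆ = 0)
    (h5 : ⁅A.J x₁, A.J x₂⁆ = 0) (h6 : ⁅x₂, A.J x₂⁆ = 0) : Equivalent A L42 := by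
  have hlie : ∀ v w : LSpace, lMap x₁ x₂ x₃ ⁅v, w⁆ = ⁅lMap x₁ x₂ x₃ v, lMap x₁ x₂ x₃ w⁆ := by
    intro v w
    simp only [lMap_apply, LSpace.lie_0, LSpace.lie_1, LSpace.lie_2, LSpace.lie_3, LSpace.lie_4,
      LSpace.lie_5, add_lie, lie_add, smul_lie, lie_smul, lie_self, cx₃.lie, cx₃.lie', cJx₃.lie,
      cJx₃.lie', h1, h2, h3, h4, h5, h6, lie_swap h1, lie_swap h2, lie_swap h3,
      lie_swap h4, lie_swap h5, lie_swap h6]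
    module
  have hJ : ∀ v : LSpace, lMap x₁ x₂ x₃ (LSpace.J v) = A.J (lMap x₁ x₂ x₃ v) := by
    intro v
    simp only [lMap_apply, LSpace.J_0, LSpace.J_1, LSpace.J_2, LSpace.J_3, LSpace.J_4,
      LSpace.J_5, map_add, map_smul, A.J_sq]
    module
  have hφ : ∀ v w : LSpace, A.φ (lMap x₁ x₂ x₃ v) (lMap x₁ x₂ x₃ w) = LSpace.φ v w := by
    intro v w
    simp only [LSpace.φ_apply, lMap_apply, map_add, map_smul, LinearMap.add_apply,
      LinearMap.smul_apply, smul_eq_mul, A.φ_J_left, A.J_sq, map_neg,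
      A.φ_self_J, x₁x₁, x₃x₃, x₂x₂, x₁x₃, x₁Jx₃, x₁x₂, x₁Jx₂, x₂x₃, x₂Jx₃, φ_swap x₁x₃,
      φ_swap x₁x₂, φ_swap x₂x₃, φ_swap_J x₁Jx₃, φ_swap_J x₁Jx₂, φ_swap_J x₂Jx₃]
    ring
  exact Equivalent.of_linearMap (B := L42) (lMap x₁ x₂ x₃) hlie hJ hφ (hdim.trans dim_LSpace.ge)

theorem equivalent_R02 {z : A.carrier} (hdim : A.dim ≤ 2) (cz : A.IsCentral z)
    (cJz : A.IsCentral (A.J z)) (hz : A.φ z z = 1) : Equivalent A R02 := by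
  refine Equivalent.of_linearMap (B := R02)
    ({ toFun := fun v : Plane => v 0 • z + v 1 • A.J z
       map_add' := fun v w => by
        change (v 0 + w 0) • z + (v 1 + w 1) • A.J z = _
        module
       map_smul' := fun t v => by
        change (t * v 0) • z + (t * v 1) • A.J z = _
        rw [RingHom.id_apply]
        module } : Plane →ₗ[ℝ] A.carrier) (fun v w => ?_) (fun v => ?_)
    (fun v w => ?_) (hdim.trans dim_Plane.ge)
  · change (0 : ℝ) • z + (0 : ℝ) • A.J z = ⁅(v : Plane) 0 • z + (v : Plane) 1 • A.J z, _⁆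
    rw [add_lie, smul_lie, smul_lie, cz, cJz]
    simp
  · change (-(v : Plane) 1) • z + (v : Plane) 0 • A.J z
      = A.J ((v : Plane) 0 • z + (v : Plane) 1 • A.J z)
    rw [map_add, map_smul, map_smul, A.J_sq]
    module
  · change A.φ ((v : Plane) 0 • z + (v : Plane) 1 • A.J z)
      ((w : Plane) 0 • z + (w : Plane) 1 • A.J z)
      = (v : Plane) 0 * (w : Plane) 0 + (v : Plane) 1 * (w : Plane) 1
    simp only [map_add, map_smul, LinearMap.add_apply, LinearMap.smul_apply, smul_eq_mul,
      A.φ_J_J, A.φ_self_J, A.φ_J_self, hz]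
    ring

end PHQAlgebra
end PHQ

namespace PHQ
namespace PHQAlgebra
variable {A : PHQAlgebra.{u}}

/-! ### Isotropic central lines and their orthogonal reduction -/

/-- `z` spans a central isotropic complex line, and `a` is dual to it. -/
structure IsPair (A : PHQAlgebra.{u}) (a z : A.carrier) : Prop where
  cz : A.IsCentral z
  cJz : A.IsCentral (A.J z)
  zz : A.φ z z = 0
  aa : A.φ a a = 0
  az : A.φ a z = 1
  aJz : A.φ a (A.J z) = 0

/-- The orthogonal of the complex span of `a` and `z`. -/
def perp (a z : A.carrier) : Submodule ℝ A.carrier where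
  carrier := {x | A.φ a x = 0 ∧ A.φ a (A.J x) = 0 ∧ A.φ z x = 0 ∧ A.φ z (A.J x) = 0}
  add_mem' := by
    rintro x y ⟨h1, h2, h3, h4⟩ ⟨k1, k2, k3, k4⟩
    refine ⟨?_, ?_, ?_, ?_⟩ <;> simp [*]
  zero_mem' := by simp
  smul_mem' := by
    rintro t x ⟨h1, h2, h3, h4⟩
    refine ⟨?_, ?_, ?_, ?_⟩ <;> simp [*]

theorem J_mem_perp {a z x : A.carrier} (h : x ∈ perp a z) : A.J x ∈ perp a z := by
  obtain ⟨h1, h2, h3, h4⟩ := h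
  refine ⟨h2, ?_, h4, ?_⟩ <;> simp [A.J_sq, *]

/-- The complex line spanned by `z`. -/
def cline (z : A.carrier) : Submodule ℝ A.carrier := Submodule.span ℝ {z, A.J z}

theorem mem_cline {z x : A.carrier} : x ∈ cline z ↔ ∃ p q : ℝ, p • z + q • A.J z = x :=
  Submodule.mem_span_pair

/-- The projection to `perp a z`. -/
def perpProj (a z x : A.carrier) : A.carrier :=
  x - A.φ z x • a + A.φ z (A.J x) • A.J a - A.φ a x • z + A.φ a (A.J x) • A.J z

theorem eq_perpProj_add (a z x : A.carrier) : x = perpProj a z x + A.φ z x • a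
    - A.φ z (A.J x) • A.J a + A.φ a x • z - A.φ a (A.J x) • A.J z := by
  rw [perpProj]; module

namespace IsPair

variable {a z : A.carrier} (h : A.IsPair a z)
include h

theorem perpProj_mem (x : A.carrier) : perpProj a z x ∈ perp a z := by
  refine ⟨?_, ?_, ?_, ?_⟩ <;>
    simp [perpProj, h.aa, h.az, h.aJz, h.zz, φ_swap h.az, φ_swap_J h.aJz, A.J_sq, A.φ_self_J]

theorem eq_zero {x : A.carrier} (h1 : A.φ x a = 0) (h2 : A.φ x (A.J a) = 0) (h3 : A.φ x z = 0)
    (h4 : A.φ x (A.J z) = 0) (h5 : ∀ u ∈ perp a z, A.φ x u = 0) : x = 0 := by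
  apply A.eq_zero_of_φ
  intro y
  rw [eq_perpProj_add a z y]
  simp [h1, h2, h3, h4, h5 _ (h.perpProj_mem y)]

theorem eq_zero_of_mem_perp {x : A.carrier} (hx : x ∈ perp a z)
    (h5 : ∀ u ∈ perp a z, A.φ x u = 0) : x = 0 := by
  obtain ⟨h1, h2, h3, h4⟩ := hx
  refine h.eq_zero (φ_swap h1) ?_ (φ_swap h3) ?_ h5
  · rw [φ_swap_J h2, neg_zero]
  · rw [φ_swap_J h4, neg_zero]

/-- The component of `x` in `perp a z` is orthogonal to that non-degenerate space, hence zero; the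
coefficients of `a` and `J a` vanish as well. -/
theorem mem_cline {x : A.carrier} (h1 : A.φ x z = 0) (h2 : A.φ x (A.J z) = 0)
    (h3 : ∀ u ∈ perp a z, A.φ x u = 0) : x ∈ cline z := by
  rw [PHQAlgebra.mem_cline]
  have h4 := φ_swap_J h2
  refine ⟨A.φ a x, -A.φ a (A.J x), ?_⟩
  have h5 : perpProj a z x = 0 := by
    refine h.eq_zero_of_mem_perp (h.perpProj_mem x) fun u hu => ?_
    have hxu := h3 u hu
    obtain ⟨k1, k2, k3, k4⟩ := hu
    simp [perpProj, k1, k2, k3, k4, A.φ_J_left, hxu]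
  conv_rhs => rw [eq_perpProj_add a z x, h5, φ_swap h1, h4]
  module

theorem lie_mem_cline_of_mem {y x : A.carrier} (hx : x ∈ cline z) : ⁅y, x⁆ ∈ cline z := by
  obtain ⟨p, q, rfl⟩ := PHQAlgebra.mem_cline.1 hx
  rw [lie_add, lie_smul, lie_smul, h.cz.lie', h.cJz.lie']
  simp

theorem lie_mem_cline {x y : A.carrier} (h3 : ∀ u ∈ perp a z, A.φ ⁅x, y⁆ u = 0) :
    ⁅x, y⁆ ∈ cline z := h.mem_cline (h.cz.φ_lie _ _) (h.cJz.φ_lie _ _) h3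

omit h in
theorem φ_cline_perp {x u : A.carrier} (hx : x ∈ cline z) (hu : u ∈ perp a z) : A.φ x u = 0 := by
  obtain ⟨p, q, rfl⟩ := PHQAlgebra.mem_cline.1 hx
  simp [A.φ_J_left, hu.2.2.1, hu.2.2.2]

theorem isDualFrame {r b : A.carrier} (hr : r ∈ perp a z) (hb : b ∈ perp a z)
    (rr : A.φ r r = 0) (bb : A.φ b b = 0) (rb : A.φ r b = 1) (rJb : A.φ r (A.J b) = 0) :
    A.IsDualFrame a r z b where
  x₁x₁ := h.aa
  x₃x₃ := rr
  y₁y₁ := h.zz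
  y₃y₃ := bb
  x₁y₁ := h.az
  x₁Jy₁ := h.aJz
  x₃y₃ := rb
  x₃Jy₃ := rJb
  x₁x₃ := hr.1
  x₁Jx₃ := hr.2.1
  x₁y₃ := hb.1
  x₁Jy₃ := hb.2.1
  x₃y₁ := φ_swap hr.2.2.1
  x₃Jy₁ := by rw [φ_swap_J hr.2.2.2, neg_zero]
  y₁y₃ := hb.2.2.1
  y₁Jy₃ := hb.2.2.2

theorem exists_dual_mem_perp {r : A.carrier} (hr : r ∈ perp a z) (hr0 : r ≠ 0)
    (rr : A.φ r r = 0) :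
    ∃ b ∈ perp a z, A.φ b b = 0 ∧ A.φ r b = 1 ∧ A.φ r (A.J b) = 0 := by
  obtain ⟨b, h1, h2⟩ := exists_dual hr0
  have h2' : A.φ r (A.J b) = 0 := by rw [A.φ_J_left] at h2; linarith
  have hra := φ_swap hr.1
  have hrz := φ_swap hr.2.2.1
  have hrJa := φ_swap_J hr.2.1
  have hrJz := φ_swap_J hr.2.2.2
  have k1 : A.φ r (perpProj a z b) = 1 := by simp [perpProj, h1, hra, hrz, hrJa, hrJz]
  have k2 : A.φ r (A.J (perpProj a z b)) = 0 := by
    simp [perpProj, h2', hra, hrz, hrJa, hrJz, A.J_sq]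
  set c := perpProj a z b with hc
  have hcm : c ∈ perp a z := h.perpProj_mem b
  refine ⟨c - (A.φ c c / 2) • r, Submodule.sub_mem _ hcm (Submodule.smul_mem _ _ hr), ?_, ?_, ?_⟩
  · simp only [map_sub, map_smul, LinearMap.sub_apply, LinearMap.smul_apply, smul_eq_mul, rr, k1,
      A.φ_symm c r]
    ring
  · simp [k1, rr]
  · simp [k2, A.φ_self_J]

/-- If the complex orthogonal of `r` in `perp a z` has only isotropic vectors, polarisation makes
the form vanish there, and non-degeneracy makes this orthogonal zero. -/
theorem exists_orthogonal_or {r : A.carrier} (hr : r ∈ perp a z) (h0 : A.φ r r ≠ 0) :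
    (∃ x ∈ perp a z, A.φ r x = 0 ∧ A.φ r (A.J x) = 0 ∧ A.φ x x ≠ 0) ∨
      ∀ u ∈ perp a z, ∃ p q : ℝ, u = p • r + q • A.J r := by
  by_contra! hcon
  obtain ⟨hiso, u, hu, hne⟩ := hcon
  set s := A.φ r r with hs
  -- the component of `u` orthogonal to `r`
  let q : A.carrier → A.carrier := fun u => u - (A.φ r u / s) • r + (A.φ r (A.J u) / s) • A.J r
  have hq_mem : ∀ u ∈ perp a z, q u ∈ perp a z := fun u hu =>
    Submodule.add_mem _ (Submodule.sub_mem _ hu (Submodule.smul_mem _ _ hr))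
      (Submodule.smul_mem _ _ (J_mem_perp hr))
  have hq1 : ∀ u, A.φ r (q u) = 0 := by
    intro u
    simp only [q, map_add, map_sub, map_smul, smul_eq_mul, ← hs, A.φ_self_J]
    field_simp
    ring
  have hq2 : ∀ u, A.φ r (A.J (q u)) = 0 := by
    intro u
    simp only [q, map_add, map_sub, map_smul, map_neg, smul_eq_mul, A.J_sq, ← hs, A.φ_self_J]
    field_simp
    ring
  have hq0 : q u = 0 := by
    refine h.eq_zero_of_mem_perp (hq_mem u hu) fun v hv => ?_
    have h1 := hiso _ (Submodule.add_mem _ (hq_mem u hu) (hq_mem v hv))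
      (by rw [map_add, hq1, hq1, add_zero]) (by rw [map_add, map_add, hq2, hq2, add_zero])
    have h2 := hiso _ (hq_mem u hu) (hq1 u) (hq2 u)
    have h3 := hiso _ (hq_mem v hv) (hq1 v) (hq2 v)
    have h4 : A.φ (q u) (q v) = 0 := by
      simp only [map_add, LinearMap.add_apply, h2, h3, A.φ_symm (q v) (q u)] at h1
      linarith
    have h5 : v = q v + (A.φ r v / s) • r - (A.φ r (A.J v) / s) • A.J r := by
      simp only [q]; module
    rw [h5, map_sub, map_add, map_smul, map_smul, h4, φ_swap (hq1 u), φ_swap_J (hq2 u)]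
    simp
  apply hne (A.φ r u / s) (-(A.φ r (A.J u) / s))
  rw [← sub_eq_zero, ← hq0]
  simp only [q]; module

end IsPair

/-- All central complex lines are isotropic. -/
def HasIsotropicCenter (A : PHQAlgebra.{u}) : Prop :=
  ∀ z, A.IsCentral z → A.IsCentral (A.J z) → A.φ z z = 0

/-- The reduction of `A` by the central line of `z` is a trivial representation of `A`. -/
def IsFlat (a z : A.carrier) : Prop :=
  ∀ u ∈ perp a z, ∀ v ∈ perp a z, ∀ y : A.carrier, A.φ ⁅y, u⁆ v = 0

namespace IsPair

variable {a z : A.carrier} (h : A.IsPair a z) (hF : IsFlat a z)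
include h

theorem lie_a_Ja_mem_perp : ⁅a, A.J a⁆ ∈ perp a z := by
  refine ⟨?_, ?_, ?_, ?_⟩
  · exact φ_swap (A.φ_lie_self' _ _)
  · rw [← neg_eq_iff_eq_neg.2 (A.φ_J_left a _), A.φ_symm, A.φ_lie_self, neg_zero]
  · exact φ_swap (h.cz.φ_lie _ _)
  · rw [← neg_eq_iff_eq_neg.2 (A.φ_J_left z _), A.φ_symm, h.cJz.φ_lie, neg_zero]

include hF

/-- Flatness and centrality leave only the pairing of `⁅a, u⁆` with `J a`, which is minus `φ ⁅a, J
a⁆ u`. This and its companions below determine the whole bracket from `⁅a, J a⁆`. -/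
theorem lie_a {u : A.carrier} (hu : u ∈ perp a z) :
    ⁅a, u⁆ = -(A.φ ⁅a, A.J a⁆ u) • A.J z := by
  rw [← sub_eq_zero]
  apply h.eq_zero
  · rw [map_sub, LinearMap.sub_apply, A.φ_lie_self']
    simp [A.φ_J_left, φ_swap_J h.aJz]
  · rw [map_sub, LinearMap.sub_apply, A.φ_lie_right]
    simp [A.φ_J_J, φ_swap h.az]
  · rw [map_sub, LinearMap.sub_apply, h.cz.φ_lie]
    simp [A.φ_J_self]
  · rw [map_sub, LinearMap.sub_apply, h.cJz.φ_lie]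
    simp [A.φ_J_J, h.zz]
  · intro v hv
    rw [map_sub, LinearMap.sub_apply, hF u hu v hv]
    simp [A.φ_J_left, hv.2.2.2]

theorem lie_Ja {u : A.carrier} (hu : u ∈ perp a z) :
    ⁅A.J a, u⁆ = A.φ ⁅a, A.J a⁆ u • z := by
  rw [← sub_eq_zero]
  apply h.eq_zero
  · rw [map_sub, LinearMap.sub_apply, ← A.φ_lie_cyclic]
    simp [φ_swap h.az]
  · rw [map_sub, LinearMap.sub_apply, A.φ_lie_self']
    simp [φ_swap_J h.aJz]
  · rw [map_sub, LinearMap.sub_apply, h.cz.φ_lie]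
    simp [h.zz]
  · rw [map_sub, LinearMap.sub_apply, h.cJz.φ_lie]
    simp [A.φ_self_J]
  · intro v hv
    rw [map_sub, LinearMap.sub_apply, hF u hu v hv]
    simp [hv.2.2.1]

theorem lie_perp {u v : A.carrier} (hu : u ∈ perp a z) (hv : v ∈ perp a z) : ⁅u, v⁆ = 0 := by
  apply h.eq_zero
  · rw [← A.φ_lie_cyclic, hF u hu v hv]
  · rw [← A.φ_lie_cyclic, hF u hu v hv]
  · exact h.cz.φ_lie _ _
  · exact h.cJz.φ_lie _ _
  · exact fun w hw => hF v hv w hw u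

theorem isCentral_of_mem_perp {u : A.carrier} (hu : u ∈ perp a z)
    (hu0 : A.φ ⁅a, A.J a⁆ u = 0) : A.IsCentral u := by
  intro y
  rw [eq_perpProj_add a z y]
  simp only [lie_add, lie_sub, lie_smul, h.lie_perp hF hu (h.perpProj_mem y),
    lie_swap (h.lie_a hF hu), lie_swap (h.lie_Ja hF hu), hu0, h.cz.lie', h.cJz.lie']
  simp

theorem φ_self_eq_zero (hA : A.HasIsotropicCenter) {u : A.carrier} (hu : u ∈ perp a z)
    (hu0 : A.φ ⁅a, A.J a⁆ u = 0) (hu0' : A.φ ⁅a, A.J a⁆ (A.J u) = 0) : A.φ u u = 0 :=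
  hA u (h.isCentral_of_mem_perp hF hu hu0) (h.isCentral_of_mem_perp hF (J_mem_perp hu) hu0')

/-- Otherwise `perp a z` consists of central, hence isotropic, vectors and is zero. Then `a` and `J
a` are central as well, and `a + z` spans a central line with `φ (a + z) (a + z) = 2`. -/
theorem lie_a_Ja_ne_zero (hA : A.HasIsotropicCenter) : ⁅a, A.J a⁆ ≠ 0 := by
  intro h0
  have hiso : ∀ u ∈ perp a z, A.φ u u = 0 := fun u hu =>
    h.φ_self_eq_zero hF hA hu (by simp [h0]) (by simp [h0])
  have hbot : ∀ u ∈ perp a z, u = 0 := by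
    intro u hu
    refine h.eq_zero_of_mem_perp hu fun v hv => ?_
    have h1 := hiso _ (Submodule.add_mem _ hu hv)
    simp only [map_add, LinearMap.add_apply, hiso u hu, hiso v hv, A.φ_symm v u] at h1
    linarith
  have ca : A.IsCentral a := by
    intro y
    rw [eq_perpProj_add a z y, hbot _ (h.perpProj_mem y)]
    simp [h0, h.cz.lie', h.cJz.lie']
  have cJa : A.IsCentral (A.J a) := by
    intro y
    rw [eq_perpProj_add a z y, hbot _ (h.perpProj_mem y)]
    simp [lie_swap h0, h.cz.lie', h.cJz.lie']
  have h2 := hA (a + z) (ca.add h.cz) (by rw [map_add]; exact cJa.add h.cJz)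
  simp [h.aa, h.zz, h.az, φ_swap h.az] at h2

theorem equivalent_T0k (hdim : A.dim ≤ 8) (hA : A.HasIsotropicCenter)
    (h0 : A.φ ⁅a, A.J a⁆ ⁅a, A.J a⁆ = 0) : Equivalent A T0k := by
  have hr := h.lie_a_Ja_mem_perp
  obtain ⟨b, hb, bb, rb, rJb⟩ := h.exists_dual_mem_perp hr (h.lie_a_Ja_ne_zero hF hA) h0
  refine (h.isDualFrame hr hb h0 bb rb rJb).equivalent_T0k hdim
    (h.isCentral_of_mem_perp hF hr h0)
    (h.isCentral_of_mem_perp hF (J_mem_perp hr) (A.φ_self_J _)) h.cz h.cJz rfl ?_ ?_ ?_ ?_ ?_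
  · rw [h.lie_a hF hb, rb, neg_one_smul]
  · rw [h.lie_Ja hF hb, rb, one_smul]
  · rw [h.lie_a hF (J_mem_perp hb), rJb, neg_zero, zero_smul]
  · rw [h.lie_Ja hF (J_mem_perp hb), rJb, zero_smul]
  · exact h.lie_perp hF hb (J_mem_perp hb)

/-- Vectors of `perp a z` complex-orthogonal to `⁅a, J a⁆` span central lines and are isotropic, so
`perp a z` is the complex line of `⁅a, J a⁆`. -/
theorem dim_le_six (hA : A.HasIsotropicCenter) (h0 : A.φ ⁅a, A.J a⁆ ⁅a, A.J a⁆ ≠ 0) :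
    A.dim ≤ 6 := by
  rcases h.exists_orthogonal_or h.lie_a_Ja_mem_perp h0 with ⟨x, hx, h1, h2, h3⟩ | hspan
  · exact absurd (h.φ_self_eq_zero hF hA hx h1 h2) h3
  have hsurj : Function.Surjective (lMap a ⁅a, A.J a⁆ z) := by
    intro y
    obtain ⟨p, q, hpq⟩ := hspan _ (h.perpProj_mem y)
    refine ⟨(![A.φ z y, -A.φ z (A.J y), p, q, A.φ a y, -A.φ a (A.J y)] : Fin 6 → ℝ), ?_⟩
    conv_rhs => rw [eq_perpProj_add a z y, hpq]
    change A.φ z y • a + (-A.φ z (A.J y)) • A.J a + p • ⁅a, A.J a⁆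
      + q • A.J ⁅a, A.J a⁆ + A.φ a y • z + (-A.φ a (A.J y)) • A.J z = _
    module
  have h1 := LinearMap.finrank_range_le (lMap a ⁅a, A.J a⁆ z)
  rwa [LinearMap.range_eq_top.2 hsurj, finrank_top, dim_LSpace] at h1

theorem equivalent_L42 (hdim : A.dim ≤ 6) (h0 : 0 < A.φ ⁅a, A.J a⁆ ⁅a, A.J a⁆) :
    Equivalent A L42 := by
  have hr : ⁅a, A.J a⁆ ∈ perp a z := h.lie_a_Ja_mem_perp
  set s := A.φ ⁅a, A.J a⁆ ⁅a, A.J a⁆ with hs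
  -- Scaling `a` by `t` multiplies `⁅a, J a⁆` by `t ^ 2` and its square length by `t ^ 4`.
  obtain ⟨t, ht0, ht⟩ : ∃ t : ℝ, 0 < t ∧ t ^ 4 * s = 1 := by
    refine ⟨√(√s⁻¹), by positivity, ?_⟩
    have h1 : √(√s⁻¹) ^ 4 = s⁻¹ := by
      calc √(√s⁻¹) ^ 4 = (√(√s⁻¹) ^ 2) ^ 2 := by ring
        _ = s⁻¹ := by rw [Real.sq_sqrt (by positivity), Real.sq_sqrt (by positivity)]
    rw [h1, inv_mul_cancel₀ h0.ne']
  have ht3 : t ^ 3 * s = t⁻¹ := by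
    field_simp
    linarith only [ht]
  refine PHQAlgebra.equivalent_L42 (x₁ := t • a) (x₂ := (t ^ 2) • ⁅a, A.J a⁆) (x₃ := t⁻¹ • z)
    hdim (h.cz.smul _) (by rw [map_smul]; exact h.cJz.smul _) ?_ ?_ ?_ ?_ ?_ ?_ ?_ ?_ ?_ ?_ ?_ ?_
    ?_ ?_ ?_
  · simp [h.aa]
  · simp [h.zz]
  · simp only [map_smul, LinearMap.smul_apply, smul_eq_mul, ← hs]
    rw [← ht]; ring
  · simp [h.az, ht0.ne']
  · simp [h.aJz]
  · simp [hr.1]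
  · simp [hr.2.1]
  · simp [φ_swap hr.2.2.1]
  · simp [φ_swap_J hr.2.2.2]
  · rw [map_smul, lie_smul, smul_lie, smul_smul, pow_two]
  · rw [lie_smul, smul_lie, h.lie_a hF hr, ← hs, map_smul, smul_smul, smul_smul, ← neg_smul, ← ht3]
    congr 1; ring
  · rw [map_smul, lie_smul, smul_lie, h.lie_Ja hF hr, ← hs, smul_smul, smul_smul, ← ht3]
    congr 1
  · simp [h.lie_a hF (J_mem_perp hr), A.φ_self_J]
  · simp [h.lie_Ja hF (J_mem_perp hr), A.φ_self_J]
  · simp [h.lie_perp hF hr (J_mem_perp hr)]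

omit hF in
-- The sign of `z` changes so that its pairing with `a` stays `1` for the opposite form.
theorem opposite : A.opposite.IsPair a (-z) where
  cz := fun y => h.cz.neg y
  cJz := by
    have h1 := h.cJz.neg
    rw [← map_neg] at h1
    exact h1
  zz := by
    change -A.φ (-z) (-z) = 0
    simp [h.zz]
  aa := by
    change -A.φ a a = 0
    simp [h.aa]
  az := by
    change -A.φ a (-z) = 1
    simp [h.az]
  aJz := by
    change -A.φ a (A.J (-z)) = 0
    simp [h.aJz]

omit h in
theorem isFlat_opposite : IsFlat (A := A.opposite) a (-z) := by
  have hmem : ∀ u : A.carrier, u ∈ perp (A := A.opposite) a (-z) → u ∈ perp a z := by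
    rintro u ⟨h1, h2, h3, h4⟩
    change -A.φ a u = 0 at h1
    change -A.φ a (A.J u) = 0 at h2
    change -A.φ (-z) u = 0 at h3
    change -A.φ (-z) (A.J u) = 0 at h4
    refine ⟨?_, ?_, ?_, ?_⟩
    · linarith
    · linarith
    · simpa using h3
    · simpa using h4
  have hflat : ∀ u v y : A.carrier, u ∈ perp (A := A.opposite) a (-z) →
      v ∈ perp (A := A.opposite) a (-z) → -A.φ ⁅y, u⁆ v = 0 := fun u v y hu hv => by
    rw [hF u (hmem u hu) v (hmem v hv), neg_zero]
  exact fun u hu v hv y => hflat u v y hu hv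

theorem equivalent_of_isFlat (hdim : A.dim ≤ 8) (hA : A.HasIsotropicCenter) :
    Equivalent A L42 ∨ Equivalent A L24 ∨ Equivalent A T0k := by
  rcases lt_trichotomy (A.φ ⁅a, A.J a⁆ ⁅a, A.J a⁆) 0 with h0 | h0 | h0
  · right; left
    apply Equivalent.opposite
    refine h.opposite.equivalent_L42 (isFlat_opposite hF) (h.dim_le_six hF hA h0.ne) ?_
    change 0 < -A.φ ⁅a, A.J a⁆ ⁅a, A.J a⁆
    linarith
  · exact Or.inr (Or.inr (h.equivalent_T0k hF hdim hA h0))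
  · exact Or.inl (h.equivalent_L42 hF (h.dim_le_six hF hA h0.ne') h0)

end IsPair

end PHQAlgebra
end PHQ

namespace PHQ
namespace PHQAlgebra
variable {A : PHQAlgebra.{u}}

/-! ### Vectors which are central modulo a central line -/

/-- `x` is central modulo the central line of `z`, tested on the orthogonal of that line. -/
def IsReduced (z x : A.carrier) : Prop :=
  ∀ y w : A.carrier, A.φ z w = 0 → A.φ z (A.J w) = 0 → A.φ ⁅y, x⁆ w = 0

namespace IsPair

variable {a z : A.carrier} (h : A.IsPair a z)
include h

theorem isReduced_iff {x : A.carrier} :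
    IsReduced z x ↔ ∀ y : A.carrier, ∀ v ∈ perp a z, A.φ ⁅y, x⁆ v = 0 := by
  constructor
  · exact fun hx y v hv => hx y v hv.2.2.1 hv.2.2.2
  · intro hx y w hw hw'
    rw [eq_perpProj_add a z w]
    simp [hw, hw', hx y _ (h.perpProj_mem w), h.cz.φ_lie, h.cJz.φ_lie]

/-- Engel's argument on the orthogonal of the line modulo the line gives a common null vector, and
its projection to `perp a z` differs from it by central terms. Non-flatness serves only to make
`perp a z` non-zero. -/
theorem exists_isReduced (hA : A.IsNilpotent) (hF : ¬ IsFlat a z) :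
    ∃ x ∈ perp a z, x ≠ 0 ∧ IsReduced z x := by
  obtain ⟨u₀, hu₀, hu₀'⟩ : ∃ u ∈ perp a z, u ≠ 0 := by
    by_contra! hcon
    exact hF fun u hu v hv y => by rw [hcon v hv, map_zero]
  let K : Submodule ℝ A.carrier :=
    LinearMap.ker (A.φ z) ⊓ LinearMap.ker (A.φ (A.J z))
  have hKz : ∀ y x : A.carrier, ⁅y, x⁆ ∈ K := fun y x =>
    ⟨φ_swap (h.cz.φ_lie y x), φ_swap (h.cJz.φ_lie y x)⟩
  obtain ⟨x, hxK, hxN, hx⟩ := exists_forall_lie_mem hA Set.univ K (cline z)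
    (fun y _ x _ => hKz y x) (x₀ := u₀)
    ⟨hu₀.2.2.1, by
      change A.φ (A.J z) u₀ = 0
      rw [A.φ_J_left, hu₀.2.2.2, neg_zero]⟩
    (fun hmem => hu₀' (h.eq_zero_of_mem_perp hu₀ fun v hv => φ_cline_perp hmem hv))
  have h1 : A.φ z x = 0 := hxK.1
  have h2 : A.φ z (A.J x) = 0 := by
    have : A.φ (A.J z) x = 0 := hxK.2
    rw [A.φ_J_left] at this
    linarith
  have h3 := eq_perpProj_add a z x
  rw [h1, h2] at h3
  refine ⟨perpProj a z x, h.perpProj_mem x, ?_, ?_⟩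
  · intro h0
    apply hxN
    rw [PHQAlgebra.mem_cline]
    refine ⟨A.φ a x, -A.φ a (A.J x), ?_⟩
    conv_rhs => rw [h3, h0]
    module
  · rw [h.isReduced_iff]
    intro y v hv
    have h4 : ⁅y, perpProj a z x⁆ = ⁅y, x⁆ := by
      conv_rhs => rw [h3]
      simp [h.cz.lie', h.cJz.lie']
    rw [h4]
    exact φ_cline_perp (hx y trivial) hv

omit h in
-- In the Nijenhuis identity the two brackets with `x` itself vanish against `v`. What remains says
-- that `ad (J x)` commutes with `J` modulo the line of `z`.
theorem φ_lie_J_J_of_isReduced {x : A.carrier}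
    (hx : IsReduced z x) {v : A.carrier}
    (hv : A.φ z v = 0) (hv' : A.φ z (A.J v) = 0) (y : A.carrier) :
    A.φ ⁅A.J x, A.J y⁆ v = -A.φ ⁅A.J x, y⁆ (A.J v) := by
  have h1 := congrArg (fun w => A.φ w v) (A.isComplex.nijenhuis x y)
  simp only [map_add, map_sub, LinearMap.add_apply, LinearMap.sub_apply, map_zero,
    LinearMap.zero_apply, A.φ_J_left] at h1
  have h2 := hx y v hv hv'
  have h3 := hx (A.J y) (A.J v) hv' (by rw [A.J_sq, map_neg, hv, neg_zero])
  rw [A.φ_lie_swap] at h2 h3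
  linarith

end IsPair

/-! ### A reduced vector of non-zero length -/

/-- Two orthogonal non-isotropic complex lines in `perp a z`, which together with `a` and `z`
span everything. -/
structure IsOrthoFrame (A : PHQAlgebra.{u}) (a z x x' : A.carrier) : Prop
    extends A.IsPair a z where
  hx : x ∈ perp a z
  hx' : x' ∈ perp a z
  xx : A.φ x x ≠ 0
  xx' : A.φ x' x' ≠ 0
  orth : A.φ x x' = 0
  orthJ : A.φ x (A.J x') = 0
  span : ∀ u ∈ perp a z, ∃ p q p' q' : ℝ, u = p • x + q • A.J x + p' • x' + q' • A.J x'

namespace IsOrthoFrame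

variable {a z x x' : A.carrier} (h : A.IsOrthoFrame a z x x')
include h

theorem coeff {u : A.carrier} (hu : u ∈ perp a z) :
    u = (A.φ x u / A.φ x x) • x - (A.φ x (A.J u) / A.φ x x) • A.J x
      + (A.φ x' u / A.φ x' x') • x' - (A.φ x' (A.J u) / A.φ x' x') • A.J x' := by
  obtain ⟨p, q, p', q', rfl⟩ := h.span u hu
  have hxx := h.xx
  have hxx' := h.xx'
  set u := p • x + q • A.J x + p' • x' + q' • A.J x'
  have e1 : A.φ x u / A.φ x x = p := by
    simp [u, A.φ_self_J, h.orth, h.orthJ, hxx]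
  have e2 : A.φ x (A.J u) / A.φ x x = -q := by
    simp [u, A.φ_self_J, h.orth, h.orthJ, hxx, A.J_sq, neg_div]
  have e3 : A.φ x' u / A.φ x' x' = p' := by
    simp [u, A.φ_self_J, φ_swap h.orth, φ_swap_J h.orthJ, hxx']
  have e4 : A.φ x' (A.J u) / A.φ x' x' = -q' := by
    simp [u, A.φ_self_J, φ_swap h.orth, φ_swap_J h.orthJ, hxx', A.J_sq, neg_div]
  rw [e1, e2, e3, e4]
  simp only [u]
  module

/-- The metric on the orthogonal of the central line in terms of the frame. -/
theorem parseval {v w : A.carrier} (hv : A.φ z v = 0) (hv' : A.φ z (A.J v) = 0)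
    (hw : A.φ z w = 0) (hw' : A.φ z (A.J w) = 0) :
    A.φ v w = (A.φ v x * A.φ w x + A.φ v (A.J x) * A.φ w (A.J x)) / A.φ x x
      + (A.φ v x' * A.φ w x' + A.φ v (A.J x') * A.φ w (A.J x')) / A.φ x' x' := by
  have key : ∀ v : A.carrier, A.φ z v = 0 → A.φ z (A.J v) = 0 → ∃ p q : ℝ, ∃ u ∈ perp a z,
      v = u + p • z + q • A.J z := by
    intro v hv hv'
    refine ⟨A.φ a v, -A.φ a (A.J v), perpProj a z v, h.perpProj_mem v, ?_⟩
    conv_lhs => rw [eq_perpProj_add a z v, hv, hv']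
    module
  obtain ⟨p, q, u, hu, rfl⟩ := key v hv hv'
  obtain ⟨p', q', u', hu', rfl⟩ := key w hw hw'
  have hz : ∀ u ∈ perp a z, A.φ (A.J z) u = 0 := fun u hu => by
    rw [A.φ_J_left, hu.2.2.2, neg_zero]
  have h1 := J_mem_perp h.hx
  have h1' := J_mem_perp h.hx'
  simp only [map_add, map_smul, LinearMap.add_apply, LinearMap.smul_apply, h.hx.2.2.1, h1.2.2.1,
    h.hx'.2.2.1, h1'.2.2.1, hz _ h.hx, hz _ h.hx', hz _ h1, hz _ h1', hz _ hu', hu'.2.2.1,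
    φ_swap hu.2.2.1, φ_swap (hz _ hu), h.zz, A.φ_self_J, A.φ_J_self, A.φ_J_J, smul_zero, add_zero]
  conv_lhs => rw [h.coeff hu']
  have hxx := h.xx
  have hxx' := h.xx'
  have e1 : A.φ x (A.J u') = -A.φ u' (A.J x) := by rw [A.φ_symm x, A.φ_J_left]
  have e2 : A.φ x' (A.J u') = -A.φ u' (A.J x') := by rw [A.φ_symm x', A.φ_J_left]
  simp only [map_add, map_sub, map_smul, smul_eq_mul, e1, e2, A.φ_symm x u', A.φ_symm x' u']
  field_simp
  ring

theorem mem_cline_of {w : A.carrier} (hz : A.φ w z = 0) (hJz : A.φ w (A.J z) = 0)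
    (h1 : A.φ w x = 0) (h2 : A.φ w (A.J x) = 0) (h3 : A.φ w x' = 0) (h4 : A.φ w (A.J x') = 0) :
    w ∈ cline z := by
  refine h.mem_cline hz hJz fun u hu => ?_
  obtain ⟨p, q, p', q', rfl⟩ := h.span u hu
  simp [h1, h2, h3, h4]

/-- Brackets are orthogonal to the central line, so `parseval` expresses iterated brackets as
products of matrix entries of single ones. -/
theorem parseval_lie (y₁ y₂ v w : A.carrier) :
    A.φ ⁅y₁, ⁅y₂, v⁆⁆ w = -((A.φ ⁅y₂, v⁆ x * A.φ ⁅y₁, w⁆ x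
        + A.φ ⁅y₂, v⁆ (A.J x) * A.φ ⁅y₁, w⁆ (A.J x)) / A.φ x x
      + (A.φ ⁅y₂, v⁆ x' * A.φ ⁅y₁, w⁆ x'
        + A.φ ⁅y₂, v⁆ (A.J x') * A.φ ⁅y₁, w⁆ (A.J x')) / A.φ x' x') := by
  have hz : ∀ y w : A.carrier, A.φ z ⁅y, w⁆ = 0 := fun y w => φ_swap (h.cz.φ_lie y w)
  have hJz : ∀ y w : A.carrier, A.φ z (A.J ⁅y, w⁆) = 0 := fun y w => by
    have := φ_swap (h.cJz.φ_lie y w)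
    rw [A.φ_J_left] at this
    linarith
  rw [A.φ_lie, h.parseval (hz _ _) (hJz _ _) (hz _ _) (hJz _ _)]

variable (hA : A.IsNilpotent) (hr : IsReduced z x)
include hr

theorem φ_lie_left {u : A.carrier} (hu : u ∈ perp a z) (y : A.carrier) : A.φ ⁅y, x⁆ u = 0 :=
  h.isReduced_iff.1 hr y u hu

theorem φ_lie_right' {u : A.carrier} (hu : u ∈ perp a z) (y : A.carrier) : A.φ ⁅y, u⁆ x = 0 := by
  rw [A.φ_lie_right, h.φ_lie_left hr hu, neg_zero]

include hA

/-- Modulo the line of `z`, `ad (J x)` kills `x` and `J x`, hence acts as an infinitesimal rotation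
of the definite plane of `x', J x'`. Its square there is `-(τ / φ x' x') ^ 2`, and nilpotency gives
`τ = 0`. -/
theorem φ_lie_Jx_x'_Jx' : A.φ ⁅A.J x, x'⁆ (A.J x') = 0 := by
  set τ := A.φ ⁅A.J x, x'⁆ (A.J x') with hτ
  have hJx' := J_mem_perp h.hx'
  have hne : x' ∉ cline z := fun hmem => h.xx' (IsPair.φ_cline_perp hmem h.hx')
  have hxx' := h.xx'
  have e1 : A.φ ⁅A.J x, A.J x'⁆ x' = -τ := by rw [A.φ_lie_right]
  have key := eq_zero_of_lie_lie_sub_smul_mem hA (y := A.J x) (x := x') (N := cline z)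
    (μ := -(τ ^ 2 / A.φ x' x' ^ 2)) (fun w hw => h.lie_mem_cline_of_mem hw) hne ?_
  · have : τ ^ 2 = 0 := by
      field_simp at key
      linarith
    exact pow_eq_zero_iff two_ne_zero |>.1 this
  · apply h.mem_cline_of
    · simp [h.cz.φ_lie, φ_swap h.hx'.2.2.1]
    · simp [h.cJz.φ_lie, φ_swap_J h.hx'.2.2.2]
    · simp only [map_sub, map_smul, LinearMap.sub_apply, LinearMap.smul_apply, φ_swap h.orth,
        h.parseval_lie, A.φ_lie_self', A.φ_lie_self, h.φ_lie_right' hr h.hx',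
        h.φ_lie_left hr (J_mem_perp h.hx), h.φ_lie_left hr h.hx', h.φ_lie_left hr hJx']
      simp
    · simp only [map_sub, map_smul, LinearMap.sub_apply, LinearMap.smul_apply, φ_swap_J h.orthJ,
        h.parseval_lie, A.φ_lie_self', A.φ_lie_self, lie_self]
      simp
    · simp only [map_sub, map_smul, LinearMap.sub_apply, LinearMap.smul_apply,
        h.parseval_lie, A.φ_lie_self', A.φ_lie_self, h.φ_lie_right' hr h.hx', ← hτ, smul_eq_mul]
      field_simp
      ring
    · simp only [map_sub, map_smul, LinearMap.sub_apply, LinearMap.smul_apply, A.φ_self_J,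
        h.parseval_lie, A.φ_lie_self', A.φ_lie_self, h.φ_lie_right' hr h.hx', ← hτ, smul_eq_mul]
      simp

/-- The 3-form on `perp a z` has `x` in its kernel, so it lives on the three-dimensional span of `J
x, x', J x'`; its only coefficient is zero by `φ_lie_Jx_x'_Jx'`. -/
theorem φ_lie_perp {u v w : A.carrier} (hu : u ∈ perp a z) (hv : v ∈ perp a z)
    (hw : w ∈ perp a z) : A.φ ⁅u, v⁆ w = 0 := by
  have hτ := h.φ_lie_Jx_x'_Jx' hA hr
  have e2 : A.φ ⁅x', A.J x'⁆ (A.J x) = 0 := by rw [← A.φ_lie_cyclic, hτ]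
  have e3 : A.φ ⁅A.J x', A.J x⁆ x' = 0 := by rw [← A.φ_lie_cyclic, e2]
  have hs1 := A.φ_lie_swap (A.J x) (A.J x') x'
  have hs2 := A.φ_lie_swap x' (A.J x) (A.J x')
  have hs3 := A.φ_lie_swap (A.J x') x' (A.J x)
  rw [e3, neg_zero] at hs1
  rw [hτ, neg_zero] at hs2
  rw [e2, neg_zero] at hs3
  have l1 : ∀ v ∈ perp a z, ∀ w ∈ perp a z, A.φ ⁅x, v⁆ w = 0 := fun v hv w hw => by
    rw [A.φ_lie_swap, h.φ_lie_left hr hw, neg_zero]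
  have hJx := J_mem_perp h.hx
  have hJx' := J_mem_perp h.hx'
  obtain ⟨p1, q1, p1', q1', rfl⟩ := h.span u hu
  obtain ⟨p2, q2, p2', q2', rfl⟩ := h.span v hv
  obtain ⟨p3, q3, p3', q3', rfl⟩ := h.span w hw
  simp only [add_lie, smul_lie, map_add, map_smul, LinearMap.add_apply, LinearMap.smul_apply,
    lie_add, lie_smul, l1 _ h.hx _ h.hx, l1 _ h.hx _ hJx, l1 _ h.hx _ h.hx', l1 _ h.hx _ hJx',
    l1 _ hJx _ h.hx, l1 _ hJx _ hJx, l1 _ hJx _ h.hx', l1 _ hJx _ hJx',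
    l1 _ h.hx' _ h.hx, l1 _ h.hx' _ hJx, l1 _ h.hx' _ h.hx', l1 _ h.hx' _ hJx',
    l1 _ hJx' _ h.hx, l1 _ hJx' _ hJx, l1 _ hJx' _ h.hx', l1 _ hJx' _ hJx',
    h.φ_lie_left hr h.hx, h.φ_lie_left hr h.hx', h.φ_lie_left hr hJx, h.φ_lie_left hr hJx',
    h.φ_lie_right' hr h.hx, h.φ_lie_right' hr h.hx', h.φ_lie_right' hr hJx,
    h.φ_lie_right' hr hJx', lie_self, A.φ_lie_self, A.φ_lie_self', hτ, e2, e3, hs1, hs2, hs3]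
  simp

end IsOrthoFrame

end PHQAlgebra
end PHQ

/-! ### Vanishing of the action in the presence of a non-isotropic reduced vector -/

namespace PHQ
namespace PHQAlgebra
variable {A : PHQAlgebra.{u}}

namespace IsOrthoFrame

variable {a z x x' : A.carrier} (h : A.IsOrthoFrame a z x x') (hA : A.IsNilpotent)
  (hr : IsReduced z x)
include h hA hr

/-- Under these hypotheses `ad y` only rotates the plane of `x', J x'` modulo the line of `z`, and a
nilpotent rotation is zero. -/
theorem eq_zero_of_lie_Jx_eq_zero {y : A.carrier} (h1 : A.φ ⁅y, A.J x⁆ x' = 0)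
    (h2 : A.φ ⁅y, A.J x⁆ (A.J x') = 0) : A.φ ⁅y, x'⁆ (A.J x') = 0 := by
  set l := A.φ ⁅y, x'⁆ (A.J x') with hl
  have hne : x' ∉ cline z := fun hmem => h.xx' (IsPair.φ_cline_perp hmem h.hx')
  have hxx' := h.xx'
  have e1 : A.φ ⁅y, x'⁆ (A.J x) = 0 := by rw [A.φ_lie_right, h1, neg_zero]
  have key := eq_zero_of_lie_lie_sub_smul_mem hA (y := y) (x := x') (N := cline z)
    (μ := -(l ^ 2 / A.φ x' x' ^ 2)) (fun w hw => h.lie_mem_cline_of_mem hw) hne ?_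
  · have : l ^ 2 = 0 := by
      field_simp at key
      linarith
    exact pow_eq_zero_iff two_ne_zero |>.1 this
  · apply h.mem_cline_of
    · simp [h.cz.φ_lie, φ_swap h.hx'.2.2.1]
    · simp [h.cJz.φ_lie, φ_swap_J h.hx'.2.2.2]
    all_goals
      simp only [map_sub, map_smul, LinearMap.sub_apply, LinearMap.smul_apply, φ_swap h.orth,
        φ_swap_J h.orthJ, A.φ_self_J,
        h.parseval_lie, A.φ_lie_self, h.φ_lie_right' hr h.hx', e1, h2,
        h.φ_lie_left hr (J_mem_perp h.hx), h.φ_lie_left hr h.hx',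
        h.φ_lie_left hr (J_mem_perp h.hx'), ← hl, smul_eq_mul]
      field_simp
      ring

/-- When `ad y` does not rotate the plane of `x', J x'`, its square multiplies `J x` by `-(α ^ 2 + β
^ 2) / (φ x x * φ x' x')` modulo the line. Nilpotency kills this scalar whatever the signature. -/
theorem lie_Jx_eq_zero_of {y : A.carrier} (h1 : A.φ ⁅y, x'⁆ (A.J x') = 0) :
    A.φ ⁅y, A.J x⁆ x' = 0 ∧ A.φ ⁅y, A.J x⁆ (A.J x') = 0 := by
  set α := A.φ ⁅y, A.J x⁆ x' with hα
  set β := A.φ ⁅y, A.J x⁆ (A.J x') with hβ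
  have hJx := J_mem_perp h.hx
  have hne : A.J x ∉ cline z := fun hmem => h.xx (by
    rw [← A.φ_J_J]; exact IsPair.φ_cline_perp hmem hJx)
  have hxx := h.xx
  have hxx' := h.xx'
  have e1 : A.φ ⁅y, x'⁆ (A.J x) = -α := by rw [A.φ_lie_right]
  have e2 : A.φ ⁅y, A.J x'⁆ (A.J x) = -β := by rw [A.φ_lie_right]
  have e3 : A.φ ⁅y, A.J x'⁆ x' = 0 := by rw [A.φ_lie_right, h1, neg_zero]
  have key := eq_zero_of_lie_lie_sub_smul_mem hA (y := y) (x := A.J x) (N := cline z)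
    (μ := -((α ^ 2 + β ^ 2) / (A.φ x x * A.φ x' x'))) (fun w hw => h.lie_mem_cline_of_mem hw) hne ?_
  · have : α ^ 2 + β ^ 2 = 0 := by
      field_simp at key
      linarith
    constructor <;> nlinarith [sq_nonneg α, sq_nonneg β]
  · apply h.mem_cline_of
    · simp [h.cz.φ_lie, φ_swap hJx.2.2.1]
    · simp [h.cJz.φ_lie, φ_swap_J hJx.2.2.2]
    all_goals
      simp only [map_sub, map_smul, LinearMap.sub_apply, LinearMap.smul_apply, A.φ_J_left x,
        A.J_sq, map_neg, h.orth, h.orthJ, A.φ_self_J,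
        h.parseval_lie, A.φ_lie_self, h.φ_lie_right' hr hJx, e1, e2, e3, h1,
        h.φ_lie_left hr hJx, h.φ_lie_left hr h.hx',
        h.φ_lie_left hr (J_mem_perp h.hx'), ← hα, ← hβ, smul_eq_mul]
      field_simp
      ring

/-- Integrability turns the entries `(α, β)` for `a` into `(-β, α)` for `J a`. Since `⁅a, J a⁆` lies
in `perp a z`, it acts trivially by `φ_lie_perp`, so the actions of `a` and `J a` commute on `J x`.
This forces either `α = β = 0` or `l = m = 0`, and nilpotency then removes the remaining entries. -/
theorem lie_a_and_Ja : (A.φ ⁅a, A.J x⁆ x' = 0 ∧ A.φ ⁅a, A.J x⁆ (A.J x') = 0 ∧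
      A.φ ⁅a, x'⁆ (A.J x') = 0) ∧
    A.φ ⁅A.J a, A.J x⁆ x' = 0 ∧ A.φ ⁅A.J a, A.J x⁆ (A.J x') = 0 ∧
      A.φ ⁅A.J a, x'⁆ (A.J x') = 0 := by
  have hJx := J_mem_perp h.hx
  have hJx' := J_mem_perp h.hx'
  have hxx' := h.xx'
  set α := A.φ ⁅a, A.J x⁆ x' with hα
  set β := A.φ ⁅a, A.J x⁆ (A.J x') with hβ
  set l := A.φ ⁅a, x'⁆ (A.J x') with hl
  set m := A.φ ⁅A.J a, x'⁆ (A.J x') with hm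
  have n1 : A.φ ⁅A.J a, A.J x⁆ x' = -β := by
    rw [A.φ_lie_swap, IsPair.φ_lie_J_J_of_isReduced hr h.hx'.2.2.1 h.hx'.2.2.2, neg_neg,
      A.φ_lie_swap]
  have n2 : A.φ ⁅A.J a, A.J x⁆ (A.J x') = α := by
    rw [A.φ_lie_swap, IsPair.φ_lie_J_J_of_isReduced hr hJx'.2.2.1 hJx'.2.2.2, neg_neg,
      A.φ_lie_swap, A.J_sq, map_neg, neg_neg]
  have jac : ∀ u ∈ perp a z, A.φ ⁅a, ⁅A.J a, A.J x⁆⁆ u = A.φ ⁅A.J a, ⁅a, A.J x⁆⁆ u := by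
    intro u hu
    rw [leibniz_lie a, map_add, LinearMap.add_apply,
      h.φ_lie_perp hA hr h.lie_a_Ja_mem_perp hJx hu, zero_add]
  have e1 : A.φ ⁅a, A.J x'⁆ x' = -l := by rw [A.φ_lie_right]
  have e2 : A.φ ⁅A.J a, A.J x'⁆ x' = -m := by rw [A.φ_lie_right]
  have j1 := jac x' h.hx'
  have j2 := jac _ hJx'
  simp only [h.parseval_lie, h.φ_lie_right' hr hJx, A.φ_lie_self, n1, n2, e1, e2, ← hα, ← hβ,
    ← hl, ← hm, zero_mul, mul_zero, zero_add, add_zero, zero_div] at j1 j2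
  field_simp at j1 j2
  -- The two Jacobi relations form a linear system in `l, m` with determinant `α ^ 2 + β ^ 2`.
  have k1 : l * (α ^ 2 + β ^ 2) = 0 := by linear_combination -α * j1 - β * j2
  have k2 : m * (α ^ 2 + β ^ 2) = 0 := by linear_combination β * j1 - α * j2
  by_cases hab : α ^ 2 + β ^ 2 = 0
  · have hα0 : α = 0 := by nlinarith [sq_nonneg α, sq_nonneg β]
    have hβ0 : β = 0 := by nlinarith [sq_nonneg α, sq_nonneg β]
    refine ⟨⟨hα0, hβ0, h.eq_zero_of_lie_Jx_eq_zero hA hr hα0 hβ0⟩, ?_, ?_, ?_⟩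
    · rw [n1, hβ0, neg_zero]
    · rw [n2, hα0]
    · exact h.eq_zero_of_lie_Jx_eq_zero hA hr (by rw [n1, hβ0, neg_zero]) (by rw [n2, hα0])
  · have hl0 : l = 0 := (mul_eq_zero.1 k1).resolve_right hab
    have hm0 : m = 0 := (mul_eq_zero.1 k2).resolve_right hab
    have h1 := h.lie_Jx_eq_zero_of hA hr hl0
    have h2 := h.lie_Jx_eq_zero_of hA hr hm0
    exact ⟨⟨h1.1, h1.2, hl0⟩, n1 ▸ h2.1, n2 ▸ h2.2, hm0⟩

theorem isFlat : IsFlat a z := by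
  have hJx := J_mem_perp h.hx
  have hJx' := J_mem_perp h.hx'
  have key : ∀ y : A.carrier, A.φ ⁅y, A.J x⁆ x' = 0 → A.φ ⁅y, A.J x⁆ (A.J x') = 0 →
      A.φ ⁅y, x'⁆ (A.J x') = 0 → ∀ u ∈ perp a z, ∀ v ∈ perp a z, A.φ ⁅y, u⁆ v = 0 := by
    intro y h1 h2 h3 u hu v hv
    have h1' : A.φ ⁅y, x'⁆ (A.J x) = 0 := by rw [A.φ_lie_right, h1, neg_zero]
    have h2' : A.φ ⁅y, A.J x'⁆ (A.J x) = 0 := by rw [A.φ_lie_right, h2, neg_zero]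
    have h3' : A.φ ⁅y, A.J x'⁆ x' = 0 := by rw [A.φ_lie_right, h3, neg_zero]
    obtain ⟨p, q, p', q', rfl⟩ := h.span u hu
    obtain ⟨s, t, s', t', rfl⟩ := h.span v hv
    simp [h1, h2, h3, h1', h2', h3', A.φ_lie_self, h.φ_lie_left hr h.hx, h.φ_lie_left hr h.hx',
      h.φ_lie_left hr hJx, h.φ_lie_left hr hJx', h.φ_lie_right' hr h.hx, h.φ_lie_right' hr h.hx',
      h.φ_lie_right' hr hJx, h.φ_lie_right' hr hJx']
  obtain ⟨⟨h1, h2, h3⟩, h4, h5, h6⟩ := h.lie_a_and_Ja hA hr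
  intro u hu v hv y
  rw [eq_perpProj_add a z y]
  simp only [add_lie, sub_lie, smul_lie, map_add, map_sub, map_smul, LinearMap.add_apply,
    LinearMap.sub_apply, LinearMap.smul_apply, h.cz.lie, h.cJz.lie, map_zero,
    LinearMap.zero_apply, key a h1 h2 h3 u hu v hv, key (A.J a) h4 h5 h6 u hu v hv,
    h.φ_lie_perp hA hr (h.perpProj_mem y) hu hv]
  simp

end IsOrthoFrame

namespace IsPair
variable {a z : A.carrier} (h : A.IsPair a z)
include h

theorem isFlat_of_isReduced (hA : A.IsNilpotent) (hdim : A.dim ≤ 8) {x : A.carrier}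
    (hx : x ∈ perp a z) (hxx : A.φ x x ≠ 0) (hr : IsReduced z x) : IsFlat a z := by
  have hJx := J_mem_perp hx
  rcases h.exists_orthogonal_or hx hxx with ⟨x', hx', h1, h2, h3⟩ | hspan
  · have hJx' := J_mem_perp hx'
    have hli : LinearIndependent ℝ ![a, A.J a, x, A.J x, x', A.J x', z, A.J z] := by
      rw [Fintype.linearIndependent_iff]
      intro c hc
      simp only [Fin.sum_univ_eight] at hc
      change c 0 • a + c 1 • A.J a + c 2 • x + c 3 • A.J x + c 4 • x' + c 5 • A.J x'
        + c 6 • z + c 7 • A.J z = 0 at hc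
      have pair : ∀ w, A.φ w (c 0 • a + c 1 • A.J a + c 2 • x + c 3 • A.J x + c 4 • x'
        + c 5 • A.J x' + c 6 • z + c 7 • A.J z) = 0 := fun w => by rw [hc, map_zero]
      have p0 := pair z
      have p1 := pair (A.J z)
      have p2 := pair x
      have p3 := pair (A.J x)
      have p4 := pair x'
      have p5 := pair (A.J x')
      have p6 := pair a
      have p7 := pair (A.J a)
      simp only [map_add, map_smul, A.φ_J_left, A.φ_self_J, A.J_sq, map_neg, h.zz, φ_swap h.az,
        φ_swap_J h.aJz, hx.1, hx.2.1, hx.2.2.1, hx.2.2.2, hx'.1, hx'.2.1, hx'.2.2.1, hx'.2.2.2,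
        φ_swap hx.1, φ_swap_J hx.2.1, φ_swap hx.2.2.1, φ_swap_J hx.2.2.2,
        φ_swap hx'.1, φ_swap_J hx'.2.1, φ_swap hx'.2.2.1, φ_swap_J hx'.2.2.2, h.aa, h.az, h.aJz,
        h1, h2, φ_swap h1, φ_swap_J h2, smul_eq_mul, mul_zero, mul_one, add_zero, zero_add,
        neg_zero, neg_neg, mul_neg, neg_eq_zero, mul_eq_zero, hxx, h3, or_false]
        at p0 p1 p2 p3 p4 p5 p6 p7
      intro i
      fin_cases i <;> assumption
    have htop := eq_top_of_linearIndependent hli hdim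
      (Submodule.span ℝ {x, A.J x, x', A.J x'} ⊔ Submodule.span ℝ {a, A.J a, z, A.J z}) (by
        intro i
        fin_cases i
        · exact Submodule.mem_sup_right (Submodule.subset_span (by simp))
        · exact Submodule.mem_sup_right (Submodule.subset_span (by simp))
        · exact Submodule.mem_sup_left (Submodule.subset_span (by simp))
        · exact Submodule.mem_sup_left (Submodule.subset_span (by simp))
        · exact Submodule.mem_sup_left (Submodule.subset_span (by simp))
        · exact Submodule.mem_sup_left (Submodule.subset_span (by simp))
        · exact Submodule.mem_sup_right (Submodule.subset_span (by simp))
        · exact Submodule.mem_sup_right (Submodule.subset_span (by simp)))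
    have hortho : A.IsOrthoFrame a z x x' :=
      { h with
        hx := hx
        hx' := hx'
        xx := hxx
        xx' := h3
        orth := h1
        orthJ := h2
        span := by
          intro u hu
          have hmem : u ∈ Submodule.span ℝ {x, A.J x, x', A.J x'} ⊔
            Submodule.span ℝ {a, A.J a, z, A.J z} := htop ▸ Submodule.mem_top
          obtain ⟨v, hv, w, hw, rfl⟩ := Submodule.mem_sup.1 hmem
          have hv' : v ∈ perp a z := by
            refine Submodule.span_le.2 ?_ hv
            rintro _ (rfl | rfl | rfl | rfl)
            exacts [hx, hJx, hx', hJx']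
          have hw' : w ∈ perp a z := by
            have := Submodule.sub_mem _ hu hv'
            rwa [add_sub_cancel_left] at this
          -- This part lies in `perp a z` but is also orthogonal to it.
          have hw0 : w = 0 := by
            refine h.eq_zero_of_mem_perp hw' fun t ht => ?_
            have hle : Submodule.span ℝ {a, A.J a, z, A.J z} ≤ LinearMap.ker (A.φ t) := by
              rw [Submodule.span_le]
              rintro _ (rfl | rfl | rfl | rfl)
              · exact φ_swap ht.1
              · exact (φ_swap_J ht.2.1).trans neg_zero
              · exact φ_swap ht.2.2.1
              · exact (φ_swap_J ht.2.2.2).trans neg_zero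
            exact φ_swap (hle hw)
          rw [hw0, add_zero]
          obtain ⟨p, w₁, hw₁, rfl⟩ := Submodule.mem_span_insert.1 hv
          obtain ⟨q, w₂, hw₂, rfl⟩ := Submodule.mem_span_insert.1 hw₁
          obtain ⟨p', q', rfl⟩ := Submodule.mem_span_pair.1 hw₂
          exact ⟨p, q, p', q', by abel⟩ }
    exact hortho.isFlat hA hr
  -- Here `perp a z` is a real plane, and a skew map of a plane that kills `x` is zero.
  · intro u hu v hv y
    have h1 := h.isReduced_iff.1 hr y
    have h2 : A.φ ⁅y, A.J x⁆ x = 0 := by rw [A.φ_lie_right, h1 _ hJx, neg_zero]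
    obtain ⟨p, q, rfl⟩ := hspan u hu
    obtain ⟨p', q', rfl⟩ := hspan v hv
    simp [h1 x hx, h1 _ hJx, h2, A.φ_lie_self]

end IsPair
end PHQAlgebra
end PHQ

/-! ### Frames adapted to an isotropic reduced vector -/

namespace PHQ
namespace PHQAlgebra
variable {A : PHQAlgebra.{u}}

namespace IsDualFrame

variable {x₁ x₃ y₁ y₃ : A.carrier} (h : A.IsDualFrame x₁ x₃ y₁ y₃)
include h

theorem linearIndependent : LinearIndependent ℝ
    ![x₁, A.J x₁, x₃, A.J x₃, y₁, A.J y₁, y₃, A.J y₃] := by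
  rw [Fintype.linearIndependent_iff]
  intro c hc
  simp only [Fin.sum_univ_eight] at hc
  change c 0 • x₁ + c 1 • A.J x₁ + c 2 • x₃ + c 3 • A.J x₃ + c 4 • y₁ + c 5 • A.J y₁
    + c 6 • y₃ + c 7 • A.J y₃ = 0 at hc
  have pair : ∀ w, A.φ w (c 0 • x₁ + c 1 • A.J x₁ + c 2 • x₃ + c 3 • A.J x₃ + c 4 • y₁
    + c 5 • A.J y₁ + c 6 • y₃ + c 7 • A.J y₃) = 0 := fun w => by rw [hc, map_zero]
  have p0 := pair y₁
  have p1 := pair (A.J y₁)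
  have p2 := pair y₃
  have p3 := pair (A.J y₃)
  have p4 := pair x₁
  have p5 := pair (A.J x₁)
  have p6 := pair x₃
  have p7 := pair (A.J x₃)
  simp only [map_add, map_smul, A.φ_J_left, A.φ_self_J, A.J_sq, map_neg,
    h.x₁x₁, h.x₃x₃, h.y₁y₁, h.y₃y₃, h.x₁y₁, h.x₁Jy₁, h.x₃y₃, h.x₃Jy₃, h.x₁x₃, h.x₁Jx₃, h.x₁y₃,
    h.x₁Jy₃, h.x₃y₁, h.x₃Jy₁, h.y₁y₃, h.y₁Jy₃,
    φ_swap h.x₁y₁, φ_swap h.x₃y₃, φ_swap h.x₁x₃, φ_swap h.x₁y₃, φ_swap h.x₃y₁, φ_swap h.y₁y₃,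
    φ_swap_J h.x₁Jy₁, φ_swap_J h.x₃Jy₃, φ_swap_J h.x₁Jx₃, φ_swap_J h.x₁Jy₃, φ_swap_J h.x₃Jy₁,
    φ_swap_J h.y₁Jy₃, smul_eq_mul, mul_zero, mul_one, add_zero, zero_add,
    neg_zero, neg_neg, mul_neg, neg_eq_zero] at p0 p1 p2 p3 p4 p5 p6 p7
  intro i
  fin_cases i <;> assumption

theorem eq_zero (hdim : A.dim ≤ 8) {v : A.carrier} (h1 : A.φ v x₁ = 0)
    (h2 : A.φ v (A.J x₁) = 0) (h3 : A.φ v x₃ = 0) (h4 : A.φ v (A.J x₃) = 0)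
    (h5 : A.φ v y₁ = 0) (h6 : A.φ v (A.J y₁) = 0) (h7 : A.φ v y₃ = 0)
    (h8 : A.φ v (A.J y₃) = 0) : v = 0 := by
  apply A.eq_zero_of_φ
  intro w
  have htop := eq_top_of_linearIndependent h.linearIndependent hdim (LinearMap.ker (A.φ v)) (by
    intro i
    fin_cases i <;> assumption)
  have hw : w ∈ LinearMap.ker (A.φ v) := htop ▸ Submodule.mem_top
  exact hw

theorem eq_sum (hdim : A.dim ≤ 8) (v : A.carrier) : v = A.φ v y₁ • x₁ + A.φ v (A.J y₁) • A.J x₁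
    + A.φ v y₃ • x₃ + A.φ v (A.J y₃) • A.J x₃ + A.φ v x₁ • y₁ + A.φ v (A.J x₁) • A.J y₁
    + A.φ v x₃ • y₃ + A.φ v (A.J x₃) • A.J y₃ := by
  rw [← sub_eq_zero]
  apply h.eq_zero hdim <;>
  simp only [map_add, map_sub, map_smul, LinearMap.add_apply, LinearMap.sub_apply,
    LinearMap.smul_apply, A.φ_J_left, A.φ_self_J, A.J_sq, map_neg,
    h.x₁x₁, h.x₃x₃, h.y₁y₁, h.y₃y₃, h.x₁y₁, h.x₁Jy₁, h.x₃y₃, h.x₃Jy₃, h.x₁x₃, h.x₁Jx₃, h.x₁y₃,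
    h.x₁Jy₃, h.x₃y₁, h.x₃Jy₁, h.y₁y₃, h.y₁Jy₃,
    φ_swap h.x₁y₁, φ_swap h.x₃y₃, φ_swap h.x₁x₃, φ_swap h.x₁y₃, φ_swap h.x₃y₁, φ_swap h.y₁y₃,
    φ_swap_J h.x₁Jy₁, φ_swap_J h.x₃Jy₃, φ_swap_J h.x₁Jx₃, φ_swap_J h.x₁Jy₃, φ_swap_J h.x₃Jy₁,
    φ_swap_J h.y₁Jy₃, smul_eq_mul] <;> ring

end IsDualFrame

/-- A dual frame `a, r` and `z, b` adapted to a flag of `J`-invariant ideals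
`⟨z⟩ ⊆ ⟨z, r⟩`, together with its structure constants. -/
structure IsTFrame (A : PHQAlgebra.{u}) (a r z b : A.carrier) (p q s s' t t' : ℝ) : Prop
    extends A.IsDualFrame a r z b where
  cz : A.IsCentral z
  cJz : A.IsCentral (A.J z)
  red : IsReduced z r
  redJ : IsReduced z (A.J r)
  hp : A.φ ⁅a, A.J a⁆ r = p
  hq : A.φ ⁅a, A.J a⁆ (A.J r) = q
  hs : A.φ ⁅a, A.J a⁆ b = s
  hs' : A.φ ⁅a, A.J a⁆ (A.J b) = s'
  ht : A.φ ⁅a, b⁆ (A.J b) = t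
  ht' : A.φ ⁅A.J a, b⁆ (A.J b) = t'

namespace IsPair
variable {a z : A.carrier} (h : A.IsPair a z)
include h

/-- Modulo the line of `z`, `⁅y, J r⁆` is a combination of `r` and `J r`. The `J r`-coefficient is
an eigenvalue of the nilpotent `ad y`, so it vanishes for all `y`; integrability transfers this to
the `r`-coefficient with `J y` in place of `y`. -/
theorem isReduced_J (hA : A.IsNilpotent) (hdim : A.dim ≤ 8) {r b : A.carrier}
    (hr : r ∈ perp a z) (hb : b ∈ perp a z) (hf : A.IsDualFrame a r z b) (hred : IsReduced z r) :
    IsReduced z (A.J r) := by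
  have hJr := J_mem_perp hr
  have hJb := J_mem_perp hb
  have hred' := h.isReduced_iff.1 hred
  have h1 : ∀ y : A.carrier, A.φ ⁅y, A.J r⁆ (A.J b) = 0 := by
    intro y
    have hmem : ∀ (w : A.carrier), w ∈ cline z ⊔ Submodule.span ℝ {r} ↔
        ∃ v ∈ cline z, ∃ c : ℝ, v + c • r = w := by
      intro w
      simp [Submodule.mem_sup, Submodule.mem_span_singleton]
    refine eq_zero_of_lie_sub_smul_mem hA (y := y) (x := A.J r)
      (N := cline z ⊔ Submodule.span ℝ {r}) ?_ ?_ ?_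
    · intro w hw
      obtain ⟨v, hv, c, rfl⟩ := (hmem w).1 hw
      rw [lie_add, lie_smul]
      exact Submodule.mem_sup_left (Submodule.add_mem _ (h.lie_mem_cline_of_mem hv)
        (Submodule.smul_mem _ _ (h.lie_mem_cline (hred' y))))
    · intro hmem'
      obtain ⟨v, hv, c, hvc⟩ := (hmem _).1 hmem'
      have h2 := congrArg (fun w => A.φ w (A.J b)) hvc
      simp [φ_cline_perp hv hJb, hf.x₃Jy₃, A.φ_J_J, hf.x₃y₃] at h2
    · rw [hmem]
      refine ⟨⁅y, A.J r⁆ - A.φ ⁅y, A.J r⁆ (A.J b) • A.J r - A.φ ⁅y, A.J r⁆ b • r, ?_,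
        A.φ ⁅y, A.J r⁆ b, by module⟩
      have e1 : A.φ ⁅y, A.J r⁆ r = 0 := by rw [A.φ_lie_right, hred' y _ hJr, neg_zero]
      refine h.mem_cline ?_ ?_ fun u hu => ?_
      · simp [h.cz.φ_lie, φ_swap hJr.2.2.1, φ_swap hr.2.2.1]
      · simp [h.cJz.φ_lie, A.φ_J_J, φ_swap_J hr.2.2.2, φ_swap hr.2.2.1]
      · rw [hf.eq_sum hdim u]
        have k1 := φ_swap hu.1
        have k2 := (φ_swap_J hu.2.1).trans neg_zero
        have k3 := φ_swap hu.2.2.1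
        have k4 := (φ_swap_J hu.2.2.2).trans neg_zero
        simp [k1, k2, k3, k4, e1, A.φ_lie_self, hf.x₃x₃, A.φ_self_J, A.φ_J_self, A.φ_J_J,
          hf.x₃y₃, hf.x₃Jy₃, A.φ_J_left r b]
        ring
  have h2 : ∀ y : A.carrier, A.φ ⁅y, A.J r⁆ b = 0 := by
    intro y
    have h3 := φ_lie_J_J_of_isReduced hred hb.2.2.1 hb.2.2.2 (A.J y)
    rw [A.J_sq, lie_neg, map_neg, LinearMap.neg_apply, neg_inj, A.φ_lie_swap,
      A.φ_lie_swap _ _ (A.J b), h1 (A.J y)] at h3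
    linarith
  rw [h.isReduced_iff]
  intro y v hv
  have e1 : A.φ ⁅y, A.J r⁆ r = 0 := by rw [A.φ_lie_right, hred' y _ hJr, neg_zero]
  rw [hf.eq_sum hdim v]
  have k1 := φ_swap hv.1
  have k2 := (φ_swap_J hv.2.1).trans neg_zero
  have k3 := φ_swap hv.2.2.1
  have k4 := (φ_swap_J hv.2.2.2).trans neg_zero
  simp [k1, k2, k3, k4, e1, A.φ_lie_self, h1, h2]

/-- With `r` and `J r` annihilated, the action has the single entry `φ ⁅y, b⁆ (J b)`. It vanishes on
every frame vector except possibly `a` and `J a`, where its values are the last two parameters. -/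
theorem isFlat_of_isTFrame (hdim : A.dim ≤ 8) {r b : A.carrier} {p q s s' : ℝ}
    (hT : A.IsTFrame a r z b p q s s' 0 0) : IsFlat a z := by
  have hred := h.isReduced_iff.1 hT.red
  have hredJ := h.isReduced_iff.1 hT.redJ
  have hr : r ∈ perp a z := ⟨hT.x₁x₃, hT.x₁Jx₃, φ_swap hT.x₃y₁, by simp [φ_swap_J hT.x₃Jy₁]⟩
  have hb : b ∈ perp a z := ⟨hT.x₁y₃, hT.x₁Jy₃, hT.y₁y₃, hT.y₁Jy₃⟩
  have hJr := J_mem_perp hr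
  have hJb := J_mem_perp hb
  have h1 : ∀ y : A.carrier, A.φ ⁅y, b⁆ (A.J b) = 0 := by
    intro y
    rw [hT.eq_sum hdim y]
    have e1 : A.φ ⁅r, b⁆ (A.J b) = 0 := by rw [A.φ_lie_swap, hred b _ hJb, neg_zero]
    have e2 : A.φ ⁅A.J r, b⁆ (A.J b) = 0 := by rw [A.φ_lie_swap, hredJ b _ hJb, neg_zero]
    simp [hT.ht, hT.ht', e1, e2, hT.cz.lie, hT.cJz.lie, A.φ_lie_self']
  intro u hu v hv y
  have h2 : A.φ ⁅y, A.J b⁆ b = 0 := by rw [A.φ_lie_right, h1, neg_zero]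
  have hl : ∀ v ∈ perp a z, A.φ ⁅y, v⁆ r = 0 := fun v hv => by
    rw [A.φ_lie_right, hred y v hv, neg_zero]
  have hlJ : ∀ v ∈ perp a z, A.φ ⁅y, v⁆ (A.J r) = 0 := fun v hv => by
    rw [A.φ_lie_right, hredJ y v hv, neg_zero]
  have key : ∀ u ∈ perp a z, u = A.φ u b • r + A.φ u (A.J b) • A.J r + A.φ u r • b
      + A.φ u (A.J r) • A.J b := by
    intro u hu
    conv_lhs => rw [hT.eq_sum hdim u]
    have k1 := φ_swap hu.1
    have k2 := (φ_swap_J hu.2.1).trans neg_zero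
    have k3 := φ_swap hu.2.2.1
    have k4 := (φ_swap_J hu.2.2.2).trans neg_zero
    simp [k1, k2, k3, k4]
  rw [key u hu, key v hv]
  simp [hred y, hredJ y, hr, hb, hJr, hJb, hl, hlJ, h1, h2, A.φ_lie_self]

theorem isFlat_or_exists_isTFrame (hA : A.IsNilpotent) (hdim : A.dim ≤ 8) : IsFlat a z ∨
    ∃ r b p q s s' t t', A.IsTFrame a r z b p q s s' t t' ∧ t ^ 2 + t' ^ 2 ≠ 0 := by
  by_contra! hcon
  obtain ⟨hF, hT⟩ := hcon
  obtain ⟨r, hr, hr0, hred⟩ := h.exists_isReduced hA hF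
  have rr : A.φ r r = 0 := by
    by_contra hne
    exact hF (h.isFlat_of_isReduced hA hdim hr hne hred)
  obtain ⟨b, hb, bb, rb, rJb⟩ := h.exists_dual_mem_perp hr hr0 rr
  have hf := h.isDualFrame hr hb rr bb rb rJb
  have hTF : A.IsTFrame a r z b _ _ _ _ _ _ :=
    { hf with
      cz := h.cz
      cJz := h.cJz
      red := hred
      redJ := h.isReduced_J hA hdim hr hb hf hred
      hp := rfl
      hq := rfl
      hs := rfl
      hs' := rfl
      ht := rfl
      ht' := rfl }
  have h0 := hT _ _ _ _ _ _ _ _ hTF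
  have ht : A.φ ⁅a, b⁆ (A.J b) = 0 := by
    nlinarith [sq_nonneg (A.φ ⁅a, b⁆ (A.J b)), sq_nonneg (A.φ ⁅A.J a, b⁆ (A.J b))]
  have ht' : A.φ ⁅A.J a, b⁆ (A.J b) = 0 := by
    nlinarith [sq_nonneg (A.φ ⁅a, b⁆ (A.J b)), sq_nonneg (A.φ ⁅A.J a, b⁆ (A.J b))]
  rw [ht, ht'] at hTF
  exact hF (h.isFlat_of_isTFrame hdim hTF)

end IsPair

namespace IsTFrame

variable {a r z b : A.carrier} {p q s s' t t' : ℝ} (h : A.IsTFrame a r z b p q s s' t t')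
include h

/-- Rescaling the pair `a, z` by a complex number. -/
theorem rescale_a {c d : ℝ} (hcd : c ^ 2 + d ^ 2 ≠ 0) :
    A.IsTFrame (c • a + d • A.J a) r ((c ^ 2 + d ^ 2)⁻¹ • (c • z + d • A.J z)) b
      ((c ^ 2 + d ^ 2) * p) ((c ^ 2 + d ^ 2) * q) ((c ^ 2 + d ^ 2) * s) ((c ^ 2 + d ^ 2) * s')
      (c * t + d * t') (c * t' - d * t) := by
  have hlie : ⁅c • a + d • A.J a, A.J (c • a + d • A.J a)⁆ = (c ^ 2 + d ^ 2) • ⁅a, A.J a⁆ := by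
    simp only [map_add, map_smul, A.J_sq, add_lie, lie_add, smul_lie, lie_smul, lie_self, lie_neg,
      ← lie_skew (A.J a) a]
    module
  have hz : ∀ w, A.φ ((c ^ 2 + d ^ 2)⁻¹ • (c • z + d • A.J z)) w = 0 →
      A.φ ((c ^ 2 + d ^ 2)⁻¹ • (c • z + d • A.J z)) (A.J w) = 0 →
      A.φ z w = 0 ∧ A.φ z (A.J w) = 0 := by
    intro w h1 h2
    simp only [map_add, map_smul, LinearMap.add_apply, LinearMap.smul_apply, smul_eq_mul,
      A.φ_J_left, A.J_sq, map_neg, mul_eq_zero, inv_eq_zero, hcd, false_or] at h1 h2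
    constructor
    · apply (mul_eq_zero.1 _).resolve_left hcd
      linear_combination c * h1 + d * h2
    · apply (mul_eq_zero.1 _).resolve_left hcd
      linear_combination c * h2 - d * h1
  constructor
  · constructor <;>
    simp only [map_add, map_sub, map_smul, LinearMap.add_apply, LinearMap.sub_apply,
      LinearMap.smul_apply, A.φ_J_left, A.φ_self_J, A.J_sq, map_neg,
      h.x₁x₁, h.x₃x₃, h.y₁y₁, h.y₃y₃, h.x₁y₁, h.x₁Jy₁, h.x₃y₃, h.x₃Jy₃, h.x₁x₃, h.x₁Jx₃, h.x₁y₃,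
      h.x₁Jy₃, h.x₃y₁, h.x₃Jy₁, h.y₁y₃, h.y₁Jy₃, smul_eq_mul] <;> first | ring1 | (field_simp; try ring1)
  · exact ((h.cz.smul c).add (h.cJz.smul d)).smul _
  · simp only [map_add, map_smul, A.J_sq]
    exact ((h.cJz.smul c).add (h.cz.neg.smul d)).smul _
  · exact fun y w h1 h2 => h.red y w (hz w h1 h2).1 (hz w h1 h2).2
  · exact fun y w h1 h2 => h.redJ y w (hz w h1 h2).1 (hz w h1 h2).2
  · rw [hlie, map_smul, LinearMap.smul_apply, h.hp, smul_eq_mul]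
  · rw [hlie, map_smul, LinearMap.smul_apply, h.hq, smul_eq_mul]
  · rw [hlie, map_smul, LinearMap.smul_apply, h.hs, smul_eq_mul]
  · rw [hlie, map_smul, LinearMap.smul_apply, h.hs', smul_eq_mul]
  · simp [h.ht, h.ht']
  · simp [h.ht, h.ht', A.J_sq]; ring

/-- Rescaling the pair `b, r` by a complex number. -/
theorem rescale_b {c d : ℝ} (hcd : c ^ 2 + d ^ 2 ≠ 0) :
    A.IsTFrame a ((c ^ 2 + d ^ 2)⁻¹ • (c • r + d • A.J r)) z (c • b + d • A.J b)
      ((c ^ 2 + d ^ 2)⁻¹ * (c * p + d * q)) ((c ^ 2 + d ^ 2)⁻¹ * (c * q - d * p))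
      (c * s + d * s') (c * s' - d * s) ((c ^ 2 + d ^ 2) * t) ((c ^ 2 + d ^ 2) * t') := by
  have e1 : A.φ ⁅a, A.J b⁆ b = -t := by rw [A.φ_lie_right, h.ht]
  have e2 : A.φ ⁅A.J a, A.J b⁆ b = -t' := by rw [A.φ_lie_right, h.ht']
  constructor
  · constructor <;>
    simp only [map_add, map_sub, map_smul, LinearMap.add_apply, LinearMap.sub_apply,
      LinearMap.smul_apply, A.φ_J_left, A.φ_self_J, A.J_sq, map_neg,
      h.x₁x₁, h.x₃x₃, h.y₁y₁, h.y₃y₃, h.x₁y₁, h.x₁Jy₁, h.x₃y₃, h.x₃Jy₃, h.x₁x₃, h.x₁Jx₃, h.x₁y₃,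
      h.x₁Jy₃, h.x₃y₁, h.x₃Jy₁, h.y₁y₃, h.y₁Jy₃, smul_eq_mul] <;> first | ring1 | (field_simp; try ring1)
  · exact h.cz
  · exact h.cJz
  · intro y w h1 h2
    simp [h.red y w h1 h2, h.redJ y w h1 h2]
  · intro y w h1 h2
    simp [h.red y w h1 h2, h.redJ y w h1 h2, A.J_sq]
  · simp [h.hp, h.hq]; ring
  · simp [h.hp, h.hq, A.J_sq]; ring
  · simp [h.hs, h.hs']
  · simp [h.hs, h.hs', A.J_sq]; ring
  · simp [h.ht, e1, A.J_sq, A.φ_lie_self]; ring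
  · simp [h.ht', e2, A.J_sq, A.φ_lie_self]; ring

/-- Adding a complex multiple of `b` to `a`. -/
theorem shear (m n : ℝ) :
    A.IsTFrame (a + m • b + n • A.J b) (r - m • z + n • A.J z) z b p q
      (s - m * t + n * t') (s' - n * t - m * t') t t' := by
  have e1 : A.φ ⁅a, A.J b⁆ b = -t := by rw [A.φ_lie_right, h.ht]
  have e2 : A.φ ⁅A.J a, A.J b⁆ b = -t' := by rw [A.φ_lie_right, h.ht']
  have e3 : A.φ ⁅b, A.J a⁆ (A.J b) = -t' := by rw [A.φ_lie_swap, h.ht']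
  have e4 : A.φ ⁅A.J b, A.J a⁆ b = t' := by rw [A.φ_lie_swap, e2, neg_neg]
  -- Brackets with `b` or `J b` never pair with `r` or `J r`, which is why the shear leaves `p` and
  -- `q` unchanged.
  have hbr : ∀ y : A.carrier, A.φ ⁅y, b⁆ r = 0 := fun y => by
    rw [A.φ_lie_right, h.red y b h.y₁y₃ h.y₁Jy₃, neg_zero]
  have hbJr : ∀ y : A.carrier, A.φ ⁅y, b⁆ (A.J r) = 0 := fun y => by
    rw [A.φ_lie_right, h.redJ y b h.y₁y₃ h.y₁Jy₃, neg_zero]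
  have hJb : A.φ z (A.J (A.J b)) = 0 := by rw [A.J_sq, map_neg, h.y₁y₃, neg_zero]
  have hJbr : ∀ y : A.carrier, A.φ ⁅y, A.J b⁆ r = 0 := fun y => by
    rw [A.φ_lie_right, h.red y _ h.y₁Jy₃ hJb, neg_zero]
  have hJbJr : ∀ y : A.carrier, A.φ ⁅y, A.J b⁆ (A.J r) = 0 := fun y => by
    rw [A.φ_lie_right, h.redJ y _ h.y₁Jy₃ hJb, neg_zero]
  have hbr' : ∀ y : A.carrier, A.φ ⁅b, y⁆ r = 0 := fun y => by rw [A.φ_lie_swap, hbr, neg_zero]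
  have hbJr' : ∀ y : A.carrier, A.φ ⁅b, y⁆ (A.J r) = 0 := fun y => by
    rw [A.φ_lie_swap, hbJr, neg_zero]
  have hJbr' : ∀ y : A.carrier, A.φ ⁅A.J b, y⁆ r = 0 := fun y => by
    rw [A.φ_lie_swap, hJbr, neg_zero]
  have hJbJr' : ∀ y : A.carrier, A.φ ⁅A.J b, y⁆ (A.J r) = 0 := fun y => by
    rw [A.φ_lie_swap, hJbJr, neg_zero]
  constructor
  · constructor <;>
    simp only [map_add, map_sub, map_smul, LinearMap.add_apply, LinearMap.sub_apply,
      LinearMap.smul_apply, A.φ_J_left, A.φ_self_J, A.J_sq, map_neg,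
      h.x₁x₁, h.x₃x₃, h.y₁y₁, h.y₃y₃, h.x₁y₁, h.x₁Jy₁, h.x₃y₃, h.x₃Jy₃, h.x₁x₃, h.x₁Jx₃, h.x₁y₃,
      h.x₁Jy₃, h.x₃y₁, h.x₃Jy₁, h.y₁y₃, h.y₁Jy₃,
      φ_swap h.x₁y₁, φ_swap h.x₃y₃, φ_swap h.x₁x₃, φ_swap h.x₁y₃, φ_swap h.x₃y₁, φ_swap h.y₁y₃,
      φ_swap_J h.x₁Jy₁, φ_swap_J h.x₃Jy₃, φ_swap_J h.x₁Jx₃, φ_swap_J h.x₁Jy₃, φ_swap_J h.x₃Jy₁,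
      φ_swap_J h.y₁Jy₃, smul_eq_mul] <;> ring
  · exact h.cz
  · exact h.cJz
  · intro y w h1 h2
    simp [h.red y w h1 h2, h.cz.lie', h.cJz.lie']
  · intro y w h1 h2
    simp [h.redJ y w h1 h2, h.cz.lie', h.cJz.lie', A.J_sq]
  · simp [h.hp, A.J_sq, hbr, hJbr, hbr', hJbr', h.cz.φ_lie, h.cJz.φ_lie]
  · simp [h.hq, A.J_sq, hbJr, hJbJr, hbJr', hJbJr', h.cz.φ_lie, h.cJz.φ_lie]
  · simp [h.hs, A.J_sq, e1, e4, A.φ_lie_self, A.φ_lie_self']; ring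
  · simp [h.hs', A.J_sq, h.ht, e3, A.φ_lie_self, A.φ_lie_self']; ring
  · simp [h.ht, A.φ_lie_self']
  · simp [h.ht', A.J_sq, A.φ_lie_self']

end IsTFrame

end PHQAlgebra
end PHQ

/-! ### Brackets of a frame with `s = s' = t' = 0` and its identification with a model -/

namespace PHQ
namespace PHQAlgebra
variable {A : PHQAlgebra.{u}}

/-- By cyclicity each pairing of `⁅u, r⁆` is one of the pairings that reducedness kills, so the
bracket is zero and not merely in the line of `z`. -/
theorem IsReduced.lie_eq_zero {z r u : A.carrier} (h : IsReduced z r) (h1 : A.φ z u = 0)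
    (h2 : A.φ z (A.J u) = 0) : ⁅u, r⁆ = 0 := by
  apply A.eq_zero_of_φ
  intro w
  rw [A.φ_lie_cyclic, A.φ_lie_swap, h w u h1 h2, neg_zero]

theorem IsDualFrame.isCentral {x₁ x₃ y₁ y₃ v : A.carrier} (h : A.IsDualFrame x₁ x₃ y₁ y₃)
    (hdim : A.dim ≤ 8) (h1 : ⁅x₁, v⁆ = 0) (h2 : ⁅A.J x₁, v⁆ = 0) (h3 : ⁅x₃, v⁆ = 0)
    (h4 : ⁅A.J x₃, v⁆ = 0) (h5 : ⁅y₁, v⁆ = 0) (h6 : ⁅A.J y₁, v⁆ = 0) (h7 : ⁅y₃, v⁆ = 0)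
    (h8 : ⁅A.J y₃, v⁆ = 0) : A.IsCentral v := by
  intro y
  rw [← lie_skew, neg_eq_zero, h.eq_sum hdim y]
  simp [h1, h2, h3, h4, h5, h6, h7, h8]

namespace IsTFrame

section Brackets

variable {a r z b : A.carrier} {p q t : ℝ} (h : A.IsTFrame a r z b p q 0 0 t 0)
include h

theorem lie_r {u : A.carrier} (h1 : A.φ z u = 0) (h2 : A.φ z (A.J u) = 0) : ⁅u, r⁆ = 0 :=
  h.red.lie_eq_zero h1 h2

theorem lie_Jr {u : A.carrier} (h1 : A.φ z u = 0) (h2 : A.φ z (A.J u) = 0) : ⁅u, A.J r⁆ = 0 :=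
  h.redJ.lie_eq_zero h1 h2

theorem b_r : ⁅b, r⁆ = 0 := h.lie_r h.y₁y₃ h.y₁Jy₃

theorem Jb_r : ⁅A.J b, r⁆ = 0 := h.lie_r h.y₁Jy₃ (by rw [A.J_sq, map_neg, h.y₁y₃, neg_zero])

theorem b_Jr : ⁅b, A.J r⁆ = 0 := h.lie_Jr h.y₁y₃ h.y₁Jy₃

theorem Jb_Jr : ⁅A.J b, A.J r⁆ = 0 :=
  h.lie_Jr h.y₁Jy₃ (by rw [A.J_sq, map_neg, h.y₁y₃, neg_zero])

theorem r_Jr : ⁅r, A.J r⁆ = 0 :=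
  h.lie_Jr (φ_swap h.x₃y₁) (by rw [φ_swap_J h.x₃Jy₁, neg_zero])

/-- A vector is determined by its pairings with a frame. -/
theorem eq_of_φ (hdim : A.dim ≤ 8) {v w : A.carrier} (h1 : A.φ v a = A.φ w a)
    (h2 : A.φ v (A.J a) = A.φ w (A.J a)) (h3 : A.φ v r = A.φ w r)
    (h4 : A.φ v (A.J r) = A.φ w (A.J r)) (h5 : A.φ v z = A.φ w z)
    (h6 : A.φ v (A.J z) = A.φ w (A.J z)) (h7 : A.φ v b = A.φ w b)
    (h8 : A.φ v (A.J b) = A.φ w (A.J b)) : v = w := by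
  rw [← sub_eq_zero]
  apply h.eq_zero hdim <;> simp [*]

theorem φ_lie_b (y : A.carrier) : A.φ ⁅y, b⁆ r = 0 ∧ A.φ ⁅y, b⁆ (A.J r) = 0 := by
  constructor <;> rw [A.φ_lie]
  · rw [A.φ_symm, h.red y b h.y₁y₃ h.y₁Jy₃, neg_zero]
  · rw [A.φ_symm, h.redJ y b h.y₁y₃ h.y₁Jy₃, neg_zero]

theorem φ_lie_Jb (y : A.carrier) : A.φ ⁅y, A.J b⁆ r = 0 ∧ A.φ ⁅y, A.J b⁆ (A.J r) = 0 := by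
  have hJb : A.φ z (A.J (A.J b)) = 0 := by rw [A.J_sq, map_neg, h.y₁y₃, neg_zero]
  constructor <;> rw [A.φ_lie]
  · rw [A.φ_symm, h.red y _ h.y₁Jy₃ hJb, neg_zero]
  · rw [A.φ_symm, h.redJ y _ h.y₁Jy₃ hJb, neg_zero]

variable (hdim : A.dim ≤ 8)
include hdim

theorem a_Ja : ⁅a, A.J a⁆ = p • b + q • A.J b := by
  apply h.eq_of_φ hdim <;>
  simp [h.hp, h.hq, h.hs, h.hs', A.φ_lie_self, A.φ_lie_self', h.cz.φ_lie, h.cJz.φ_lie,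
    A.φ_J_left b, A.J_sq, h.y₃y₃, A.φ_self_J, φ_swap h.x₁y₃, φ_swap h.y₁y₃, φ_swap h.x₃y₃,
    φ_swap_J h.x₁Jy₃, φ_swap_J h.y₁Jy₃, φ_swap_J h.x₃Jy₃]

theorem a_b : ⁅a, b⁆ = t • A.J r := by
  have e : A.φ ⁅a, b⁆ (A.J a) = 0 := by rw [A.φ_lie_right, h.hs, neg_zero]
  apply h.eq_of_φ hdim <;>
  simp [h.ht, e, (h.φ_lie_b a).1, (h.φ_lie_b a).2, A.φ_lie_self, A.φ_lie_self', h.cz.φ_lie,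
    h.cJz.φ_lie, A.φ_J_left r, A.J_sq, h.x₃x₃, A.φ_self_J, φ_swap h.x₁x₃, h.x₃y₁, h.x₃y₃,
    φ_swap_J h.x₁Jx₃, h.x₃Jy₁, h.x₃Jy₃]

theorem a_Jb : ⁅a, A.J b⁆ = -(t • r) := by
  have e : A.φ ⁅a, A.J b⁆ (A.J a) = 0 := by rw [A.φ_lie_right, h.hs', neg_zero]
  have e' : A.φ ⁅a, A.J b⁆ b = -t := by rw [A.φ_lie_right, h.ht]
  apply h.eq_of_φ hdim <;>
  simp [e', e, (h.φ_lie_Jb a).1, (h.φ_lie_Jb a).2, A.φ_lie_self, A.φ_lie_self', h.cz.φ_lie,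
    h.cJz.φ_lie, A.J_sq, h.x₃x₃, A.φ_self_J, φ_swap h.x₁x₃, h.x₃y₁, h.x₃y₃,
    φ_swap_J h.x₁Jx₃, h.x₃Jy₁, h.x₃Jy₃]

theorem Ja_b : ⁅A.J a, b⁆ = 0 := by
  have e : A.φ ⁅A.J a, b⁆ a = 0 := by rw [A.φ_lie_right, A.φ_lie_swap, h.hs]; simp
  apply h.eq_of_φ hdim <;>
  simp [h.ht', e, (h.φ_lie_b _).1, (h.φ_lie_b _).2, A.φ_lie_self, A.φ_lie_self', h.cz.φ_lie,
    h.cJz.φ_lie]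

theorem Ja_Jb : ⁅A.J a, A.J b⁆ = 0 := by
  have e : A.φ ⁅A.J a, A.J b⁆ a = 0 := by rw [A.φ_lie_right, A.φ_lie_swap, h.hs']; simp
  have e' : A.φ ⁅A.J a, A.J b⁆ b = 0 := by rw [A.φ_lie_right, h.ht', neg_zero]
  apply h.eq_of_φ hdim <;>
  simp [e', e, (h.φ_lie_Jb _).1, (h.φ_lie_Jb _).2, A.φ_lie_self, A.φ_lie_self', h.cz.φ_lie,
    h.cJz.φ_lie]

theorem b_Jb : ⁅b, A.J b⁆ = t • z := by
  have e : A.φ ⁅b, A.J b⁆ a = t := by rw [← A.φ_lie_cyclic, h.ht]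
  have e' : A.φ ⁅b, A.J b⁆ (A.J a) = 0 := by rw [← A.φ_lie_cyclic, h.ht']
  apply h.eq_of_φ hdim <;>
  simp [e', e, (h.φ_lie_Jb _).1, (h.φ_lie_Jb _).2, A.φ_lie_self, A.φ_lie_self', h.cz.φ_lie,
    h.cJz.φ_lie, h.y₁y₁, h.y₁y₃, h.y₁Jy₃, φ_swap h.x₁y₁, φ_swap h.x₃y₁, φ_swap_J h.x₁Jy₁,
    φ_swap_J h.x₃Jy₁, A.φ_self_J]

theorem a_r : ⁅a, r⁆ = -(p • A.J z) := by
  have e : A.φ ⁅a, r⁆ (A.J a) = -p := by rw [A.φ_lie_right, h.hp]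
  have hb := h.red a b h.y₁y₃ h.y₁Jy₃
  have hJb := h.red a (A.J b) h.y₁Jy₃ (by rw [A.J_sq, map_neg, h.y₁y₃, neg_zero])
  have hJr : A.φ ⁅a, r⁆ (A.J r) = 0 := by rw [A.φ_lie_cyclic, h.r_Jr]; simp
  apply h.eq_of_φ hdim <;>
  simp [e, hb, hJb, hJr, A.φ_lie_self, A.φ_lie_self', h.cz.φ_lie, h.cJz.φ_lie, A.φ_J_left z,
    A.J_sq, h.y₁y₁, h.y₁y₃, h.y₁Jy₃, φ_swap h.x₁y₁, φ_swap h.x₃y₁, φ_swap_J h.x₁Jy₁,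
    φ_swap_J h.x₃Jy₁, A.φ_self_J]

theorem a_Jr : ⁅a, A.J r⁆ = -(q • A.J z) := by
  have e : A.φ ⁅a, A.J r⁆ (A.J a) = -q := by rw [A.φ_lie_right, h.hq]
  have hb := h.redJ a b h.y₁y₃ h.y₁Jy₃
  have hJb := h.redJ a (A.J b) h.y₁Jy₃ (by rw [A.J_sq, map_neg, h.y₁y₃, neg_zero])
  have hJr : A.φ ⁅a, A.J r⁆ r = 0 := by rw [A.φ_lie_right, A.φ_lie_cyclic, h.r_Jr]; simp
  apply h.eq_of_φ hdim <;>
  simp [e, hb, hJb, hJr, A.φ_lie_self, A.φ_lie_self', h.cz.φ_lie, h.cJz.φ_lie, A.φ_J_left z,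
    A.J_sq, h.y₁y₁, h.y₁y₃, h.y₁Jy₃, φ_swap h.x₁y₁, φ_swap h.x₃y₁, φ_swap_J h.x₁Jy₁,
    φ_swap_J h.x₃Jy₁, A.φ_self_J]

theorem Ja_r : ⁅A.J a, r⁆ = p • z := by
  have e : A.φ ⁅A.J a, r⁆ a = p := by rw [← A.φ_lie_cyclic, h.hp]
  have hb := h.red (A.J a) b h.y₁y₃ h.y₁Jy₃
  have hJb := h.red (A.J a) (A.J b) h.y₁Jy₃ (by rw [A.J_sq, map_neg, h.y₁y₃, neg_zero])
  have hJr : A.φ ⁅A.J a, r⁆ (A.J r) = 0 := by rw [A.φ_lie_cyclic, h.r_Jr]; simp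
  apply h.eq_of_φ hdim <;>
  simp [e, hb, hJb, hJr, A.φ_lie_self, A.φ_lie_self', h.cz.φ_lie, h.cJz.φ_lie,
    A.J_sq, h.y₁y₁, h.y₁y₃, h.y₁Jy₃, φ_swap h.x₁y₁, φ_swap h.x₃y₁, φ_swap_J h.x₁Jy₁,
    φ_swap_J h.x₃Jy₁, A.φ_self_J]

theorem Ja_Jr : ⁅A.J a, A.J r⁆ = q • z := by
  have e : A.φ ⁅A.J a, A.J r⁆ a = q := by rw [← A.φ_lie_cyclic, h.hq]
  have hb := h.redJ (A.J a) b h.y₁y₃ h.y₁Jy₃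
  have hJb := h.redJ (A.J a) (A.J b) h.y₁Jy₃ (by rw [A.J_sq, map_neg, h.y₁y₃, neg_zero])
  have hJr : A.φ ⁅A.J a, A.J r⁆ r = 0 := by rw [A.φ_lie_right, A.φ_lie_cyclic, h.r_Jr]; simp
  apply h.eq_of_φ hdim <;>
  simp [e, hb, hJb, hJr, A.φ_lie_self, A.φ_lie_self', h.cz.φ_lie, h.cJz.φ_lie,
    A.J_sq, h.y₁y₁, h.y₁y₃, h.y₁Jy₃, φ_swap h.x₁y₁, φ_swap h.x₃y₁, φ_swap_J h.x₁Jy₁,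
    φ_swap_J h.x₃Jy₁, A.φ_self_J]

end Brackets

variable {a r z b : A.carrier}

theorem isCentral_Jr {p t : ℝ} (h : A.IsTFrame a r z b p 0 0 0 t 0) (hdim : A.dim ≤ 8) :
    A.IsCentral (A.J r) := by
  refine h.isCentral hdim ?_ ?_ h.r_Jr (lie_self _) (h.cz.lie _) (h.cJz.lie _) h.b_Jr h.Jb_Jr
  · rw [h.a_Jr hdim]; simp
  · rw [h.Ja_Jr hdim]; simp

theorem isCentral_r {q t : ℝ} (h : A.IsTFrame a r z b 0 q 0 0 t 0) (hdim : A.dim ≤ 8) :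
    A.IsCentral r := by
  refine h.isCentral hdim ?_ ?_ (lie_self _) ?_ (h.cz.lie _) (h.cJz.lie _) h.b_r h.Jb_r
  · rw [h.a_r hdim]; simp
  · rw [h.Ja_r hdim]; simp
  · rw [← lie_skew, h.r_Jr, neg_zero]

/-- Now `a` and `J a` commute, and the Kodaira–Thurston bracket is `⁅b, J b⁆ = z`; so `b, z` span
the base, with `r, a` as their duals. -/
theorem equivalent_T0k (h : A.IsTFrame a r z b 0 0 0 0 1 0) (hdim : A.dim ≤ 8) :
    Equivalent A T0k := by
  have hf : A.IsDualFrame b z r a :=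
    { x₁x₁ := h.y₃y₃
      x₃x₃ := h.y₁y₁
      y₁y₁ := h.x₃x₃
      y₃y₃ := h.x₁x₁
      x₁y₁ := φ_swap h.x₃y₃
      x₁Jy₁ := by rw [φ_swap_J h.x₃Jy₃, neg_zero]
      x₃y₃ := φ_swap h.x₁y₁
      x₃Jy₃ := by rw [φ_swap_J h.x₁Jy₁, neg_zero]
      x₁x₃ := φ_swap h.y₁y₃
      x₁Jx₃ := by rw [φ_swap_J h.y₁Jy₃, neg_zero]
      x₁y₃ := φ_swap h.x₁y₃
      x₁Jy₃ := by rw [φ_swap_J h.x₁Jy₃, neg_zero]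
      x₃y₁ := φ_swap h.x₃y₁
      x₃Jy₁ := by rw [φ_swap_J h.x₃Jy₁, neg_zero]
      y₁y₃ := φ_swap h.x₁x₃
      y₁Jy₃ := by rw [φ_swap_J h.x₁Jx₃, neg_zero] }
  refine hf.equivalent_T0k hdim h.cz h.cJz (h.isCentral_r hdim) (h.isCentral_Jr hdim)
    ?_ ?_ ?_ ?_ ?_ ?_
  · rw [h.b_Jb hdim, one_smul]
  · rw [lie_swap (h.a_b hdim), one_smul]
  · rw [lie_swap (h.a_Jb hdim), one_smul, neg_neg]
  · rw [lie_swap (h.Ja_b hdim), neg_zero]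
  · rw [lie_swap (h.Ja_Jb hdim), neg_zero]
  · rw [h.a_Ja hdim]; simp

/-- The Kodaira–Thurston bracket is now `⁅a, J a⁆ = b`, with `z, r` dual to `a, b`; the brackets of
`a, J a, b, J b` valued in the dual part form `θ₃`. -/
theorem equivalent_Tθ₃k (h : A.IsTFrame a r z b 1 0 0 0 1 0) (hdim : A.dim ≤ 8) :
    Equivalent A Tθ₃k := by
  have hf : A.IsDualFrame a b z r :=
    { x₁x₁ := h.x₁x₁
      x₃x₃ := h.y₃y₃
      y₁y₁ := h.y₁y₁
      y₃y₃ := h.x₃x₃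
      x₁y₁ := h.x₁y₁
      x₁Jy₁ := h.x₁Jy₁
      x₃y₃ := φ_swap h.x₃y₃
      x₃Jy₃ := by rw [φ_swap_J h.x₃Jy₃, neg_zero]
      x₁x₃ := h.x₁y₃
      x₁Jx₃ := h.x₁Jy₃
      x₁y₃ := h.x₁x₃
      x₁Jy₃ := h.x₁Jx₃
      x₃y₁ := φ_swap h.y₁y₃
      x₃Jy₁ := by rw [φ_swap_J h.y₁Jy₃, neg_zero]
      y₁y₃ := φ_swap h.x₃y₁
      y₁Jy₃ := by rw [φ_swap_J h.x₃Jy₁, neg_zero] }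
  refine hf.equivalent_Tθ₃k hdim (h.isCentral_Jr hdim) h.cz h.cJz
    ?_ ?_ ?_ ?_ ?_ (h.Ja_b hdim) (h.Ja_Jb hdim) ?_ h.b_r h.Jb_r
  · rw [h.a_Ja hdim]; simp
  · rw [h.a_r hdim, one_smul]
  · rw [h.Ja_r hdim, one_smul]
  · rw [h.a_b hdim, one_smul]
  · rw [h.a_Jb hdim, one_smul]
  · rw [h.b_Jb hdim, one_smul]

/-- A complex rescaling of `a` makes `(t, t') = (1, 0)`, and a shear then removes `(s, s')`. The
pair `(p, q)` is either zero or becomes `(1, 0)` by a complex rescaling of `b`; a final real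
rescaling restores `t = 1`. -/
theorem equivalent_or {p q s s' t t' : ℝ} (h : A.IsTFrame a r z b p q s s' t t')
    (ht : t ^ 2 + t' ^ 2 ≠ 0) (hdim : A.dim ≤ 8) : Equivalent A T0k ∨ Equivalent A Tθ₃k := by
  set n := t ^ 2 + t' ^ 2 with hn
  have hc : (t / n) ^ 2 + (t' / n) ^ 2 = n⁻¹ := by
    field_simp; exact hn.symm
  have h1 := h.rescale_a (c := t / n) (d := t' / n) (by rw [hc]; exact inv_ne_zero ht)
  have e1 : t / n * t + t' / n * t' = 1 := by field_simp; exact hn.symm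
  have e2 : t / n * t' - t' / n * t = 0 := by ring
  rw [e1, e2, hc] at h1
  have h2 := h1.shear (n⁻¹ * s) (n⁻¹ * s')
  have e3 : n⁻¹ * s - n⁻¹ * s * 1 + n⁻¹ * s' * 0 = 0 := by ring
  have e4 : n⁻¹ * s' - n⁻¹ * s' * 1 - n⁻¹ * s * 0 = 0 := by ring
  rw [e3, e4] at h2
  generalize n⁻¹ * p = p at h2
  generalize n⁻¹ * q = q at h2
  by_cases h0 : p ^ 2 + q ^ 2 = 0
  · left
    have hp : p = 0 := by nlinarith [sq_nonneg p, sq_nonneg q]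
    have hq : q = 0 := by nlinarith [sq_nonneg p, sq_nonneg q]
    rw [hp, hq] at h2
    exact h2.equivalent_T0k hdim
  · right
    have h3 := h2.rescale_b h0
    have hpos : 0 < p ^ 2 + q ^ 2 := lt_of_le_of_ne (by positivity) (Ne.symm h0)
    have e5 : (p ^ 2 + q ^ 2)⁻¹ * (p * p + q * q) = 1 := by field_simp
    have e6 : (p ^ 2 + q ^ 2)⁻¹ * (p * q - q * p) = 0 := by ring
    have e7 : p * 0 + q * 0 = 0 := by ring
    have e8 : p * 0 - q * 0 = 0 := by ring
    have e9 : (p ^ 2 + q ^ 2) * 0 = 0 := by ring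
    rw [e5, e6, e7, e8, e9, mul_one] at h3
    generalize p ^ 2 + q ^ 2 = t at h3 hpos
    -- Scaling `a` by `m` and `b` by `m ^ 2` preserves `p = 1` and multiplies `t` by `m ^ 5`.
    obtain ⟨m, hm, hmt⟩ : ∃ m : ℝ, 0 < m ∧ m ^ 5 * t = 1 := by
      refine ⟨(t⁻¹) ^ ((5 : ℝ)⁻¹), by positivity, ?_⟩
      have := Real.rpow_inv_natCast_pow (x := t⁻¹) (by positivity) (n := 5) (by norm_num)
      push_cast at this
      rw [this, inv_mul_cancel₀ hpos.ne']
    have h4 := h3.rescale_a (c := m) (d := 0) (by positivity)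
    have h5 := h4.rescale_b (c := m ^ 2) (d := 0) (by positivity)
    have f1 : ((m ^ 2) ^ 2 + 0 ^ 2)⁻¹ * (m ^ 2 * ((m ^ 2 + 0 ^ 2) * 1)
        + 0 * ((m ^ 2 + 0 ^ 2) * 0)) = 1 := by field_simp; ring
    have f2 : ((m ^ 2) ^ 2 + 0 ^ 2) * (m * t + 0 * 0) = 1 := by linear_combination hmt
    simp only [f1, f2] at h5
    simp only [mul_zero, zero_mul, sub_zero, add_zero, sub_self] at h5
    exact h5.equivalent_Tθ₃k hdim

end IsTFrame

/-- Every indecomposable algebra with isotropic centre is one of four. -/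
theorem HasIsotropicCenter.equivalent [Nontrivial A.carrier] (hI : A.HasIsotropicCenter)
    (hA : A.IsNilpotent) (hdim : A.dim ≤ 8) :
    Equivalent A L42 ∨ Equivalent A L24 ∨ Equivalent A T0k ∨ Equivalent A Tθ₃k := by
  obtain ⟨z, hz0, cz, cJz⟩ := exists_isCentral_isCentral_J hA hdim
  have zz := hI z cz cJz
  obtain ⟨a, h1, h2, aa⟩ := exists_isotropic_dual hz0 zz
  have h : A.IsPair a z :=
    ⟨cz, cJz, zz, aa, φ_swap h1, φ_swap h2⟩
  rcases h.isFlat_or_exists_isTFrame hA hdim with hF | ⟨r, b, p, q, s, s', t, t', hT, ht⟩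
  · rcases h.equivalent_of_isFlat hF hdim hI with h' | h' | h' <;> simp [h']
  · rcases hT.equivalent_or ht hdim with h' | h' <;> simp [h']

end PHQAlgebra
end PHQ

namespace PHQ
namespace PHQAlgebra
variable {A : PHQAlgebra.{u}}

/-! ### Non-isotropic central lines -/

/-- The ideal spanned by a central complex line. -/
def clineIdeal {z : A.carrier} (cz : A.IsCentral z) (cJz : A.IsCentral (A.J z)) :
    LieIdeal ℝ A.carrier where
  __ := cline z
  lie_mem := by
    intro x m hm
    obtain ⟨p, q, rfl⟩ := mem_cline.1 hm
    rw [lie_add, lie_smul, lie_smul, cz.lie', cJz.lie']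
    simp

theorem mem_clineIdeal {z : A.carrier} (cz : A.IsCentral z) (cJz : A.IsCentral (A.J z))
    {x : A.carrier} : x ∈ clineIdeal cz cJz ↔ ∃ p q : ℝ, p • z + q • A.J z = x := mem_cline

/-- The orthogonal of a central complex line. -/
def clinePerp {z : A.carrier} (cz : A.IsCentral z) (cJz : A.IsCentral (A.J z)) :
    LieIdeal ℝ A.carrier where
  carrier := {x | A.φ x z = 0 ∧ A.φ x (A.J z) = 0}
  add_mem' := by
    rintro x y ⟨h1, h2⟩ ⟨h3, h4⟩
    simp [*]
  zero_mem' := by simp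
  smul_mem' := by
    rintro t x ⟨h1, h2⟩
    simp [*]
  lie_mem := by
    intro x m _
    exact ⟨cz.φ_lie _ _, cJz.φ_lie _ _⟩

/-- A central complex line with `φ z z ≠ 0` is a non-degenerate `J`-invariant ideal complementary to
its orthogonal, so indecomposability makes that orthogonal zero. -/
theorem dim_le_two_of_isIndecomposable (hA : A.IsIndecomposable) {z : A.carrier}
    (cz : A.IsCentral z) (cJz : A.IsCentral (A.J z)) (hz : A.φ z z ≠ 0) : A.dim ≤ 2 := by
  have hmem : ∀ {x}, x ∈ clinePerp cz cJz ↔ A.φ x z = 0 ∧ A.φ x (A.J z) = 0 := Iff.rfl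
  have hsplit : ∀ x, ∃ i ∈ clineIdeal cz cJz, ∃ k ∈ clinePerp cz cJz, i + k = x := by
    intro x
    refine ⟨(A.φ x z / A.φ z z) • z + (A.φ x (A.J z) / A.φ z z) • A.J z,
      (mem_clineIdeal cz cJz).2 ⟨_, _, rfl⟩, x - ((A.φ x z / A.φ z z) • z
        + (A.φ x (A.J z) / A.φ z z) • A.J z), hmem.2 ⟨?_, ?_⟩, add_sub_cancel _ _⟩ <;>
    simp [A.φ_J_self, A.φ_self_J, A.φ_J_J, hz]
  have horth : ∀ x ∈ clineIdeal cz cJz, ∀ y ∈ clinePerp cz cJz, A.φ x y = 0 := by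
    intro x hx y hy
    obtain ⟨p, q, rfl⟩ := (mem_clineIdeal cz cJz).1 hx
    simp [φ_swap (hmem.1 hy).1, φ_swap (hmem.1 hy).2]
  have hdisj : ∀ x, x ∈ clineIdeal cz cJz → x ∈ clinePerp cz cJz → x = 0 := by
    intro x hx hy
    obtain ⟨p, q, rfl⟩ := (mem_clineIdeal cz cJz).1 hx
    obtain ⟨h1, h2⟩ := hmem.1 hy
    simp only [map_add, map_smul, LinearMap.add_apply, LinearMap.smul_apply, A.φ_J_self,
      A.φ_self_J, A.φ_J_J, smul_eq_mul, mul_zero, add_zero, zero_add, mul_eq_zero, hz,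
      or_false] at h1 h2
    simp [h1, h2]
  have hI : A.IsPHQIdeal (clineIdeal cz cJz) := by
    constructor
    · intro x hx
      obtain ⟨p, q, rfl⟩ := (mem_clineIdeal cz cJz).1 hx
      exact (mem_clineIdeal cz cJz).2 ⟨-q, p, by simp only [map_add, map_smul, A.J_sq]; module⟩
    · intro x hx h
      apply A.eq_zero_of_φ
      intro y
      obtain ⟨i, hi, k, hk, rfl⟩ := hsplit y
      rw [map_add, h i hi, horth x hx k hk, add_zero]
  have hK : A.IsPHQIdeal (clinePerp cz cJz) := by
    constructor
    · intro x hx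
      obtain ⟨h1, h2⟩ := hmem.1 hx
      exact hmem.2 ⟨by rw [A.φ_J_left, h2, neg_zero], by rw [A.φ_J_J, h1]⟩
    · intro x hx h
      apply A.eq_zero_of_φ
      intro y
      obtain ⟨i, hi, k, hk, rfl⟩ := hsplit y
      rw [map_add, h k hk, A.φ_symm, horth i hi x hx, add_zero]
  have hcompl : IsCompl (clineIdeal cz cJz) (clinePerp cz cJz) := by
    rw [← LieSubmodule.isCompl_toSubmodule]
    constructor
    · rw [Submodule.disjoint_def]
      exact hdisj
    · rw [codisjoint_iff, Submodule.eq_top_iff']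
      intro x
      obtain ⟨i, hi, k, hk, rfl⟩ := hsplit x
      exact Submodule.add_mem_sup hi hk
  have hK0 : clinePerp cz cJz = ⊥ := by
    by_contra hne
    refine hA.2 ⟨_, _, fun h0 => hz ?_, hne, hI, hK, horth, hcompl⟩
    have : z ∈ clineIdeal cz cJz := (mem_clineIdeal cz cJz).2 ⟨1, 0, by simp⟩
    rw [h0, LieSubmodule.mem_bot] at this
    simp [this]
  have htop : cline z = ⊤ := by
    rw [Submodule.eq_top_iff']
    intro x
    obtain ⟨i, hi, k, hk, rfl⟩ := hsplit x
    rw [hK0, LieSubmodule.mem_bot] at hk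
    rw [hk, add_zero]
    exact hi
  rw [PHQAlgebra.dim, ← finrank_top, ← htop]
  classical
  have h := finrank_span_finset_le_card (R := ℝ) ({z, A.J z} : Finset A.carrier)
  rw [Finset.coe_pair] at h
  exact h.trans Finset.card_le_two

theorem equivalent_R02_of_pos (hdim : A.dim ≤ 2) {z : A.carrier}
    (cz : A.IsCentral z) (cJz : A.IsCentral (A.J z)) (hz : 0 < A.φ z z) : Equivalent A R02 := by
  refine equivalent_R02 (z := (√(A.φ z z))⁻¹ • z) hdim (cz.smul _) ?_ ?_
  · rw [map_smul]
    exact cJz.smul _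
  · simp only [map_smul, LinearMap.smul_apply, smul_eq_mul]
    have h2 : √(A.φ z z) ≠ 0 := (Real.sqrt_pos.2 hz).ne'
    field_simp
    exact (Real.sq_sqrt hz.le).symm

theorem IsIndecomposable.exists_equivalent (hI : A.IsIndecomposable) (hA : A.IsNilpotent)
    (hdim : A.dim ≤ 8) : ∃ i : Label, Equivalent A i.alg := by
  by_cases hiso : A.HasIsotropicCenter
  · have := hI.1
    rcases hiso.equivalent hA hdim with h | h | h | h
    · exact ⟨.L42, h⟩
    · exact ⟨.L24, h⟩
    · exact ⟨.T0k, h⟩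
    · exact ⟨.Tθ₃k, h⟩
  · simp only [HasIsotropicCenter, not_forall] at hiso
    obtain ⟨z, cz, cJz, hz⟩ := hiso
    have h2 := dim_le_two_of_isIndecomposable hI cz cJz hz
    rcases lt_or_gt_of_ne hz with hlt | hgt
    · refine ⟨.R20, Equivalent.opposite (equivalent_R02_of_pos (A := A.opposite) (z := z) h2
        cz cJz ?_)⟩
      change 0 < -A.φ z z
      linarith
    · exact ⟨.R02, equivalent_R02_of_pos h2 cz cJz hgt⟩

end PHQAlgebra
end PHQ

namespace PHQ
namespace PHQAlgebra
variable {A : PHQAlgebra.{u}}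

/-! ### Indecomposability criteria -/

/-- The ideals `I` and `K` split `A` orthogonally and are `J`-invariant. -/
structure IsSplitting (A : PHQAlgebra.{u}) (I K : LieIdeal ℝ A.carrier) : Prop where
  J_left : ∀ x ∈ I, A.J x ∈ I
  J_right : ∀ x ∈ K, A.J x ∈ K
  orth : ∀ x ∈ I, ∀ y ∈ K, A.φ x y = 0
  disj : ∀ x, x ∈ I → x ∈ K → x = 0
  split : ∀ x, ∃ i ∈ I, ∃ k ∈ K, i + k = x

namespace IsSplitting

variable {I K : LieIdeal ℝ A.carrier} (h : A.IsSplitting I K)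
include h

theorem symm : A.IsSplitting K I where
  J_left := h.J_right
  J_right := h.J_left
  orth x hx y hy := by rw [A.φ_symm, h.orth y hy x hx]
  disj x hx hy := h.disj x hy hx
  split x := by
    obtain ⟨i, hi, k, hk, rfl⟩ := h.split x
    exact ⟨k, hk, i, hi, add_comm _ _⟩

theorem lie_eq_zero {x y : A.carrier} (hx : x ∈ I) (hy : y ∈ K) : ⁅x, y⁆ = 0 :=
  h.disj _ (lie_mem_left ℝ _ I x y hx) (lie_mem_right ℝ _ K x y hy)

theorem lie_split_left {x y i k : A.carrier} (hx : x ∈ I) (hk : k ∈ K)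
    (hik : i + k = y) : ⁅x, y⁆ = ⁅x, i⁆ := by
  rw [← hik, lie_add, h.lie_eq_zero hx hk, add_zero]

theorem eq_zero_of_comb {x z : A.carrier} (hz : z ∈ K) (hx : x ∈ I) {p q : ℝ}
    (hpq : p • z + q • A.J z = x) : x = 0 :=
  h.disj x hx (hpq ▸ K.add_mem (K.smul_mem p hz) (K.smul_mem q (h.J_right z hz)))

theorem isCentral_left {i k : A.carrier} (hi : i ∈ I) (hk : k ∈ K) (hc : A.IsCentral (i + k)) :
    A.IsCentral i := by
  intro y
  obtain ⟨i', hi', k', hk', rfl⟩ := h.split y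
  have h1 := hc i'
  rw [add_lie, h.symm.lie_eq_zero hk hi', add_zero] at h1
  rw [lie_add, h1, h.lie_eq_zero hi hk', add_zero]

/-- The `I`-component of `z` and its `J`-image are again central, so it is a complex multiple of
`z`. A non-zero factor can be inverted, placing `z` in `I`; a zero factor places `z` in `K`. -/
theorem mem_or_mem {z : A.carrier} (cz : A.IsCentral z) (cJz : A.IsCentral (A.J z))
    (hz : ∀ x, A.IsCentral x → A.IsCentral (A.J x) → ∃ p q : ℝ, p • z + q • A.J z = x) :
    z ∈ I ∨ z ∈ K := by
  obtain ⟨i, hi, k, hk, hik⟩ := h.split z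
  have hJ : A.J i + A.J k = A.J z := by rw [← map_add, hik]
  obtain ⟨p, q, hpq⟩ := hz i (h.isCentral_left hi hk (hik ▸ cz))
    (h.isCentral_left (h.J_left i hi) (h.J_right k hk) (hJ ▸ cJz))
  by_cases h0 : p ^ 2 + q ^ 2 = 0
  · right
    have hp : p = 0 := by nlinarith [sq_nonneg p, sq_nonneg q]
    have hq : q = 0 := by nlinarith [sq_nonneg p, sq_nonneg q]
    rw [hp, hq, zero_smul, zero_smul, add_zero] at hpq
    rwa [← hik, ← hpq, zero_add]
  · left
    have h1 : (p ^ 2 + q ^ 2)⁻¹ • (p • i - q • A.J i) = z := by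
      have : p • i - q • A.J i = (p ^ 2 + q ^ 2) • z := by
        rw [← hpq]
        simp only [map_add, map_smul, A.J_sq]
        module
      rw [this, smul_smul, inv_mul_cancel₀ h0, one_smul]
    rw [← h1]
    exact I.smul_mem _ (I.sub_mem (I.smul_mem _ hi) (I.smul_mem _ (h.J_left i hi)))

end IsSplitting

/-- The vector `z` serves as a marker of one summand; by symmetry of splittings it is enough to
empty the summand not containing it. -/
theorem not_isDecomposable {z : A.carrier} (h1 : ∀ I K, A.IsSplitting I K → z ∈ I ∨ z ∈ K)
    (h2 : ∀ I K, A.IsSplitting I K → z ∈ K → ∀ x ∈ I, x = 0) : ¬ A.IsDecomposable := by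
  rintro ⟨I, K, hI, hK, hI', hK', horth, hcompl⟩
  have h : A.IsSplitting I K := by
    rw [← LieSubmodule.isCompl_toSubmodule] at hcompl
    refine ⟨hI'.1, hK'.1, horth, Submodule.disjoint_def.1 hcompl.disjoint, fun x => ?_⟩
    exact Submodule.mem_sup.1 (hcompl.sup_eq_top.ge Submodule.mem_top)
  rcases h1 I K h with hz | hz
  · exact hK ((LieSubmodule.eq_bot_iff K).2 (h2 K I h.symm hz))
  · exact hI ((LieSubmodule.eq_bot_iff I).2 (h2 I K h hz))

theorem IsIndecomposable.opposite (h : A.IsIndecomposable) : A.opposite.IsIndecomposable := by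
  refine ⟨h.1, fun hd => h.2 ?_⟩
  obtain ⟨I, K, hI, hK, hI', hK', horth, hcompl⟩ := hd
  have hneg : ∀ {x y : A.carrier}, A.opposite.φ x y = 0 ↔ A.φ x y = 0 := neg_eq_zero
  exact ⟨I, K, hI, hK, ⟨hI'.1, fun x hx hx' => hI'.2 x hx fun y hy => hneg.2 (hx' y hy)⟩,
    ⟨hK'.1, fun x hx hx' => hK'.2 x hx fun y hy => hneg.2 (hx' y hy)⟩,
    fun x hx y hy => hneg.1 (horth x hx y hy), hcompl⟩

end PHQAlgebra

open PHQAlgebra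

/-! ### The six models -/

theorem isNilpotent_R02 : R02.IsNilpotent :=
  isNilpotent_of_lie_lie_lie (g := Plane) fun _ _ _ _ => rfl

theorem isIndecomposable_R02 : R02.IsIndecomposable := by
  have hJ0 : ∀ x : Plane, Plane.J x 0 = -x 1 := fun _ => rfl
  have hJ1 : ∀ x : Plane, Plane.J x 1 = x 0 := fun _ => rfl
  let z : Plane := (![1, 0] : Fin 2 → ℝ)
  have hz0 : z 0 = 1 := rfl
  have hz1 : z 1 = 0 := rfl
  constructor
  · exact ⟨z, 0, fun h => one_ne_zero (congrFun h 0)⟩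
  · have hc : ∀ x : R02.carrier, R02.IsCentral x := fun x y => rfl
    refine not_isDecomposable (A := R02) (z := z) ?_ ?_
    · intro I K h
      refine h.mem_or_mem (hc _) (hc _) fun (x : Plane) _ _ => ⟨x 0, x 1, ?_⟩
      funext i
      fin_cases i
      · change x 0 * z 0 + x 1 * Plane.J z 0 = x 0
        rw [hJ0, hz0, hz1]; ring
      · change x 0 * z 1 + x 1 * Plane.J z 1 = x 1
        rw [hJ1, hz0, hz1]; ring
    · intro I K h hz x hx
      have h1 : (x : Plane) 0 * z 0 + (x : Plane) 1 * z 1 = 0 := h.orth x hx z hz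
      have h2 : (x : Plane) 0 * Plane.J z 0 + (x : Plane) 1 * Plane.J z 1 = 0 :=
        h.orth x hx _ (h.J_right z hz)
      rw [hz0, hz1] at h1
      rw [hJ0, hJ1, hz0, hz1] at h2
      funext i
      fin_cases i
      · change (x : Plane) 0 = 0
        linarith
      · change (x : Plane) 1 = 0
        linarith

theorem isNilpotent_L42 : L42.IsNilpotent :=
  isNilpotent_of_lie_lie_lie (g := LSpace) fun _ _ _ _ => by ext <;> simp

namespace LSpace

/-- The standard basis vectors of `𝓛`. -/
def e (i : Fin 6) : LSpace := (Pi.single i 1 : Fin 6 → ℝ)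

theorem e_apply (i j : Fin 6) : e i j = if j = i then 1 else 0 := by
  change (Pi.single i 1 : Fin 6 → ℝ) j = _
  rw [Pi.single_apply]

theorem comb_eq (x : LSpace) (h0 : x 0 = 0) (h1 : x 1 = 0) (h2 : x 2 = 0) (h3 : x 3 = 0) :
    x 4 • e 4 + x 5 • J (e 4) = x := by
  ext <;> simp [e_apply, *]

theorem lie_e_0 (x : LSpace) (h1 : x 1 = 0) : ⁅e 0, x⁆ = (0 : ℝ) • e 4 + (-x 2) • J (e 4) := by
  ext <;> simp [e_apply, *]

end LSpace

-- The marker is `x₃`, whose complex line is exactly Z ∩ JZ. Elements of the other summand are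
-- orthogonal to this line, and their brackets with `x₁` fall into both summands; applied to `x` and
-- `J x`, this confines them to the line itself.
open LSpace in
theorem isIndecomposable_L42 : L42.IsIndecomposable := by
  constructor
  · refine ⟨(e 0 : LSpace), (0 : LSpace), fun h => one_ne_zero (α := ℝ) ?_⟩
    simpa [e_apply] using congrFun h 0
  · refine not_isDecomposable (A := L42) (z := e 4) ?_ ?_
    · intro I K h
      refine h.mem_or_mem (fun (y : LSpace) => ?_) (fun (y : LSpace) => ?_)
        fun (x : LSpace) hx hx' => ⟨_, _, comb_eq x ?_ ?_ ?_ ?_⟩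
      · change ⁅e 4, y⁆ = (0 : LSpace)
        ext <;> simp [e_apply]
      · change ⁅LSpace.J (e 4), y⁆ = (0 : LSpace)
        ext <;> simp [e_apply]
      · have k : (⁅e 0, LSpace.J x⁆ : LSpace) 2 = 0 := congrFun (hx'.lie' (e 0)) 2
        simpa [e_apply] using k
      · have k : (⁅e 0, x⁆ : LSpace) 2 = 0 := congrFun (hx.lie' (e 0)) 2
        simpa [e_apply] using k
      · have k : (⁅e 0, x⁆ : LSpace) 5 = 0 := congrFun (hx.lie' (e 0)) 5
        simpa [e_apply] using k
      · have k : (⁅e 0, LSpace.J x⁆ : LSpace) 5 = 0 := congrFun (hx'.lie' (e 0)) 5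
        simpa [e_apply] using k
    · intro I K h hz
      have key : ∀ x : LSpace, x ∈ I → x 1 = 0 ∧ x 2 = 0 := by
        intro x hx
        have h1 : LSpace.φ x (LSpace.J (e 4)) = 0 := h.orth x hx _ (h.J_right _ hz)
        have h1' : x 1 = 0 := by simpa [LSpace.φ_apply, e_apply] using h1
        have h2 : (⁅e 0, x⁆ : LSpace) = 0 :=
          h.eq_zero_of_comb hz (lie_mem_right ℝ _ I _ x hx) (lie_e_0 x h1').symm
        refine ⟨h1', ?_⟩
        simpa [e_apply] using congrFun h2 5
      intro x hx
      obtain ⟨h1, h2⟩ := key x hx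
      obtain ⟨h3, h4⟩ := key _ (h.J_left x hx)
      exact h.eq_zero_of_comb hz hx (comb_eq x h3 h1 h2 (neg_eq_zero.1 h4))

namespace KT

/-- The dual basis of the Kodaira-Thurston algebra. -/
def coord (i : Fin 4) : Module.Dual ℝ KT where
  toFun x := x i
  map_add' _ _ := rfl
  map_smul' _ _ := rfl

theorem zero_θ (x y z : KT) : (TStarCocycle.zero J).θ x y z = 0 := rfl

end KT

namespace TStar

variable {c : TStarCocycle KT.J}

theorem ext_KT {x y : TStar c} (h0 : x.1 0 = y.1 0) (h1 : x.1 1 = y.1 1) (h2 : x.1 2 = y.1 2)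
    (h3 : x.1 3 = y.1 3) (k0 : x.2 (KT.e 0) = y.2 (KT.e 0)) (k1 : x.2 (KT.e 1) = y.2 (KT.e 1))
    (k2 : x.2 (KT.e 2) = y.2 (KT.e 2)) (k3 : x.2 (KT.e 3) = y.2 (KT.e 3)) : x = y := by
  apply TStar.ext
  · ext <;> assumption
  · intro w
    rw [KT.eq_sum w]
    simp [*]

/-- The inclusion of the Kodaira-Thurston algebra as a subspace. -/
def vec (c : TStarCocycle KT.J) (i : Fin 4) : TStar c := (KT.e i, 0)

/-- The dual basis vectors. -/
def covec (c : TStarCocycle KT.J) (i : Fin 4) : TStar c := (0, KT.coord i)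

theorem vec_fst (i : Fin 4) : (vec c i).1 = KT.e i := rfl
theorem vec_snd (i : Fin 4) (w : KT) : (vec c i).2 w = 0 := rfl
theorem covec_fst (i : Fin 4) : (covec c i).1 = 0 := rfl
theorem covec_snd (i : Fin 4) (w : KT) : (covec c i).2 w = w i := rfl

end TStar

open TStar

theorem isNilpotent_T0k : T0k.IsNilpotent :=
  isNilpotent_of_lie_lie_lie (g := TStar (TStarCocycle.zero KT.J)) fun _ _ _ _ => by
    apply ext_KT <;> simp [KT.zero_θ, KT.lie_e_0, KT.lie_e_1, KT.lie_e_2, KT.lie_e_3]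

theorem isNilpotent_Tθ₃k : Tθ₃k.IsNilpotent :=
  isNilpotent_of_lie_lie_lie (g := TStar KT.θ₃) fun _ _ _ _ => by
    apply ext_KT <;> simp [KT.θ₃_apply, KT.lie_e_0, KT.lie_e_1, KT.lie_e_2, KT.lie_e_3, KT.e_apply]

theorem nontrivial_TStar (c : TStarCocycle KT.J) : Nontrivial (TStar c) := by
  refine ⟨vec c 0, 0, fun h => ?_⟩
  have := congrArg (fun x : TStar c => x.1 0) h
  simp [vec_fst, KT.e_apply] at this

/-- Here Z ∩ JZ is larger than a complex line, so `mem_or_mem` does not apply. The marker `x₃` is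
located by splitting both factors of `⁅x₁, x₂⁆ = x₃`. -/
theorem isIndecomposable_T0k : T0k.IsIndecomposable := by
  refine ⟨nontrivial_TStar (TStarCocycle.zero KT.J), ?_⟩
  set c := TStarCocycle.zero KT.J with hc
  have hJz : ∀ p q : ℝ, (p • vec c 2 + q • JT c (vec c 2)).1 2 = p := by
    intro p q; simp [vec_fst, KT.e_apply]
  have lie_1 : ∀ x : TStar c, x.2 (KT.e 2) = 0 → x.1 0 • vec c 2 + (0 : ℝ) • JT c (vec c 2)
      = ⁅x, vec c 1⁆ := by
    intro x h
    apply ext_KT <;> simp [vec_fst, vec_snd, hc, KT.zero_θ, KT.lie_e_0, KT.lie_e_1, KT.lie_e_2,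
      KT.lie_e_3, KT.e_apply, h]
  have lie_0 : ∀ x : TStar c, x.2 (KT.e 2) = 0 → (x.1 1) • vec c 2 + (0 : ℝ) • JT c (vec c 2)
      = ⁅vec c 0, x⁆ := by
    intro x h
    apply ext_KT <;> simp [vec_fst, vec_snd, hc, KT.zero_θ, KT.lie_e_0, KT.lie_e_1, KT.lie_e_2,
      KT.lie_e_3, KT.e_apply, h]
  refine not_isDecomposable (A := T0k) (z := vec c 2) ?_ ?_
  · intro I K h
    have e01 : ⁅vec c 0, vec c 1⁆ = vec c 2 := by
      apply ext_KT <;> simp [vec_fst, vec_snd, hc, KT.zero_θ, KT.e_apply]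
    obtain ⟨(i : TStar c), hi, (k : TStar c), hk, hik⟩ := h.split (vec c 0)
    obtain ⟨(i' : TStar c), hi', (k' : TStar c), hk', hik'⟩ := h.split (vec c 1)
    have h1 : ⁅i, vec c 1⁆ = ⁅i, i'⁆ := h.lie_split_left hi hk' hik'
    have h2 : ⁅vec c 0, i'⁆ = ⁅i, i'⁆ := by
      rw [← lie_skew, ← lie_skew i i', neg_inj]
      exact h.lie_split_left hi' hk hik
    -- The bracket `⁅x₁, i'⁆` has no `x₁*`-coefficient, whereas that of `⁅i, x₂⁆` is minus the
    -- `x₃*`-coefficient of `i`.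
    have h3 : i.2 (KT.e 2) = 0 := by
      have := congrArg (fun v : TStar c => v.2 (KT.e 0)) (h1.trans h2.symm)
      simpa [vec_fst, vec_snd, hc, KT.zero_θ, KT.lie_e_0, KT.e_apply] using this
    have h4 := lie_1 i h3
    rw [zero_smul, add_zero] at h4
    by_cases h0 : i.1 0 = 0
    · right
      rw [h0, zero_smul] at h4
      rw [← e01, ← show i + k = vec c 0 from hik, add_lie, ← h4, zero_add]
      exact lie_mem_left ℝ _ K k (vec c 1) hk
    · left
      have h5 : (i.1 0)⁻¹ • ⁅i, vec c 1⁆ = vec c 2 := by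
        rw [← h4, smul_smul, inv_mul_cancel₀ h0, one_smul]
      rw [← h5]
      exact I.smul_mem _ (lie_mem_left ℝ _ I i (vec c 1) hi)
  · intro I K h hz
    have key : ∀ x : TStar c, x ∈ I → x.1 0 = 0 ∧ x.1 1 = 0 ∧ x.2 (KT.e 2) = 0
        ∧ x.2 (KT.e 3) = 0 := by
      intro x hx
      have h1 : φT c x (vec c 2) = 0 := h.orth x hx _ hz
      have h2 : φT c x (JT c (vec c 2)) = 0 := h.orth x hx _ (h.J_right _ hz)
      simp [φT_apply, vec_fst, vec_snd, KT.J_e_2] at h1 h2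
      have h3 : ⁅x, vec c 1⁆ = 0 :=
        h.eq_zero_of_comb hz (lie_mem_left ℝ _ I x (vec c 1) hx) (lie_1 x h1)
      have h4 : ⁅vec c 0, x⁆ = 0 :=
        h.eq_zero_of_comb hz (lie_mem_right ℝ _ I (vec c 0) x hx) (lie_0 x h1)
      rw [← lie_1 x h1] at h3
      rw [← lie_0 x h1] at h4
      refine ⟨?_, ?_, h1, h2⟩
      · rw [← hJz (x.1 0) 0, h3]; rfl
      · rw [← hJz (x.1 1) 0, h4]; rfl
    intro x hx
    -- Elements of `I` have no `x₁, x₂, x₃*, x₄*` coordinates, so `I` is totally isotropic; being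
    -- also orthogonal to `K`, it is zero.
    apply T0k.eq_zero_of_φ
    intro y
    obtain ⟨i, hi, k, hk, rfl⟩ := h.split y
    rw [map_add, h.orth x hx k hk, add_zero]
    obtain ⟨a0, a1, a2, a3⟩ := key x hx
    obtain ⟨b0, b1, b2, b3⟩ := key i hi
    change (x : TStar c).2 (i : TStar c).1 + (i : TStar c).2 (x : TStar c).1 = 0
    rw [KT.eq_sum (i : TStar c).1, KT.eq_sum (x : TStar c).1]
    simp [a0, a1, a2, a3, b0, b1, b2, b3]

/-- The marker is `x₁*`, whose complex line is Z ∩ JZ. In the other summand, `⁅⁅x₁, x⁆, x₂⁆` detects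
the `x₄`-coordinate and then `⁅x₁, x⁆` the `x₃*`-coordinate; `J`-invariance handles their partners.
-/
theorem isIndecomposable_Tθ₃k : Tθ₃k.IsIndecomposable := by
  refine ⟨nontrivial_TStar KT.θ₃, ?_⟩
  set c := KT.θ₃ with hc
  have Jz : JT c (covec c 0) = covec c 1 := by
    apply ext_KT <;> simp [covec_fst, covec_snd, KT.e_apply]
  have comb_eq : ∀ x : TStar c, x.1 = 0 → x.2 (KT.e 2) = 0 → x.2 (KT.e 3) = 0 →
      x.2 (KT.e 0) • covec c 0 + x.2 (KT.e 1) • JT c (covec c 0) = x := by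
    intro x h1 h2 h3
    rw [Jz]
    apply ext_KT <;> simp [covec_fst, covec_snd, h1, h2, h3, KT.e_apply]
  have lie_lie : ∀ x : TStar c, x.1 0 = 0 → x.1 1 = 0 →
      (x.1 3) • covec c 0 + (0 : ℝ) • JT c (covec c 0) = ⁅⁅vec c 0, x⁆, vec c 1⁆ := by
    intro x h0 h1
    rw [Jz]
    apply ext_KT <;> simp [covec_fst, covec_snd, vec_fst, vec_snd, hc, KT.θ₃_apply, KT.lie_e_0,
      KT.lie_e_1, KT.lie_e_2, KT.lie_e_3, KT.e_apply, h0, h1]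
  have lie_0 : ∀ x : TStar c, x.1 = 0 →
      (0 : ℝ) • covec c 0 + (-x.2 (KT.e 2)) • JT c (covec c 0) = ⁅vec c 0, x⁆ := by
    intro x h0
    rw [Jz]
    apply ext_KT <;> simp [covec_fst, covec_snd, vec_fst, vec_snd, KT.lie_e_0,
      KT.lie_e_1, KT.lie_e_2, KT.lie_e_3, KT.e_apply, h0]
  refine not_isDecomposable (A := Tθ₃k) (z := covec c 0) ?_ ?_
  · intro I K h
    refine h.mem_or_mem (fun (y : TStar c) => ?_) (fun (y : TStar c) => ?_)
      fun (x : TStar c) hx hx' => ⟨_, _, comb_eq x ?_ ?_ ?_⟩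
    · change ⁅covec c 0, y⁆ = (0 : TStar c)
      apply ext_KT <;> simp [covec_fst, covec_snd]
    · change ⁅JT c (covec c 0), y⁆ = (0 : TStar c)
      rw [Jz]
      apply ext_KT <;> simp [covec_fst, covec_snd]
    all_goals
      have k1 : ⁅x, vec c 1⁆ = (0 : TStar c) := hx (vec c 1)
      have k2 : ⁅x, vec c 0⁆ = (0 : TStar c) := hx (vec c 0)
      have k3 : ⁅JT c x, vec c 0⁆ = (0 : TStar c) := hx' (vec c 0)
      have l0 := congrArg (fun v : TStar c => v.1 2) k1
      have l1 := congrArg (fun v : TStar c => v.1 2) k2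
      have l2 := congrArg (fun v : TStar c => v.2 (KT.e 3)) k2
      have l3 := congrArg (fun v : TStar c => v.2 (KT.e 2)) k2
      have l4 := congrArg (fun v : TStar c => v.2 (KT.e 1)) k2
      have l5 := congrArg (fun v : TStar c => v.2 (KT.e 1)) k3
      simp [vec_fst, vec_snd, hc, KT.θ₃_apply, KT.lie_e_1, KT.lie_e_2, KT.lie_e_3, KT.e_apply,
        KT.J_e_2] at l0 l1 l2 l3 l4 l5
    · ext <;> assumption
    · assumption
    · assumption
  · intro I K h hz
    have key : ∀ x : TStar c, x ∈ I → x.1 0 = 0 ∧ x.1 1 = 0 ∧ x.1 3 = 0 := by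
      intro x hx
      have h1 : φT c x (covec c 0) = 0 := h.orth x hx _ hz
      have h2 : φT c x (JT c (covec c 0)) = 0 := h.orth x hx _ (h.J_right _ hz)
      rw [Jz] at h2
      simp [φT_apply, covec_fst, covec_snd] at h1 h2
      have h3 : ⁅⁅vec c 0, x⁆, vec c 1⁆ = 0 :=
        h.eq_zero_of_comb hz (lie_mem_left ℝ _ I (⁅vec c 0, x⁆ : TStar c) (vec c 1)
          (lie_mem_right ℝ _ I (vec c 0) x hx)) (lie_lie x h1 h2)
      rw [← lie_lie x h1 h2] at h3
      have h4 := congrArg (fun v : TStar c => v.2 (KT.e 0)) h3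
      simp [covec_snd, Jz, KT.e_apply] at h4
      exact ⟨h1, h2, h4⟩
    have key' : ∀ x : TStar c, x ∈ I → x.1 = 0 ∧ x.2 (KT.e 2) = 0 := by
      intro x hx
      obtain ⟨h0, h1, h3⟩ := key x hx
      have h2 : x.1 2 = 0 := (key _ (h.J_left x hx)).2.2
      have hx1 : x.1 = 0 := by ext <;> assumption
      have h4 : ⁅vec c 0, x⁆ = 0 :=
        h.eq_zero_of_comb hz (lie_mem_right ℝ _ I (vec c 0) x hx) (lie_0 x hx1)
      rw [← lie_0 x hx1] at h4
      have h5 := congrArg (fun v : TStar c => v.2 (KT.e 1)) h4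
      simp [covec_snd, Jz, KT.e_apply] at h5
      exact ⟨hx1, h5⟩
    intro (x : TStar c) hx
    obtain ⟨h1, h2⟩ := key' x hx
    have h3 : (JT c x).2 (KT.e 2) = 0 := (key' _ (h.J_left x hx)).2
    rw [JT_snd, KT.J_e_2, neg_eq_zero] at h3
    exact h.eq_zero_of_comb hz hx (comb_eq x h1 h2 h3)

/-! ### The models are pairwise inequivalent -/

theorem Equivalent.dim_eq {A B : PHQAlgebra} (h : Equivalent A B) : A.dim = B.dim := by
  obtain ⟨ψ, -, -⟩ := h
  exact ψ.toLinearEquiv.finrank_eq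

theorem not_equivalent_R02_R20 : ¬ Equivalent R02 R20 := by
  rintro ⟨ψ, -, hφ⟩
  let z : Plane := (![1, 0] : Fin 2 → ℝ)
  have h : -(Plane.φ (ψ z) (ψ z)) = Plane.φ z z := hφ z z
  have h1 : Plane.φ z z = 1 * 1 + 0 * 0 := rfl
  have h2 : Plane.φ (ψ z) (ψ z) = (ψ z : Plane) 0 * (ψ z : Plane) 0
    + (ψ z : Plane) 1 * (ψ z : Plane) 1 := rfl
  nlinarith [mul_self_nonneg ((ψ z : Plane) 0), mul_self_nonneg ((ψ z : Plane) 1)]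

/-- Every bracket has non-negative square length in `L42` and non-positive in `L24`, while `⁅x₁, J
x₁⁆` has square length 1 in `L42`. -/
theorem not_equivalent_L42_L24 : ¬ Equivalent L42 L24 := by
  rintro ⟨ψ, -, hφ⟩
  have h0 : ∀ x y : LSpace, 0 ≤ LSpace.φ ⁅x, y⁆ ⁅x, y⁆ := by
    intro x y
    have : LSpace.φ ⁅x, y⁆ ⁅x, y⁆ = (x 0 * y 1 - x 1 * y 0) ^ 2 := by
      simp [LSpace.φ_apply, pow_two]
    rw [this]
    positivity
  obtain ⟨f, hlie, h⟩ : ∃ f : LSpace → LSpace, (∀ x y, f ⁅x, y⁆ = ⁅f x, f y⁆) ∧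
      ∀ v, -(LSpace.φ (f v) (f v)) = LSpace.φ v v :=
    ⟨ψ, fun x y => LieEquiv.map_lie ψ x y, fun v => hφ v v⟩
  have h1 : LSpace.φ ⁅LSpace.e 0, LSpace.e 1⁆ ⁅LSpace.e 0, LSpace.e 1⁆ = 1 := by
    simp [LSpace.φ_apply, LSpace.e_apply]
  have h2 := h ⁅LSpace.e 0, LSpace.e 1⁆
  rw [h1, hlie] at h2
  linarith [h0 (f (LSpace.e 0)) (f (LSpace.e 1))]

/-- `T0k` is two-step nilpotent, whereas `⁅⁅x₁, x₂⁆, x₁⁆ = -x₄*` in `Tθ₃k`. -/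
theorem not_equivalent_T0k_Tθ₃k : ¬ Equivalent T0k Tθ₃k := by
  intro h
  obtain ⟨ψ, -, -⟩ := h.symm
  have h0 : ∀ x y w : TStar (TStarCocycle.zero KT.J), ⁅⁅x, y⁆, w⁆ = 0 := by
    intro x y w
    apply ext_KT <;> simp [KT.zero_θ, KT.lie_e_0, KT.lie_e_1, KT.lie_e_2, KT.lie_e_3]
  obtain ⟨f, hlie, hinj, hf0⟩ : ∃ f : TStar KT.θ₃ → TStar (TStarCocycle.zero KT.J),
      (∀ x y, f ⁅x, y⁆ = ⁅f x, f y⁆) ∧ Function.Injective f ∧ f 0 = 0 :=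
    ⟨ψ, fun x y => LieEquiv.map_lie ψ x y, ψ.injective, map_zero ψ⟩
  have h1 : ∀ x y w : TStar KT.θ₃, ⁅⁅x, y⁆, w⁆ = 0 := by
    intro x y w
    apply hinj
    rw [hlie, hlie, h0, hf0]
  have h3 := congrArg (fun v : TStar KT.θ₃ => v.2 (KT.e 3))
    (h1 (vec KT.θ₃ 0) (vec KT.θ₃ 1) (vec KT.θ₃ 0))
  simp [vec_fst, vec_snd, KT.θ₃_apply, KT.e_apply] at h3

theorem Label.eq_of_equivalent {i j : Label} (h : Equivalent i.alg j.alg) : i = j := by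
  have hd := h.dim_eq
  have d1 : PHQ.R02.dim = 2 := dim_Plane
  have d2 : PHQ.R20.dim = 2 := dim_Plane
  have d3 : PHQ.L42.dim = 6 := dim_LSpace
  have d4 : PHQ.L24.dim = 6 := dim_LSpace
  have d5 : PHQ.T0k.dim = 8 := dim_TStar _
  have d6 : PHQ.Tθ₃k.dim = 8 := dim_TStar _
  cases i <;> cases j <;> simp only [Label.alg] at h hd <;> first
    | rfl
    | (exfalso; omega)
    | exact absurd h not_equivalent_R02_R20
    | exact absurd h.symm not_equivalent_R02_R20
    | exact absurd h not_equivalent_L42_L24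
    | exact absurd h.symm not_equivalent_L42_L24
    | exact absurd h not_equivalent_T0k_Tθ₃k
    | exact absurd h.symm not_equivalent_T0k_Tθ₃k

theorem Label.alg_properties (i : Label) :
    i.alg.IsNilpotent ∧ i.alg.IsIndecomposable ∧ i.alg.dim ≤ 8 := by
  cases i
  · exact ⟨isNilpotent_R02, isIndecomposable_R02, dim_Plane.le.trans (by norm_num)⟩
  · exact ⟨isNilpotent_R02, isIndecomposable_R02.opposite, dim_Plane.le.trans (by norm_num)⟩
  · exact ⟨isNilpotent_L42, isIndecomposable_L42, dim_LSpace.le.trans (by norm_num)⟩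
  · exact ⟨isNilpotent_L42, isIndecomposable_L42.opposite, dim_LSpace.le.trans (by norm_num)⟩
  · exact ⟨isNilpotent_T0k, isIndecomposable_T0k, (dim_TStar _).le⟩
  · exact ⟨isNilpotent_Tθ₃k, isIndecomposable_Tθ₃k, (dim_TStar _).le⟩

end PHQ

theorem mainTheorem2 :
    (∀ i : PHQ.Label, i.alg.IsNilpotent ∧ i.alg.IsIndecomposable ∧ i.alg.dim ≤ 8) ∧
    ∀ A : PHQ.PHQAlgebra.{u}, A.IsNilpotent → A.IsIndecomposable → A.dim ≤ 8 →
      ∃! i : PHQ.Label, PHQ.Equivalent A i.alg := by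
  refine ⟨PHQ.Label.alg_properties, fun A hA hI hdim => ?_⟩
  obtain ⟨i, hi⟩ := hI.exists_equivalent hA hdim
  exact ⟨i, hi, fun j hj => PHQ.Label.eq_of_equivalent (hj.symm.trans hi)⟩
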